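/- Let $n>1$, and consider integers $n_0\ge 0$, $k\ge 0$, $n_1,\dots,n_k\ge 1$ with $\mathbb{R}^{n+1}=\mathbb{R}^{n_0}\oplus\mathbb{C}^{n_1}\oplus\cdots\oplus\mathbb{C}^{n_k}$ (with the product Euclidean metric, so $n_0+2\sum_i n_i=n+1$), with points written $x=(\mathbf{x}_0,\mathbf{z}_1,\dots,\mathbf{z}_k)$. Let $(M,h)=(S^n,h)$ be its unit sphere, with the standard Riemannian metric $h$, and let $W$ be the Killing vector field on $S^n$ $$W(\mathbf{x}_0,\mathbf{z}_1,\dots,\mathbf{z}_k)=(0,\sqrt{-1}\,\lambda_1\mathbf{z}_1,\dots,\sqrt{-1}\,\lambda_k\mathbf{z}_k),\qquad 0<\lambda_1<\cdots<\lambda_k<1 .$$ Let $F$ be the Randers metric with navigation datum $(h,W)$, i.e. $$F(y)=\frac{\sqrt{\lambda\,h(y,y)+h(W,y)^2}}{\lambda}-\frac{h(W,y)}{\lambda},\qquad \lambda=1-h(W,W).$$ Assume that one of the following two conditions holds. (A4) All $\lambda_i$ are irrational, and for all $1\le i<j\le k$ the numbers $1,\lambda_i,\lambda_j$ are linearly independent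 over $\mathbb{Q}$. (A5) $n_0=0$; exactly one $\lambda_i$ is rational, and $n_i=1$ for this $i$; and $1,\lambda_i,\lambda_j$ are linearly independent over $\mathbb{Q}$ whenever $i<j$ and $\lambda_i,\lambda_j$ are irrational. Let $G=I_o(M,F)$ be the identity component of the isometry group of $(M,F)$. The group $\hat G=G\times(\mathbb{R}/\mathbb{Z})$ acts on closed curves $c:\mathbb{R}/\mathbb{Z}\to M$ by $((g,t')\cdot c)(t)=g\cdot c(t+t')$. A closed geodesic is a curve $\gamma:\mathbb{R}/\mathbb{Z}\to M$ that is a geodesic of $F$ of positive constant speed; it is prime if $\min\{t>0:\gamma(t)=\gamma(0)\}=1$. For an orbit $\mathcal{B}=\hat G\cdot\gamma$ of a prime closed geodesic let $B\subset M$ be the union of the curves in $\mathcal{B}$; two orbits are geometrically distinct if their unions are different subsets of $M$. Let $H$ be the subgroup of all $g\in G$ such that for every closed geodesic $\gamma$ there is a $t_0$ with $g\cdot\gamma(t)=\gamma(t+t_0)$ for all $t$; let $H_o$ be its identity component, and let $m=\dim H$ be the dimension of the Lie group $H$. Then: (1) $(M,F)$ satisfies Assumption (F): there are only finitely many $\hat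 G$-orbits of prime closed geodesics. (2) There are exactly $m$ geometrically distinct orbits $\mathcal{B}_i$ of prime closed geodesics (that is, exactly $m$ different subsets $B_i\subset M$) such that $B_i$ is a totally geodesic submanifold of $(M,F)$ on which $H_o$ acts non-trivially. -/

import Mathlib

open scoped Manifold ContDiff

noncomputable section

namespace Finsler

section General

variable {E : Type*} [NormedAddCommGroup E] [NormedSpace ℝ E]
  {M : Type*} [TopologicalSpace M] [ChartedSpace E M]

/-- The velocity vector `ċ(t)` of a curve in a manifold. -/
def velocity (c : ℝ → M) (t : ℝ) : TangentSpace 𝓘(ℝ, E) (c t) :=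
  mfderiv 𝓘(ℝ, ℝ) 𝓘(ℝ, E) c t (1 : ℝ)

/-- The energy `∫ₐᵇ F(ċ(t))² dt` of a curve. -/
def energy (F : ∀ x : M, TangentSpace 𝓘(ℝ, E) x → ℝ) (c : ℝ → M) (a b : ℝ) : ℝ :=
  ∫ t in a..b, F (c t) (velocity (E := E) c t) ^ 2

/-- `c` is a geodesic (of positive constant speed) of `(N, F|_N)`, where `N` is a submanifold
of `M`: a smooth curve in `N` of positive constant `F`-speed which is a critical point of the
energy, on each compact interval, among the smooth variations inside `N` with fixed endpoints.
For `N = Set.univ` these are the geodesics of `(M, F)`. -/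
def IsGeodesicIn (F : ∀ x : M, TangentSpace 𝓘(ℝ, E) x → ℝ) (N : Set M) (c : ℝ → M) : Prop :=
  ContMDiff 𝓘(ℝ, ℝ) 𝓘(ℝ, E) ∞ c ∧ (∀ t, c t ∈ N) ∧
  (∃ l : ℝ, 0 < l ∧ ∀ t, F (c t) (velocity (E := E) c t) = l) ∧
  ∀ (a b : ℝ) (Γ : ℝ × ℝ → M), a < b →
    ContMDiff 𝓘(ℝ, ℝ × ℝ) 𝓘(ℝ, E) ∞ Γ → (∀ p, Γ p ∈ N) →
    (∀ t, Γ (0, t) = c t) → (∀ s, Γ (s, a) = c a) → (∀ s, Γ (s, b) = c b) →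
    HasDerivAt (fun s : ℝ => energy F (fun t => Γ (s, t)) a b) 0 0

/-- `N` is an embedded (boundaryless, pure-dimensional) smooth submanifold of `M`: near each of
its points there is a smooth chart of `M` in which `N` is a linear slice. -/
def IsEmbeddedSubmanifold (E : Type*) [NormedAddCommGroup E] [NormedSpace ℝ E]
    {M : Type*} [TopologicalSpace M] [ChartedSpace E M] (N : Set M) : Prop :=
  ∃ d : ℕ, ∀ x ∈ N, ∃ φ ∈ IsManifold.maximalAtlas 𝓘(ℝ, E) ∞ M, x ∈ φ.source ∧
    ∃ L : Submodule ℝ E, Module.finrank ℝ L = d ∧ ∀ y ∈ φ.source, y ∈ N ↔ φ y ∈ L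

/-- `N` is a totally geodesic submanifold of `(M, F)`: a submanifold such that all geodesics of
`(N, F|_N)` are geodesics of `(M, F)`. -/
def IsTotallyGeodesic (F : ∀ x : M, TangentSpace 𝓘(ℝ, E) x → ℝ) (N : Set M) : Prop :=
  IsEmbeddedSubmanifold E N ∧ ∀ c : ℝ → M, IsGeodesicIn F N c → IsGeodesicIn F Set.univ c

/-- Closed geodesics of positive constant speed, as curves `γ : ℝ/ℤ → M`. -/
def IsClosedGeodesic (F : ∀ x : M, TangentSpace 𝓘(ℝ, E) x → ℝ) (γ : UnitAddCircle → M) : Prop :=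
  IsGeodesicIn F Set.univ (fun t : ℝ => γ (t : UnitAddCircle))

/-- Prime closed geodesics: `1` is the least `t > 0` with `γ(t) = γ(0)`. -/
def IsPrimeClosedGeodesic (F : ∀ x : M, TangentSpace 𝓘(ℝ, E) x → ℝ)
    (γ : UnitAddCircle → M) : Prop :=
  IsClosedGeodesic F γ ∧ IsLeast {t : ℝ | 0 < t ∧ γ (t : UnitAddCircle) = γ 0} 1

/-- The isometry group `I(M, F)`: the diffeomorphisms preserving `F`. It is a subset of `C(M, M)`
and carries the compact-open topology. -/
def isometries (F : ∀ x : M, TangentSpace 𝓘(ℝ, E) x → ℝ) : Set C(M, M) :=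
  {g | ∃ Φ : M ≃ₘ^∞⟮𝓘(ℝ, E), 𝓘(ℝ, E)⟯ M, (∀ x, Φ x = g x) ∧
    ∀ (x : M) (y : TangentSpace 𝓘(ℝ, E) x),
      F (Φ x) (mfderiv 𝓘(ℝ, E) 𝓘(ℝ, E) Φ x y) = F x y}

/-- The connected isometry group `G = I_o(M, F)`. -/
def connIsometries (F : ∀ x : M, TangentSpace 𝓘(ℝ, E) x → ℝ) : Set C(M, M) :=
  connectedComponentIn (isometries F) (ContinuousMap.id M)

/-- The orbit of a closed curve under `Ĝ = G × S¹`, `((g, t') · γ)(t) = g (γ (t + t'))`. -/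
def curveOrbit (F : ∀ x : M, TangentSpace 𝓘(ℝ, E) x → ℝ) (γ : UnitAddCircle → M) :
    Set (UnitAddCircle → M) :=
  {c | ∃ g ∈ connIsometries F, ∃ t' : UnitAddCircle, ∀ t, c t = g (γ (t + t'))}

/-- The orbits `𝓑 = Ĝ · γ` of prime closed geodesics. -/
def primeOrbits (F : ∀ x : M, TangentSpace 𝓘(ℝ, E) x → ℝ) : Set (Set (UnitAddCircle → M)) :=
  {𝓑 | ∃ γ, IsPrimeClosedGeodesic F γ ∧ 𝓑 = curveOrbit F γ}

/-- The union `B` of the curves in a set `𝓑` of closed curves. -/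
def unionOfCurves (𝓑 : Set (UnitAddCircle → M)) : Set M :=
  ⋃ c ∈ 𝓑, Set.range c

/-- Assumption (F): there are only finitely many orbits of prime closed geodesics. -/
def AssumptionF (F : ∀ x : M, TangentSpace 𝓘(ℝ, E) x → ℝ) : Prop :=
  (primeOrbits F).Finite

/-- The subgroup `H` of `G = I_o(M, F)` preserving each closed geodesic `γ`, that is,
`g (γ(t)) = γ(t + t₀)` for all `t` and some `t₀`. -/
def preservingGroup (F : ∀ x : M, TangentSpace 𝓘(ℝ, E) x → ℝ) : Set C(M, M) :=
  {g | g ∈ connIsometries F ∧ ∀ γ : UnitAddCircle → M, IsClosedGeodesic F γ →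
    ∃ t₀ : UnitAddCircle, ∀ t, g (γ t) = γ (t + t₀)}

/-- The identity component `H_o` of `H`. -/
def connPreservingGroup (F : ∀ x : M, TangentSpace 𝓘(ℝ, E) x → ℝ) : Set C(M, M) :=
  connectedComponentIn (preservingGroup F) (ContinuousMap.id M)

/-- The Lie algebra of a Lie transformation group `K` of `M`, as a space of vector fields: it
consists of the generators `X` of the continuous one-parameter subgroups `φ` of `K`. (For a Lie
group `K` these already form a linear space.) -/
def lieAlgebra (E : Type*) [NormedAddCommGroup E] [NormedSpace ℝ E]
    {M : Type*} [TopologicalSpace M] [ChartedSpace E M] (K : Set C(M, M)) :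
    Submodule ℝ (∀ x : M, TangentSpace 𝓘(ℝ, E) x) :=
  Submodule.span ℝ
    {X | ∃ φ : ℝ → C(M, M), Continuous φ ∧ (∀ t, φ t ∈ K) ∧ φ 0 = ContinuousMap.id M ∧
      (∀ s t, φ (s + t) = (φ s).comp (φ t)) ∧ ∀ x, IsMIntegralCurve (fun t => φ t x) X}

/-- The Randers metric with navigation datum `(h, W)`. -/
def randersMetric (h : ∀ x : M, TangentSpace 𝓘(ℝ, E) x → TangentSpace 𝓘(ℝ, E) x → ℝ)
    (W : ∀ x : M, TangentSpace 𝓘(ℝ, E) x) (x : M) (y : TangentSpace 𝓘(ℝ, E) x) : ℝ :=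
  √((1 - h x (W x) (W x)) * h x y y + h x (W x) y ^ 2) / (1 - h x (W x) (W x))
    - h x (W x) y / (1 - h x (W x) (W x))

end General

section Sphere

variable {V : Type*} [NormedAddCommGroup V] [InnerProductSpace ℝ V] {n : ℕ}
  [Fact (Module.finrank ℝ V = n + 1)]

/-- The differential at `x` of the inclusion of the unit sphere of `V` into `V`. -/
def sphereIncl (x : Metric.sphere (0 : V) 1) (y : TangentSpace (𝓡 n) x) : V :=
  mfderiv (𝓡 n) 𝓘(ℝ, V) ((↑) : Metric.sphere (0 : V) 1 → V) x y

/-- The standard Riemannian metric of the unit sphere of `V`. -/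
def roundMetric (x : Metric.sphere (0 : V) 1) (u v : TangentSpace (𝓡 n) x) : ℝ :=
  inner ℝ (sphereIncl x u) (sphereIncl x v)

end Sphere

/-- `ℝ^{n₀} ⊕ ℂ^{d₁} ⊕ ⋯ ⊕ ℂ^{d_k}` with the product Euclidean metric. -/
abbrev KatokSpace (n₀ : ℕ) {k : ℕ} (d : Fin k → ℕ) : Type :=
  WithLp 2 (EuclideanSpace ℝ (Fin n₀) × PiLp 2 fun i : Fin k => EuclideanSpace ℂ (Fin (d i)))

/-- The linear field `(x₀, z₁, …, z_k) ↦ (0, √-1 λ₁ z₁, …, √-1 λ_k z_k)`. -/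
def rotationField {n₀ k : ℕ} {d : Fin k → ℕ} (lam : Fin k → ℝ) (x : KatokSpace n₀ d) :
    KatokSpace n₀ d :=
  WithLp.toLp 2 (0, WithLp.toLp 2 fun i => (Complex.I * (lam i : ℂ)) • x.snd i)

/-- All `λᵢ` are irrational, and `1, λᵢ, λⱼ` are linearly independent over `ℚ` for `i < j`. -/
def ConditionA4 {k : ℕ} (lam : Fin k → ℝ) : Prop :=
  (∀ i, Irrational (lam i)) ∧ ∀ i j, i < j → LinearIndependent ℚ ![(1 : ℝ), lam i, lam j]

/-- `n₀ = 0`, exactly one `λᵢ` is rational, its block has complex dimension one, and `1, λᵢ, λⱼ`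
are linearly independent over `ℚ` for any two irrational `λᵢ, λⱼ`. -/
def ConditionA5 (n₀ : ℕ) {k : ℕ} (d : Fin k → ℕ) (lam : Fin k → ℝ) : Prop :=
  n₀ = 0 ∧ (∃! i, ¬ Irrational (lam i)) ∧ (∀ i, ¬ Irrational (lam i) → d i = 1) ∧
  ∀ i j, i < j → Irrational (lam i) → Irrational (lam j) →
    LinearIndependent ℚ ![(1 : ℝ), lam i, lam j]

end Finsler

end

/-! Write A = ∑ λᵢ Jᵢ for the skew linear field of the wind and R for its flow. Zermelo navigation
says that y has F-length l at x exactly when l ≥ 0 and |y − l A x| = l. Hence a curve c of F-speed l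
becomes, in the moving frame σ(t) = R(−lt) c(t), a curve of Euclidean speed l. Its first variation
of energy in the direction X is the integral of 2l ⟨σ', X'⟩ / (l + ⟨σ', A σ⟩). Vanishing of this
integral forces σ to be a great circle; conversely, on a great circle the weight is constant by
skewness and the integrand is exact. So the geodesics are the curves R(lt)(cos(lt) p + sin(lt) q)
with p, q orthonormal (`exists_greatCircle_of_critical`, `critical_moving_greatCircle`). The same
argument inside a flow-invariant subspace shows that its unit sphere is totally geodesic.

Applying Jᵢ to such a curve gives a superposition of rotations with frequencies (λᵢ + 1) l and (λᵢ −
1) l, while the component in the common kernel rotates with frequency l. On a closed curve each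
frequency that occurs lies in 2πℤ, and the arithmetic hypotheses leave room for one only. A closed
geodesic is therefore a circle in a complex line of one block or a great circle in the common kernel
(`IsGenericFamily.closed_moving_greatCircle`). Plane rotations commuting with all Jᵢ act
transitively on each kind, which gives finiteness. Isometries preserve the speed, and the speed of a
prime closed geodesic determines its block, so the union of an orbit in a block is the whole unit
sphere of that block.

Isometries of F are restrictions of linear isometries
(`exists_linearIsometryEquiv_of_mem_isometries`). A generator of H is thus a skew linear map D
respecting the plane of every closed geodesic; it is a multiple of Jᵢ on the i-th block. On the
common kernel D vanishes, because a vector there lies on several great circles meeting only in ±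
that vector. As all block rotations belong to H, dim H is the number of blocks, and H_o moves the
block spheres and fixes the kernel.

The argument on the kernel fails exactly when n₀ = 2: then ℝ² carries one circle, which its
rotations preserve. In that case ℝ² is added to the family as a further block of speed 0
(`isGenericFamily_optionFamily`). `IsGenericFamily` collects what the two cases have in common. -/

namespace Finsler

open Set Filter Topology MeasureTheory

/-! ### Differentiation under the integral sign -/

section ParametricIntegral

/-- Differentiation under the integral sign for a function that is `C¹` near `{0} × [a, b]`. -/
theorem hasDerivAt_integral_of_contDiffAt {f : ℝ × ℝ → ℝ} {a b : ℝ} (hab : a ≤ b)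
    (hf : ∀ t ∈ Icc a b, ContDiffAt ℝ 1 f (0, t)) :
    HasDerivAt (fun s : ℝ => ∫ t in a..b, f (s, t)) (∫ t in a..b, fderiv ℝ f (0, t) (1, 0)) 0 := by
  have hopen : IsOpen {p : ℝ × ℝ | ContDiffAt ℝ 1 f p} := by
    rw [isOpen_iff_mem_nhds]
    intro p hp
    exact ContDiffAt.eventually hp (by simp)
  -- The tube lemma makes the neighbourhood of s = 0 uniform in t, so that a constant dominates the
  -- derivative.
  obtain ⟨u, v, hu, -, hu0, hv, huv⟩ := generalized_tube_lemma (isCompact_singleton (x := (0 : ℝ)))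
    (isCompact_Icc (a := a) (b := b)) hopen (by
      rintro ⟨s, t⟩ ⟨hs, ht⟩
      obtain rfl : s = 0 := hs
      exact hf t ht)
  obtain ⟨ε, hε, hεu⟩ := Metric.nhds_basis_closedBall.mem_iff.1 (hu.mem_nhds (hu0 rfl))
  have hsm : ∀ s ∈ Metric.closedBall (0 : ℝ) ε, ∀ t ∈ Icc a b, ContDiffAt ℝ 1 f (s, t) :=
    fun s hs t ht => huv ⟨hεu hs, hv ht⟩
  have hcf : ∀ s ∈ Metric.closedBall (0 : ℝ) ε, ∀ t ∈ Icc a b,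
      ContinuousAt (fun p => fderiv ℝ f p (1, 0)) (s, t) := fun s hs t ht =>
    ((hsm s hs t ht).fderiv_right (m := 0) (by norm_num)).continuousAt.clm_apply
      continuousAt_const
  obtain ⟨C, hC⟩ := ((isCompact_closedBall (0 : ℝ) ε).prod (isCompact_Icc (a := a) (b := b))
    ).exists_bound_of_continuousOn (f := fun p => fderiv ℝ f p (1, 0))
    fun p hp => (hcf p.1 hp.1 p.2 hp.2).continuousWithinAt
  have hnh : Metric.closedBall (0 : ℝ) ε ∈ 𝓝 (0 : ℝ) := Metric.closedBall_mem_nhds _ hε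
  have h0 : (0 : ℝ) ∈ Metric.closedBall (0 : ℝ) ε := Metric.mem_closedBall_self hε.le
  have hcont : ∀ s ∈ Metric.closedBall (0 : ℝ) ε, ContinuousOn (fun t => f (s, t)) (Icc a b) :=
    fun s hs t ht => ((hsm s hs t ht).continuousAt.comp
      (f := fun t : ℝ => (s, t)) (by fun_prop)).continuousWithinAt
  have hioc : uIoc a b ⊆ Icc a b := by rw [uIoc_of_le hab]; exact Ioc_subset_Icc_self
  refine (intervalIntegral.hasDerivAt_integral_of_dominated_loc_of_deriv_le
    (F := fun s t => f (s, t)) (F' := fun s t => fderiv ℝ f (s, t) (1, 0))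
    (bound := fun _ => C) hnh ?_ ?_ ?_ ?_ ?_ ?_).2
  · filter_upwards [hnh] with s hs
    exact ((hcont s hs).mono hioc).aestronglyMeasurable measurableSet_uIoc
  · exact (hcont 0 h0).intervalIntegrable_of_Icc hab
  · refine ContinuousOn.aestronglyMeasurable (fun t ht => ?_) measurableSet_uIoc
    exact ((hcf 0 h0 t (hioc ht)).comp (f := fun t : ℝ => ((0 : ℝ), t))
      (by fun_prop)).continuousWithinAt
  · exact Eventually.of_forall fun t ht s hs => hC (s, t) ⟨hs, hioc ht⟩
  · exact intervalIntegrable_const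
  · refine Eventually.of_forall fun t ht s hs => ?_
    have h1 := ((hsm s hs t (hioc ht)).differentiableAt (by norm_num)).hasFDerivAt
    exact h1.comp_hasDerivAt s ((hasDerivAt_id s).prodMk (hasDerivAt_const s t))

end ParametricIntegral

variable {V : Type*} [NormedAddCommGroup V] [InnerProductSpace ℝ V] {n : ℕ}

/-! ### Tangent vectors and smooth maps of the sphere in ambient terms -/

section SphereInclusion

variable [Fact (Module.finrank ℝ V = n + 1)]

theorem sphereIncl_add (x : Metric.sphere (0 : V) 1) (u v : TangentSpace (𝓡 n) x) :
    sphereIncl x (u + v) = sphereIncl x u + sphereIncl x v :=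
  map_add (mfderiv (𝓡 n) 𝓘(ℝ, V) ((↑) : Metric.sphere (0 : V) 1 → V) x) u v

theorem sphereIncl_smul (x : Metric.sphere (0 : V) 1) (r : ℝ) (u : TangentSpace (𝓡 n) x) :
    sphereIncl x (r • u) = r • sphereIncl x u :=
  map_smul (mfderiv (𝓡 n) 𝓘(ℝ, V) ((↑) : Metric.sphere (0 : V) 1 → V) x) r u

theorem sphereIncl_injective (x : Metric.sphere (0 : V) 1) :
    Function.Injective (sphereIncl (n := n) x) :=
  injective_mvfderiv_subtypeVal_sphere x

theorem exists_sphereIncl_eq_iff (x : Metric.sphere (0 : V) 1) (v : V) :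
    (∃ y : TangentSpace (𝓡 n) x, sphereIncl x y = v) ↔ inner ℝ (x : V) v = 0 := by
  rw [← Submodule.mem_orthogonal_singleton_iff_inner_right, ← range_mvfderiv_subtypeVal (n := n) x]
  rfl

/-- Moves all variational computations from the sphere to V. -/
theorem contMDiff_sphere_iff {E : Type*} [NormedAddCommGroup E] [NormedSpace ℝ E]
    {f : E → Metric.sphere (0 : V) 1} :
    ContMDiff 𝓘(ℝ, E) (𝓡 n) ∞ f ↔ ContDiff ℝ ∞ (fun p => (f p : V)) := by
  rw [← contMDiff_iff_contDiff]
  exact ⟨fun h => contMDiff_coe_sphere.comp h, fun h => h.codRestrict_sphere fun p => (f p).2⟩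

theorem sphereIncl_mfderiv {E : Type*} [NormedAddCommGroup E] [NormedSpace ℝ E]
    {f : E → Metric.sphere (0 : V) 1} {p : E} (hf : MDifferentiableAt 𝓘(ℝ, E) (𝓡 n) f p) (v : E) :
    sphereIncl (f p) (mfderiv 𝓘(ℝ, E) (𝓡 n) f p v) = fderiv ℝ (fun p => (f p : V)) p v := by
  have h := mfderiv_comp p ((contMDiff_coe_sphere (m := 1) (n := n) (f p)).mdifferentiableAt one_ne_zero) hf
  rw [← mfderiv_eq_fderiv]
  exact (congrArg (fun L => L v) h).symm

theorem sphereIncl_velocity {c : ℝ → Metric.sphere (0 : V) 1} {t : ℝ}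
    (hc : MDifferentiableAt 𝓘(ℝ, ℝ) (𝓡 n) c t) :
    sphereIncl (c t) (velocity (E := EuclideanSpace ℝ (Fin n)) c t) = deriv (fun t => (c t : V)) t := by
  rw [← fderiv_apply_one_eq_deriv]
  exact sphereIncl_mfderiv hc 1

end SphereInclusion

/-! ### The Randers norm and Zermelo navigation -/

section RandersNorm

/-- The Randers norm of `y` at `x`, for the Euclidean metric and the wind `A x`. -/
noncomputable def randersNorm (A : V →L[ℝ] V) (x y : V) : ℝ :=
  √((1 - inner ℝ (A x) (A x)) * inner ℝ y y + inner ℝ (A x) y ^ 2) / (1 - inner ℝ (A x) (A x))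
    - inner ℝ (A x) y / (1 - inner ℝ (A x) (A x))

/-- The sphere of radius l for the Randers norm is the round one translated by the wind l A x. The
radicand becomes the square of l + ⟨A x, T⟩, which is nonnegative because |A x| < 1. -/
theorem randersNorm_wind_add (A : V →L[ℝ] V) {x T : V} {l : ℝ} (hx : ‖A x‖ < 1)
    (hT : ‖T‖ = l) : randersNorm A x (l • A x + T) = l := by
  have hl : 0 ≤ l := hT ▸ norm_nonneg T
  have hw : inner ℝ (A x) (A x) < 1 := by
    rw [real_inner_self_eq_norm_sq]; nlinarith [norm_nonneg (A x)]
  have ha : |inner ℝ (A x) T| ≤ ‖A x‖ * ‖T‖ := abs_real_inner_le_norm _ _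
  have hTT : inner ℝ T T = l ^ 2 := by rw [real_inner_self_eq_norm_sq, hT]
  have h0 : 0 ≤ l + inner ℝ (A x) T := by
    have := neg_abs_le (inner ℝ (A x) T)
    nlinarith
  unfold randersNorm
  have : (1 - inner ℝ (A x) (A x)) * inner ℝ (l • A x + T) (l • A x + T)
      + inner ℝ (A x) (l • A x + T) ^ 2 = (l + inner ℝ (A x) T) ^ 2 := by
    simp only [inner_add_left, inner_add_right, inner_smul_left, inner_smul_right, hTT,
      real_inner_comm (A x) T, RCLike.conj_to_real]
    ring
  rw [this, Real.sqrt_sq h0, inner_add_right, inner_smul_right, ← sub_div]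
  rw [div_eq_iff (by linarith)]
  ring

/-- Converse navigation identity: the Randers norm f of y is a root of (1 − |A x|²) f² + 2 ⟨A x, y⟩
f = |y|², which rearranges to |y − f A x|² = f². -/
theorem norm_sub_randersNorm_smul_wind (A : V →L[ℝ] V) {x : V} (hx : ‖A x‖ < 1) (y : V) :
    inner ℝ (y - randersNorm A x y • A x) (y - randersNorm A x y • A x) =
      randersNorm A x y ^ 2 := by
  have hw : 0 < 1 - inner ℝ (A x) (A x) := by
    rw [real_inner_self_eq_norm_sq]; nlinarith [norm_nonneg (A x)]
  have hr : 0 ≤ (1 - inner ℝ (A x) (A x)) * inner ℝ y y + inner ℝ (A x) y ^ 2 :=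
    add_nonneg (mul_nonneg hw.le real_inner_self_nonneg) (sq_nonneg _)
  set f := randersNorm A x y with hf
  have h1 : (1 - inner ℝ (A x) (A x)) * f + inner ℝ (A x) y =
      √((1 - inner ℝ (A x) (A x)) * inner ℝ y y + inner ℝ (A x) y ^ 2) := by
    rw [hf, randersNorm]
    field_simp
    ring
  have h2 := congrArg (· ^ 2) h1
  simp only [Real.sq_sqrt hr] at h2
  simp only [inner_sub_left, inner_sub_right, inner_smul_left, inner_smul_right,
    real_inner_comm (A x) y, RCLike.conj_to_real]
  refine mul_left_cancel₀ hw.ne' ?_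
  linear_combination -h2

theorem contDiffAt_randersNorm {E : Type*} [NormedAddCommGroup E] [NormedSpace ℝ E]
    (A : V →L[ℝ] V) {x y : E → V} {p : E} {m : ℕ∞ω} (hx : ContDiffAt ℝ m x p)
    (hy : ContDiffAt ℝ m y p) (hA : ‖A (x p)‖ < 1) (hy0 : y p ≠ 0) :
    ContDiffAt ℝ m (fun q => randersNorm A (x q) (y q)) p := by
  have hw : 0 < 1 - inner ℝ (A (x p)) (A (x p)) := by
    rw [real_inner_self_eq_norm_sq]; nlinarith [norm_nonneg (A (x p))]
  have hr : 0 < (1 - inner ℝ (A (x p)) (A (x p))) * inner ℝ (y p) (y p)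
      + inner ℝ (A (x p)) (y p) ^ 2 :=
    add_pos_of_pos_of_nonneg (mul_pos hw (real_inner_self_pos.2 hy0)) (sq_nonneg _)
  have hAx : ContDiffAt ℝ m (fun q => A (x q)) p := A.contDiff.contDiffAt.comp p hx
  have hl : ContDiffAt ℝ m (fun q => 1 - inner ℝ (A (x q)) (A (x q))) p :=
    contDiffAt_const.sub (hAx.inner ℝ hAx)
  unfold randersNorm
  exact ((((hl.mul (hy.inner ℝ hy)).add ((hAx.inner ℝ hy).pow 2)).sqrt hr.ne').div hl hw.ne').sub
    ((hAx.inner ℝ hy).div hl hw.ne')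

end RandersNorm

/-! ### One-parameter groups of linear isometries -/

/-- `R` is the one-parameter group of linear isometries generated by `A`. -/
structure IsIsometryFlow (A : V →L[ℝ] V) (R : ℝ → V →L[ℝ] V) : Prop where
  zero : R 0 = 1
  add : ∀ s t, R (s + t) = R s * R t
  contDiff : ContDiff ℝ ∞ R
  hasDerivAt : ∀ t, HasDerivAt R (A * R t) t
  norm : ∀ t x, ‖R t x‖ = ‖x‖

namespace IsIsometryFlow

variable {A : V →L[ℝ] V} {R : ℝ → V →L[ℝ] V}

theorem neg_apply (h : IsIsometryFlow A R) (t : ℝ) (x : V) : R (-t) (R t x) = x := by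
  have := h.add (-t) t
  rw [neg_add_cancel, h.zero] at this
  exact (congrArg (fun L => L x) this).symm

theorem apply_neg (h : IsIsometryFlow A R) (t : ℝ) (x : V) : R t (R (-t) x) = x := by
  simpa using h.neg_apply (-t) x

theorem inner_map_map (h : IsIsometryFlow A R) (t : ℝ) (x y : V) : inner ℝ (R t x) (R t y) = inner ℝ x y := by
  rw [real_inner_eq_norm_add_mul_self_sub_norm_mul_self_sub_norm_mul_self_div_two, ← map_add,
    h.norm, h.norm, h.norm,
    ← real_inner_eq_norm_add_mul_self_sub_norm_mul_self_sub_norm_mul_self_div_two]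

/-- Both sides come from the derivative at s = 0 of R(t + s) = R(t) R(s). -/
theorem comm (h : IsIsometryFlow A R) (t : ℝ) (x : V) : A (R t x) = R t (A x) := by
  have h0 : HasDerivAt R A 0 := by simpa [h.zero] using h.hasDerivAt 0
  have h1 : HasDerivAt (fun s => R t * R s) (R t * A) 0 := h0.const_mul (R t)
  have h2 : HasDerivAt (fun s => R t * R s) (A * R t) 0 := by
    have h3 := HasDerivAt.scomp (𝕜' := ℝ) (0 : ℝ) (g₁ := R) (h := fun s => t + s)
      (by simpa using h.hasDerivAt t) ((hasDerivAt_id (0 : ℝ)).const_add t)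
    simp only [one_smul] at h3
    refine h3.congr_of_eventuallyEq (Eventually.of_forall fun s => ?_)
    exact (h.add t s).symm
  exact congrArg (fun L => L x) (h2.unique h1)

/-- Skewness of the generator is the derivative at 0 of the constant |R(s) x|². -/
theorem inner_map_self (h : IsIsometryFlow A R) (x : V) : inner ℝ (A x) x = 0 := by
  have h0 : HasDerivAt R A 0 := by simpa [h.zero] using h.hasDerivAt 0
  have h1 : HasDerivAt (fun s => R s x) (A x) 0 := by
    simpa using h0.clm_apply (hasDerivAt_const (0 : ℝ) x)
  have h2 := h1.inner ℝ h1
  simp only [h.inner_map_map, h.zero] at h2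
  have := h2.unique (hasDerivAt_const _ _)
  simp [real_inner_comm] at this
  rw [real_inner_comm]; linarith

theorem randersNorm_map (h : IsIsometryFlow A R) (t : ℝ) (x y : V) :
    randersNorm A (R t x) (R t y) = randersNorm A x y := by
  unfold randersNorm
  simp only [h.comm, h.inner_map_map]

end IsIsometryFlow

end Finsler

/-! ### First variation of the energy in the moving frame -/

namespace Finsler

open Set Filter Topology MeasureTheory

variable {V : Type*} [NormedAddCommGroup V] [InnerProductSpace ℝ V] {n : ℕ}

theorem fderiv_apply_right_eq_deriv {σ : ℝ × ℝ → V} {s t : ℝ}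
    (hσ : DifferentiableAt ℝ σ (s, t)) :
    HasDerivAt (fun t => σ (s, t)) (fderiv ℝ σ (s, t) (0, 1)) t :=
  hσ.hasFDerivAt.comp_hasDerivAt t ((hasDerivAt_const t s).prodMk (hasDerivAt_id t))

theorem fderiv_apply_left_eq_deriv {σ : ℝ × ℝ → V} {s t : ℝ}
    (hσ : DifferentiableAt ℝ σ (s, t)) :
    HasDerivAt (fun s => σ (s, t)) (fderiv ℝ σ (s, t) (1, 0)) s :=
  hσ.hasFDerivAt.comp_hasDerivAt s ((hasDerivAt_id s).prodMk (hasDerivAt_const s t))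

theorem contDiff_fderiv_apply_const {E : Type*} [NormedAddCommGroup E] [NormedSpace ℝ E]
    {σ : E → V} (hσ : ContDiff ℝ ∞ σ) (v : E) : ContDiff ℝ ∞ fun p => fderiv ℝ σ p v :=
  (hσ.fderiv_right (m := ∞) le_rfl).clm_apply contDiff_const

/-- Symmetry of the mixed second derivatives of a smooth variation. -/
theorem hasDerivAt_variationField {σ : ℝ × ℝ → V} (hσ : ContDiff ℝ ∞ σ) (s t : ℝ) :
    HasDerivAt (fun t => fderiv ℝ σ (s, t) (1, 0))
      (fderiv ℝ (fun p => fderiv ℝ σ p (0, 1)) (s, t) (1, 0)) t := by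
  have hd : DifferentiableAt ℝ (fderiv ℝ σ) (s, t) :=
    (hσ.fderiv_right (m := ∞) le_rfl).differentiable (by simp) _
  have hsymm : IsSymmSndFDerivAt ℝ σ (s, t) := hσ.contDiffAt.isSymmSndFDerivAt
    (by rw [minSmoothness_of_isRCLikeNormedField]; exact WithTop.coe_le_coe.2 le_top)
  have h1 := fderiv_apply_right_eq_deriv (s := s) (t := t)
    (σ := fun p => fderiv ℝ σ p (1, 0))
    ((contDiff_fderiv_apply_const hσ (1, 0)).differentiable (by simp) _)
  convert h1 using 1
  rw [fderiv_clm_apply hd (differentiableAt_const _), fderiv_clm_apply hd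
    (differentiableAt_const _)]
  simpa using hsymm.eq (1, 0) (0, 1)

section FirstVariation

variable {A : V →L[ℝ] V} {R : ℝ → V →L[ℝ] V}

/-- Up to the isometry R(lt), the velocity is l A σ + σ', the shape to which navigation applies. -/
theorem IsIsometryFlow.hasDerivAt_moving (h : IsIsometryFlow A R) {σ : ℝ → V} {σ' : V} {l t : ℝ}
    (hσ : HasDerivAt σ σ' t) :
    HasDerivAt (fun t => R (l * t) (σ t)) (R (l * t) (l • A (σ t) + σ')) t := by
  have h1 : HasDerivAt (fun t => R (l * t)) (l • (A * R (l * t))) t := by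
    have := HasDerivAt.scomp (𝕜' := ℝ) t (g₁ := R) (h := fun t => l * t) (h.hasDerivAt (l * t))
      ((hasDerivAt_id t).const_mul l)
    rw [mul_one] at this
    exact this
  convert h1.clm_apply hσ using 1
  simp [h.comm]

theorem IsIsometryFlow.contDiff_moving (h : IsIsometryFlow A R) {E : Type*} [NormedAddCommGroup E]
    [NormedSpace ℝ E] {σ : E → V} {τ : E → ℝ} (hτ : ContDiff ℝ ∞ τ) (hσ : ContDiff ℝ ∞ σ) :
    ContDiff ℝ ∞ fun p => R (τ p) (σ p) :=
  (h.contDiff.comp hτ).clm_apply hσ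

/-- A Randers norm that equals `l` at first order: the derivative of its square along a variation
`(x, l A x + T)` with `‖T‖ = l` initially. -/
theorem hasDerivAt_randersNorm_sq (hA : ∀ x : V, ‖x‖ = 1 → ‖A x‖ < 1) {x T : ℝ → V} {x' T' : V}
    {l : ℝ} (hl : 0 < l) (h1 : ∀ s, ‖x s‖ = 1) (hx : HasDerivAt x x' 0)
    (hT : HasDerivAt T T' 0) (hTl : ‖T 0‖ = l) {g' : ℝ}
    (hg : HasDerivAt (fun s => randersNorm A (x s) (l • A (x s) + T s) ^ 2) g' 0) :
    g' = 2 * l * (inner ℝ (T 0) T' / (l + inner ℝ (T 0) (A (x 0)))) := by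
  set g : ℝ → ℝ := fun s => randersNorm A (x s) (l • A (x s) + T s) with hgdef
  have hg0 : g 0 = l := randersNorm_wind_add A (hA _ (h1 0)) hTl
  have hpos : 0 < l + inner ℝ (T 0) (A (x 0)) := by
    have h2 := neg_abs_le (inner ℝ (T 0) (A (x 0)))
    have h3 := abs_real_inner_le_norm (T 0) (A (x 0))
    have h4 := hA _ (h1 0)
    rw [hTl] at h3
    nlinarith
  -- The hypothesis gives the derivative of g² only; g is recovered as its square root near 0, where
  -- it is continuous and positive.
  have hgnn : ∀ᶠ s in 𝓝 (0 : ℝ), √(g s ^ 2) = g s := by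
    have hy0 : l • A (x 0) + T 0 ≠ 0 := by
      intro h0
      have : ‖T 0‖ = ‖l • A (x 0)‖ := by rw [eq_neg_of_add_eq_zero_right h0, norm_neg]
      rw [hTl, norm_smul, Real.norm_of_nonneg hl.le] at this
      nlinarith [hA _ (h1 0)]
    have hc : ContinuousAt g 0 := by
      have hAx : ContinuousAt (fun s => A (x s)) 0 :=
        A.continuous.continuousAt.comp (f := x) hx.continuousAt
      have hne : 1 - inner ℝ (A (x 0)) (A (x 0)) ≠ 0 := by
        rw [real_inner_self_eq_norm_sq]; nlinarith [norm_nonneg (A (x 0)), hA _ (h1 0)]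
      have hy : ContinuousAt (fun s => l • A (x s) + T s) 0 :=
        (hAx.const_smul l).add hT.continuousAt
      have hlam := (continuousAt_const (y := (1 : ℝ))).sub (hAx.inner (𝕜 := ℝ) hAx)
      exact ((((hlam.mul (hy.inner (𝕜 := ℝ) hy)).add ((hAx.inner (𝕜 := ℝ) hy).pow 2)).sqrt).div
        hlam hne).sub ((hAx.inner (𝕜 := ℝ) hy).div hlam hne)
    filter_upwards [hc.eventually (lt_mem_nhds (hg0 ▸ hl : (0 : ℝ) < g 0))] with s hs
    exact Real.sqrt_sq hs.le
  have hgd : HasDerivAt g (g' / (2 * l)) 0 := by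
    have := hg.sqrt (by change g 0 ^ 2 ≠ 0; rw [hg0]; positivity)
    refine (this.congr_of_eventuallyEq ?_).congr_deriv ?_
    · filter_upwards [hgnn] with s hs using hs.symm
    · show g' / (2 * √(g 0 ^ 2)) = _
      rw [hg0, Real.sqrt_sq hl.le]
  have hAx : HasDerivAt (fun s => A (x s)) (A x') 0 := A.hasFDerivAt.comp_hasDerivAt 0 hx
  -- Navigation reads |T + (l − g) A x|² = g² for every s. Differentiating at 0, where g = l, gives
  -- a linear equation for the derivative of g and avoids differentiating the formula of the norm.
  have hu : HasDerivAt (fun s => T s + (l - g s) • A (x s))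
      (T' - (g' / (2 * l)) • A (x 0)) 0 := by
    refine (hT.add ((hgd.const_sub l).smul hAx)).congr_deriv ?_
    rw [hg0]; simp; abel
  have hid : (fun s => inner ℝ (T s + (l - g s) • A (x s)) (T s + (l - g s) • A (x s))) =
      fun s => g s ^ 2 := by
    funext s
    rw [← norm_sub_randersNorm_smul_wind A (hA _ (h1 s)) (l • A (x s) + T s)]
    have : l • A (x s) + T s - randersNorm A (x s) (l • A (x s) + T s) • A (x s)
        = T s + (l - g s) • A (x s) := by
      rw [hgdef, sub_smul]; abel
    rw [this]
  have h5 := hu.inner ℝ hu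
  rw [hid] at h5
  have h6 := h5.unique hg
  simp only [hg0, sub_self, zero_smul, add_zero, inner_sub_right, inner_smul_right,
    real_inner_comm (T 0)] at h6
  rw [mul_div_assoc', eq_div_iff hpos.ne']
  field_simp at h6
  linear_combination (-1 / 2) * h6

/-- First variation of the energy along `t ↦ R (l t) σ(t)`, in terms of a variation of `σ`. -/
theorem hasDerivAt_energy (h : IsIsometryFlow A R) (hA : ∀ x : V, ‖x‖ = 1 → ‖A x‖ < 1) {l : ℝ}
    (hl : 0 < l) {σ : ℝ × ℝ → V} (hσ : ContDiff ℝ ∞ σ) (h1 : ∀ p, ‖σ p‖ = 1) {a b : ℝ}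
    (hab : a ≤ b) (hs : ∀ t, ‖fderiv ℝ σ (0, t) (0, 1)‖ = l) :
    HasDerivAt (fun s => ∫ t in a..b, randersNorm A (R (l * t) (σ (s, t)))
        (fderiv ℝ (fun p : ℝ × ℝ => R (l * p.2) (σ p)) (s, t) (0, 1)) ^ 2)
      (∫ t in a..b, 2 * l * (inner ℝ (fderiv ℝ σ (0, t) (0, 1))
          (deriv (fun t => fderiv ℝ σ (0, t) (1, 0)) t) /
        (l + inner ℝ (fderiv ℝ σ (0, t) (0, 1)) (A (σ (0, t)))))) 0 := by
  have hσd : Differentiable ℝ σ := hσ.differentiable (by simp)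
  have hT := contDiff_fderiv_apply_const hσ (0, 1)
  set f : ℝ × ℝ → ℝ := fun p => randersNorm A (σ p) (l • A (σ p) + fderiv ℝ σ p (0, 1)) ^ 2 with hf
  -- The flow preserves the Randers norm, so the integrand depends on σ alone.
  have hfΓ : ∀ s t, randersNorm A (R (l * t) (σ (s, t)))
        (fderiv ℝ (fun p : ℝ × ℝ => R (l * p.2) (σ p)) (s, t) (0, 1)) ^ 2 = f (s, t) := by
    intro s t
    have hΓ : ContDiff ℝ ∞ fun p : ℝ × ℝ => R (l * p.2) (σ p) :=
      h.contDiff_moving (contDiff_const.mul contDiff_snd) hσ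
    have e1 := fderiv_apply_right_eq_deriv (s := s) (t := t) (hΓ.differentiable (by simp) _)
    have e2 := h.hasDerivAt_moving (l := l) (fderiv_apply_right_eq_deriv (hσd (s, t)))
    rw [e1.unique e2, h.randersNorm_map]
  simp only [hfΓ]
  have hfc : ∀ t, ContDiffAt ℝ 1 f (0, t) := by
    intro t
    refine (contDiffAt_randersNorm A (hσ.of_le (by simp)).contDiffAt ?_ (hA _ (h1 _)) ?_).pow 2
    · exact ((A.contDiff.comp hσ).const_smul l |>.add hT |>.of_le (by simp)).contDiffAt
    · intro h0
      have := congrArg norm (eq_neg_of_add_eq_zero_right h0)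
      rw [hs, norm_neg, norm_smul, Real.norm_of_nonneg hl.le] at this
      nlinarith [hA _ (h1 (0, t))]
  convert hasDerivAt_integral_of_contDiffAt hab fun t _ => hfc t using 1
  refine intervalIntegral.integral_congr fun t _ => ?_
  have hfd : HasDerivAt (fun s => f (s, t)) (fderiv ℝ f (0, t) (1, 0)) 0 :=
    fderiv_apply_left_eq_deriv ((hfc t).differentiableAt (by simp))
  have := hasDerivAt_randersNorm_sq hA hl (fun s => h1 (s, t))
    (fderiv_apply_left_eq_deriv (hσd (0, t)))
    (fderiv_apply_left_eq_deriv (hT.differentiable (by simp) (0, t))) (hs t) hfd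
  rw [this, (hasDerivAt_variationField hσ 0 t).deriv]

end FirstVariation

end Finsler

/-! ### Geodesics are great circles carried by the wind -/

namespace Finsler

open Set Filter Topology MeasureTheory

variable {V : Type*} [NormedAddCommGroup V] [InnerProductSpace ℝ V] {n : ℕ}

theorem deriv_mem_submodule [FiniteDimensional ℝ V] {U : Submodule ℝ V} {f : ℝ → V}
    (hf : ∀ t, f t ∈ U) (t : ℝ) : deriv f t ∈ U := by
  have h := range_deriv_subset_closure_span_image f (dense_univ (X := ℝ)) (mem_range_self t)
  have h2 : (Submodule.span ℝ (f '' univ) : Set V) ⊆ U :=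
    SetLike.coe_subset_coe.2 (Submodule.span_le.2 (by rintro _ ⟨s, -, rfl⟩; exact hf s))
  exact closure_minimal h2 (Submodule.closed_of_finiteDimensional U) h

/-- A solution of `σ'' = -l² σ`. -/
theorem eq_cos_add_sin_of_deriv {σ : ℝ → V} {σ' : ℝ → V} {l : ℝ} (hl : 0 < l)
    (h1 : ∀ t, HasDerivAt σ (σ' t) t) (h2 : ∀ t, HasDerivAt σ' (-(l ^ 2) • σ t) t) (t : ℝ) :
    σ t = Real.cos (l * t) • σ 0 + Real.sin (l * t) • (l⁻¹ • σ' 0) := by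
  have hlt : ∀ t, HasDerivAt (fun t : ℝ => l * t) l t := fun t => by
    simpa using (hasDerivAt_id t).const_mul l
  have hc : ∀ t, HasDerivAt (fun t => Real.cos (l * t)) (-Real.sin (l * t) * l) t :=
    fun t => (hlt t).cos
  have hs : ∀ t, HasDerivAt (fun t => Real.sin (l * t)) (Real.cos (l * t) * l) t :=
    fun t => (hlt t).sin
  -- Rotating the pair (σ, σ'/l) back by the angle lt leaves a constant pair.
  have hu : ∀ t, HasDerivAt (fun t => Real.cos (l * t) • σ t - Real.sin (l * t) • (l⁻¹ • σ' t))
      0 t := fun t => by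
    refine (((hc t).smul (h1 t)).sub ((hs t).smul ((h2 t).const_smul l⁻¹))).congr_deriv ?_
    simp only [Pi.smul_apply]
    match_scalars <;> field_simp <;> ring
  have hv : ∀ t, HasDerivAt (fun t => Real.sin (l * t) • σ t + Real.cos (l * t) • (l⁻¹ • σ' t))
      0 t := fun t => by
    refine (((hs t).smul (h1 t)).add ((hc t).smul ((h2 t).const_smul l⁻¹))).congr_deriv ?_
    simp only [Pi.smul_apply]
    match_scalars <;> field_simp <;> ring
  have hu' := is_const_of_deriv_eq_zero (fun t => (hu t).differentiableAt)
    (fun t => (hu t).deriv) t 0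
  have hv' := is_const_of_deriv_eq_zero (fun t => (hv t).differentiableAt)
    (fun t => (hv t).deriv) t 0
  simp only [mul_zero, Real.cos_zero, Real.sin_zero, one_smul, zero_smul, sub_zero, zero_add]
    at hu' hv'
  rw [← hu', ← hv']
  match_scalars
  · linear_combination (-1 : ℝ) * Real.sin_sq_add_cos_sq (l * t)
  · ring

/-- The normalized variation of a curve on the unit sphere with a tangential variation field. -/
noncomputable def normalizedVariation (σ W : ℝ → V) (p : ℝ × ℝ) : V :=
  (√(1 + p.1 ^ 2 * inner ℝ (W p.2) (W p.2)))⁻¹ • (σ p.2 + p.1 • W p.2)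

section NormalizedVariation

variable {σ W : ℝ → V}

theorem normalizedVariation_pos (W : ℝ → V) (p : ℝ × ℝ) :
    0 < 1 + p.1 ^ 2 * inner ℝ (W p.2) (W p.2) := by
  have := mul_nonneg (sq_nonneg p.1) (real_inner_self_nonneg (x := W p.2))
  linarith

theorem contDiff_normalizedVariation (hσ : ContDiff ℝ ∞ σ) (hW : ContDiff ℝ ∞ W) :
    ContDiff ℝ ∞ (normalizedVariation σ W) := by
  have hW2 : ContDiff ℝ ∞ fun p : ℝ × ℝ => W p.2 := hW.comp contDiff_snd
  have hσ2 : ContDiff ℝ ∞ fun p : ℝ × ℝ => σ p.2 := hσ.comp contDiff_snd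
  have h1 : ContDiff ℝ ∞ fun p : ℝ × ℝ => 1 + p.1 ^ 2 * inner ℝ (W p.2) (W p.2) :=
    contDiff_const.add ((contDiff_fst.pow 2).mul (hW2.inner ℝ hW2))
  exact ((h1.sqrt fun p => (normalizedVariation_pos W p).ne').inv fun p =>
    (Real.sqrt_pos.2 (normalizedVariation_pos W p)).ne').smul (hσ2.add (contDiff_fst.smul hW2))

theorem norm_normalizedVariation (h1 : ∀ t, ‖σ t‖ = 1) (h2 : ∀ t, inner ℝ (σ t) (W t) = 0)
    (p : ℝ × ℝ) : ‖normalizedVariation σ W p‖ = 1 := by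
  have h3 : ‖σ p.2 + p.1 • W p.2‖ = √(1 + p.1 ^ 2 * inner ℝ (W p.2) (W p.2)) := by
    rw [← Real.sqrt_sq (norm_nonneg _), ← real_inner_self_eq_norm_sq]
    congr 1
    simp only [inner_add_left, inner_add_right, inner_smul_left, inner_smul_right, h2,
      real_inner_comm (σ p.2) (W p.2), real_inner_self_eq_norm_sq (σ p.2), h1, RCLike.conj_to_real]
    ring
  rw [normalizedVariation, norm_smul, h3, norm_inv,
    Real.norm_of_nonneg (Real.sqrt_nonneg _),
    inv_mul_cancel₀ (Real.sqrt_pos.2 (normalizedVariation_pos W p)).ne']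

theorem normalizedVariation_zero (t : ℝ) : normalizedVariation σ W (0, t) = σ t := by
  simp [normalizedVariation]

theorem normalizedVariation_of_eq_zero {t : ℝ} (h : W t = 0) (s : ℝ) :
    normalizedVariation σ W (s, t) = σ t := by
  simp [normalizedVariation, h]

theorem hasDerivAt_normalizedVariation (t : ℝ) :
    HasDerivAt (fun s => normalizedVariation σ W (s, t)) (W t) 0 := by
  unfold normalizedVariation
  have h1 : HasDerivAt (fun s : ℝ => 1 + s ^ 2 * inner ℝ (W t) (W t)) 0 0 := by
    have := (((hasDerivAt_id (0 : ℝ)).pow 2).mul_const (inner ℝ (W t) (W t))).const_add 1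
    simpa using this
  have h2 := (h1.sqrt (by simp)).inv (by simp)
  have h3 : HasDerivAt (fun s : ℝ => σ t + s • W t) (W t) 0 := by
    simpa using ((hasDerivAt_id (0 : ℝ)).smul_const (W t)).const_add (σ t)
  refine (h2.smul h3).congr_deriv ?_
  simp

end NormalizedVariation

section Geodesics

variable {A : V →L[ℝ] V} {R : ℝ → V →L[ℝ] V}

/-- Cauchy–Schwarz with |A x| < 1. This is the denominator of the first variation. -/
theorem speed_add_inner_wind_pos (hA : ∀ x : V, ‖x‖ = 1 → ‖A x‖ < 1) {x T : V} {l : ℝ}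
    (hl : 0 < l) (hx : ‖x‖ = 1) (hT : ‖T‖ = l) : 0 < l + inner ℝ T (A x) := by
  have h2 := neg_abs_le (inner ℝ T (A x))
  have h3 := abs_real_inner_le_norm T (A x)
  have h4 := hA _ hx
  rw [hT] at h3
  nlinarith

/-- If the weighted first variation `∫ ρ ⟨σ', V'⟩` vanishes for the tangential fields `V` in `U`,
then `σ` is a great circle. Here `ρ = 1 / (l + ⟨σ', A σ⟩)`. -/
theorem deriv_deriv_eq_of_firstVariation_eq_zero [FiniteDimensional ℝ V]
    (hA : ∀ x : V, ‖x‖ = 1 → ‖A x‖ < 1) {U : Submodule ℝ V} {l : ℝ} (hl : 0 < l) {σ : ℝ → V}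
    (hσ : ContDiff ℝ ∞ σ) (h1 : ∀ t, ‖σ t‖ = 1) (hU : ∀ t, σ t ∈ U) (hs : ∀ t, ‖deriv σ t‖ = l)
    (hcrit : ∀ (a b : ℝ) (W : ℝ → V), a < b → ContDiff ℝ ∞ W → (∀ t, W t ∈ U) →
      (∀ t, inner ℝ (σ t) (W t) = 0) → W a = 0 → W b = 0 →
      ∫ t in a..b, 2 * l * (inner ℝ (deriv σ t) (deriv W t) /
        (l + inner ℝ (deriv σ t) (A (σ t)))) = 0) (t : ℝ) :
    deriv (deriv σ) t = -(l ^ 2) • σ t := by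
  have hd1 : ContDiff ℝ ∞ (deriv σ) := (contDiff_infty_iff_deriv.1 hσ).2
  have hd2 : ContDiff ℝ ∞ (deriv (deriv σ)) := (contDiff_infty_iff_deriv.1 hd1).2
  have hder {f : ℝ → V} (hf : ContDiff ℝ ∞ f) (t : ℝ) : HasDerivAt f (deriv f t) t :=
    (hf.differentiable (by simp) t).hasDerivAt
  have hpos : ∀ t, 0 < l + inner ℝ (deriv σ t) (A (σ t)) := fun t =>
    speed_add_inner_wind_pos hA hl (h1 t) (hs t)
  set ρ : ℝ → ℝ := fun t => (l + inner ℝ (deriv σ t) (A (σ t)))⁻¹ with hρ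
  have hρpos : ∀ t, 0 < ρ t := fun t => inv_pos.2 (hpos t)
  have hρc : ContDiff ℝ ∞ ρ :=
    (contDiff_const.add (hd1.inner ℝ (A.contDiff.comp hσ))).inv fun t => (hpos t).ne'
  have hρd : ∀ t, HasDerivAt ρ (deriv ρ t) t := fun t =>
    (hρc.differentiable (by simp) t).hasDerivAt
  set w : ℝ → V := fun t => ρ t • deriv σ t with hw
  have hwc : ContDiff ℝ ∞ w := hρc.smul hd1
  have hwd : ContDiff ℝ ∞ (deriv w) := (contDiff_infty_iff_deriv.1 hwc).2
  have hσσ : ∀ t, inner ℝ (σ t) (deriv σ t) = 0 := fun t => by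
    have h := (hder hσ t).inner ℝ (hder hσ t)
    simp only [real_inner_self_eq_norm_sq, h1] at h
    have := h.unique (hasDerivAt_const _ _)
    rw [real_inner_comm (σ t)] at this; linarith
  have hσw : ∀ t, inner ℝ (σ t) (deriv w t) = -(ρ t * l ^ 2) := fun t => by
    have h := (hder hσ t).inner ℝ (hder hwc t)
    have h0 : (fun t => inner ℝ (σ t) (w t)) = fun _ => 0 := by
      funext t; rw [hw]; simp [inner_smul_right, hσσ]
    rw [h0] at h
    have := h.unique (hasDerivAt_const _ _)
    rw [hw] at this
    simp only [inner_smul_right, real_inner_self_eq_norm_sq, hs] at this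
    linarith
  -- Z is the part of w' = (ρ σ')' tangent to the sphere; the normal part is −ρ l² σ because w is
  -- orthogonal to σ. It is the Euler–Lagrange expression of the weighted problem.
  set Z : ℝ → V := fun t => deriv w t + (ρ t * l ^ 2) • σ t with hZ
  have hZc : ContDiff ℝ ∞ Z := hwd.add ((hρc.mul contDiff_const).smul hσ)
  have hZσ : ∀ t, inner ℝ (σ t) (Z t) = 0 := fun t => by
    simp [hZ, inner_add_right, inner_smul_right, hσw, h1]
  have hZU : ∀ t, Z t ∈ U := fun t => U.add_mem
    (deriv_mem_submodule (fun t => U.smul_mem _ (deriv_mem_submodule hU t)) t)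
    (U.smul_mem _ (hU t))
  have hZ0 : ∀ t, Z t = 0 := by
    intro t₀
    by_contra hne
    set a := t₀ - 1
    set b := t₀ + 1
    have hab : a < b := by simp only [a, b]; linarith
    -- f vanishes at both ends and is positive in between; integrating by parts against the test
    -- field f Z leaves ∫ f |Z|² = 0.
    set f : ℝ → ℝ := fun t => (t - a) * (b - t) with hf
    have hfc : ContDiff ℝ ∞ f :=
      (contDiff_id.sub contDiff_const).mul (contDiff_const.sub contDiff_id)
    have hWc : ContDiff ℝ ∞ fun t => f t • Z t := hfc.smul hZc
    have hW := hcrit a b (fun t => f t • Z t) hab hWc (fun t => U.smul_mem _ (hZU t))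
      (fun t => by simp [inner_smul_right, hZσ]) (by simp [hf]) (by simp [hf])
    have hd : ∀ t, HasDerivAt (fun t => inner ℝ (w t) (f t • Z t))
        (inner ℝ (w t) (deriv (fun t => f t • Z t) t) + inner ℝ (deriv w t) (f t • Z t)) t :=
      fun t => (hder hwc t).inner ℝ (hder hWc t)
    have hWd : ContDiff ℝ ∞ (deriv fun t => f t • Z t) := (contDiff_infty_iff_deriv.1 hWc).2
    have hi1 : Continuous fun t => inner ℝ (w t) (deriv (fun t => f t • Z t) t) :=
      hwc.continuous.inner hWd.continuous
    have hi2 : Continuous fun t => inner ℝ (deriv w t) (f t • Z t) :=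
      hwd.continuous.inner hWc.continuous
    have hint := intervalIntegral.integral_eq_sub_of_hasDerivAt (a := a) (b := b)
      (fun t _ => hd t) ((hi1.add hi2).intervalIntegrable a b)
    have e1 : ∀ t, inner ℝ (w t) (deriv (fun t => f t • Z t) t) = (2 * l)⁻¹ * (2 * l *
        (inner ℝ (deriv σ t) (deriv (fun t => f t • Z t) t) /
          (l + inner ℝ (deriv σ t) (A (σ t))))) := fun t => by
      rw [hw, hρ]; simp only [inner_smul_left, RCLike.conj_to_real]; field_simp
    have e2 : ∀ t, inner ℝ (deriv w t) (f t • Z t) = f t * inner ℝ (Z t) (Z t) := fun t => by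
      have : deriv w t = Z t - (ρ t * l ^ 2) • σ t := by simp [hZ]
      rw [this, inner_smul_right, inner_sub_left, inner_smul_left, hZσ]; simp
    rw [intervalIntegral.integral_add (hi1.intervalIntegrable a b) (hi2.intervalIntegrable a b)]
      at hint
    simp only [e1, e2, intervalIntegral.integral_const_mul, hW] at hint
    have hfa : f a = 0 := by simp [hf]
    have hfb : f b = 0 := by simp [hf]
    simp only [hfa, hfb, zero_smul, inner_zero_right, sub_zero, mul_zero, zero_add] at hint
    have : 0 < ∫ t in a..b, f t * inner ℝ (Z t) (Z t) := by
      refine intervalIntegral.integral_pos hab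
        (hfc.continuous.mul (hZc.continuous.inner hZc.continuous)).continuousOn
        (fun t ht => mul_nonneg (mul_nonneg (by linarith [ht.1]) (by linarith [ht.2]))
          real_inner_self_nonneg) ⟨t₀, ⟨by simp [a], by simp [b]⟩, ?_⟩
      refine mul_pos ?_ (real_inner_self_pos.2 hne)
      simp [hf, a, b]
    exact this.ne' hint
  have hwd' : ∀ t, deriv w t = -(ρ t * l ^ 2) • σ t := fun t => by
    rw [neg_smul]; exact eq_neg_of_add_eq_zero_left (hZ0 t)
  have hwe : ∀ t, deriv w t = ρ t • deriv (deriv σ) t + deriv ρ t • deriv σ t := fun t =>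
    ((hρd t).smul (hder hd1 t)).deriv
  have hss : ∀ t, inner ℝ (deriv σ t) (deriv (deriv σ) t) = 0 := fun t => by
    have h := (hder hd1 t).inner ℝ (hder hd1 t)
    simp only [real_inner_self_eq_norm_sq, hs] at h
    have := h.unique (hasDerivAt_const _ _)
    rw [real_inner_comm (deriv σ t)] at this; linarith
  -- Pairing with σ', which is orthogonal to σ and to σ'', isolates ρ' l² = 0. With a constant
  -- weight the equation becomes σ'' = −l² σ.
  have hρ0 : ∀ t, deriv ρ t = 0 := fun t => by
    have h := congrArg (fun v => inner ℝ (deriv σ t) v) ((hwe t).symm.trans (hwd' t))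
    simp only [inner_add_right, inner_smul_right, hss, real_inner_self_eq_norm_sq, hs,
      real_inner_comm (σ t), hσσ] at h
    have hl2 : l ^ 2 ≠ 0 := by positivity
    simpa [hl2] using h
  have h := (hwe t).symm.trans (hwd' t)
  rw [hρ0, zero_smul, add_zero, ← mul_neg, mul_smul] at h
  exact smul_right_injective V (hρpos t).ne' h

/-- Classification of the critical curves of constant speed in `S ∩ U`. -/
theorem exists_greatCircle_of_critical [FiniteDimensional ℝ V] (h : IsIsometryFlow A R)
    (hA : ∀ x : V, ‖x‖ = 1 → ‖A x‖ < 1) {U : Submodule ℝ V} (hRU : ∀ t, ∀ x ∈ U, R t x ∈ U)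
    {l : ℝ} (hl : 0 < l) {C : ℝ → V} (hC : ContDiff ℝ ∞ C) (h1 : ∀ t, ‖C t‖ = 1)
    (hCU : ∀ t, C t ∈ U) (hF : ∀ t, randersNorm A (C t) (deriv C t) = l)
    (hcrit : ∀ (a b : ℝ) (Γ : ℝ × ℝ → V), a < b → ContDiff ℝ ∞ Γ → (∀ p, ‖Γ p‖ = 1 ∧ Γ p ∈ U) →
      (∀ t, Γ (0, t) = C t) → (∀ s, Γ (s, a) = C a) → (∀ s, Γ (s, b) = C b) →
      HasDerivAt (fun s => ∫ t in a..b,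
        randersNorm A (Γ (s, t)) (fderiv ℝ Γ (s, t) (0, 1)) ^ 2) 0 0) :
    ∃ p ∈ U, ∃ q ∈ U, ‖p‖ = 1 ∧ ‖q‖ = 1 ∧ inner ℝ p q = 0 ∧
      ∀ t, C t = R (l * t) (Real.cos (l * t) • p + Real.sin (l * t) • q) := by
  -- In the frame drifting with the wind the Randers speed l turns into the Euclidean speed l.
  set σ : ℝ → V := fun t => R (-l * t) (C t) with hσdef
  have hσ : ContDiff ℝ ∞ σ := h.contDiff_moving (contDiff_const.mul contDiff_id) hC
  have hCσ : ∀ t, C t = R (l * t) (σ t) := fun t => by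
    simp only [hσdef, neg_mul, h.apply_neg]
  have hσ1 : ∀ t, ‖σ t‖ = 1 := fun t => by simp only [hσdef, h.norm, h1]
  have hσU : ∀ t, σ t ∈ U := fun t => hRU _ _ (hCU t)
  have hσd : ∀ t, HasDerivAt σ (deriv σ t) t := fun t =>
    (hσ.differentiable (by simp) t).hasDerivAt
  have hs : ∀ t, ‖deriv σ t‖ = l := fun t => by
    have hd := h.hasDerivAt_moving (l := l) (hσd t)
    have e : (fun t => R (l * t) (σ t)) = C := funext fun t => (hCσ t).symm
    rw [e] at hd
    have hF' := hF t
    rw [hd.deriv, hCσ t, h.randersNorm_map] at hF'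
    have h2 := norm_sub_randersNorm_smul_wind A (hA _ (hσ1 t)) (l • A (σ t) + deriv σ t)
    rw [hF', add_sub_cancel_left, real_inner_self_eq_norm_sq] at h2
    exact (pow_left_inj₀ (norm_nonneg _) hl.le two_ne_zero).1 h2
  have hdd := deriv_deriv_eq_of_firstVariation_eq_zero hA hl hσ hσ1 hσU hs (by
    intro a b W hab hW hWU hσW hWa hWb
    -- Each tangential field W along σ comes from the normalized variation, and dragging that by R
    -- gives a variation of C which stays in the sphere of U because U is flow-invariant.
    have hv := contDiff_normalizedVariation hσ hW
    have hvn := norm_normalizedVariation hσ1 hσW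
    have hv0 : ∀ t, fderiv ℝ (normalizedVariation σ W) (0, t) (0, 1) = deriv σ t := fun t => by
      have h2 := fderiv_apply_right_eq_deriv (hv.differentiable (by simp) (0, t))
      simp only [normalizedVariation_zero] at h2
      exact h2.unique (hσd t)
    have hvs : ∀ t, fderiv ℝ (normalizedVariation σ W) (0, t) (1, 0) = W t := fun t =>
      (fderiv_apply_left_eq_deriv (hv.differentiable (by simp) (0, t))).unique
        (hasDerivAt_normalizedVariation t)
    have hE := hasDerivAt_energy h hA hl hv hvn hab.le (fun t => by rw [hv0, hs])
    have hE0 := hcrit a b (fun p => R (l * p.2) (normalizedVariation σ W p)) hab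
      (h.contDiff_moving (contDiff_const.mul contDiff_snd) hv)
      (fun p => ⟨by rw [h.norm, hvn], hRU _ _
        (U.smul_mem _ (U.add_mem (hσU _) (U.smul_mem _ (hWU _))))⟩)
      (fun t => by simp only [normalizedVariation_zero, hCσ])
      (fun s => by simp only [normalizedVariation_of_eq_zero hWa, hCσ])
      (fun s => by simp only [normalizedVariation_of_eq_zero hWb, hCσ])
    have h3 := hE.unique hE0
    simp only [hv0, hvs, normalizedVariation_zero] at h3
    exact h3)
  have hd1 : ContDiff ℝ ∞ (deriv σ) := (contDiff_infty_iff_deriv.1 hσ).2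
  have hsol := eq_cos_add_sin_of_deriv hl hσd fun t => by
    rw [← hdd t]; exact (hd1.differentiable (by simp) t).hasDerivAt
  refine ⟨σ 0, hσU 0, l⁻¹ • deriv σ 0, U.smul_mem _ (deriv_mem_submodule hσU 0), hσ1 0, ?_, ?_,
    fun t => by rw [hCσ, ← hsol]⟩
  · rw [norm_smul, hs, norm_inv, Real.norm_of_nonneg hl.le, inv_mul_cancel₀ hl.ne']
  · have h2 := (hσd 0).inner ℝ (hσd 0)
    simp only [real_inner_self_eq_norm_sq, hσ1] at h2
    have := h2.unique (hasDerivAt_const _ _)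
    rw [real_inner_comm (σ 0)] at this
    rw [inner_smul_right, show inner ℝ (σ 0) (deriv σ 0) = 0 by linarith, mul_zero]

theorem norm_cos_add_sin {p q : V} (hp : ‖p‖ = 1) (hq : ‖q‖ = 1) (hpq : inner ℝ p q = 0) (θ : ℝ) :
    ‖Real.cos θ • p + Real.sin θ • q‖ = 1 := by
  rw [← pow_left_inj₀ (norm_nonneg _) zero_le_one two_ne_zero, ← real_inner_self_eq_norm_sq]
  simp only [inner_add_left, inner_add_right, inner_smul_left, inner_smul_right, hpq,
    real_inner_comm p q, real_inner_self_eq_norm_sq, hp, hq, RCLike.conj_to_real]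
  linear_combination Real.sin_sq_add_cos_sq θ

theorem hasDerivAt_cos_add_sin (p q : V) (l t : ℝ) :
    HasDerivAt (fun t => Real.cos (l * t) • p + Real.sin (l * t) • q)
      (l • (Real.cos (l * t) • q - Real.sin (l * t) • p)) t := by
  have hlt : HasDerivAt (fun t : ℝ => l * t) l t := by
    simpa using (hasDerivAt_id t).const_mul l
  refine ((hlt.cos.smul_const p).add (hlt.sin.smul_const q)).congr_deriv ?_
  match_scalars <;> ring

theorem contDiff_cos_add_sin (p q : V) (l : ℝ) :
    ContDiff ℝ ∞ fun t => Real.cos (l * t) • p + Real.sin (l * t) • q := by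
  have h : ContDiff ℝ ∞ fun t : ℝ => l * t := contDiff_const.mul contDiff_id
  exact (h.cos.smul contDiff_const).add (h.sin.smul contDiff_const)

theorem norm_deriv_cos_add_sin {p q : V} (hp : ‖p‖ = 1) (hq : ‖q‖ = 1) (hpq : inner ℝ p q = 0)
    {l : ℝ} (hl : 0 < l) (θ : ℝ) : ‖l • (Real.cos θ • q - Real.sin θ • p)‖ = l := by
  have h := norm_cos_add_sin (q := -p) hq (by rw [norm_neg, hp])
    (by rw [inner_neg_right, real_inner_comm, hpq, neg_zero]) θ
  rw [smul_neg, ← sub_eq_add_neg] at h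
  rw [norm_smul, h, Real.norm_of_nonneg hl.le, mul_one]

theorem randersNorm_moving_greatCircle (h : IsIsometryFlow A R)
    (hA : ∀ x : V, ‖x‖ = 1 → ‖A x‖ < 1) {p q : V} (hp : ‖p‖ = 1) (hq : ‖q‖ = 1)
    (hpq : inner ℝ p q = 0) {l : ℝ} (hl : 0 < l) (t : ℝ) :
    randersNorm A (R (l * t) (Real.cos (l * t) • p + Real.sin (l * t) • q))
      (deriv (fun t => R (l * t) (Real.cos (l * t) • p + Real.sin (l * t) • q)) t) = l := by
  rw [(h.hasDerivAt_moving (hasDerivAt_cos_add_sin p q l t)).deriv, h.randersNorm_map]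
  exact randersNorm_wind_add A (hA _ (norm_cos_add_sin hp hq hpq _))
    (norm_deriv_cos_add_sin hp hq hpq hl _)

/-- The curves `R (l t) (cos (l t) p + sin (l t) q)` are critical for the energy. -/
theorem critical_moving_greatCircle (h : IsIsometryFlow A R)
    (hA : ∀ x : V, ‖x‖ = 1 → ‖A x‖ < 1) {p q : V} (hp : ‖p‖ = 1) (hq : ‖q‖ = 1)
    (hpq : inner ℝ p q = 0) {l : ℝ} (hl : 0 < l) {C : ℝ → V}
    (hC : ∀ t, C t = R (l * t) (Real.cos (l * t) • p + Real.sin (l * t) • q))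
    {a b : ℝ} (hab : a < b) {Γ : ℝ × ℝ → V} (hΓ : ContDiff ℝ ∞ Γ) (h1 : ∀ p, ‖Γ p‖ = 1)
    (hΓ0 : ∀ t, Γ (0, t) = C t) (hΓa : ∀ s, Γ (s, a) = C a) (hΓb : ∀ s, Γ (s, b) = C b) :
    HasDerivAt (fun s => ∫ t in a..b,
        randersNorm A (Γ (s, t)) (fderiv ℝ Γ (s, t) (0, 1)) ^ 2) 0 0 := by
  set σ : ℝ × ℝ → V := fun p => R (-l * p.2) (Γ p) with hσdef
  have hσ : ContDiff ℝ ∞ σ := h.contDiff_moving (contDiff_const.mul contDiff_snd) hΓ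
  have hσd : Differentiable ℝ σ := hσ.differentiable (by simp)
  have hΓσ : ∀ p, Γ p = R (l * p.2) (σ p) := fun p => by
    simp only [hσdef, neg_mul, h.apply_neg]
  have hσ1 : ∀ p, ‖σ p‖ = 1 := fun t => by simp only [hσdef, h.norm, h1]
  have hσ0 : ∀ t, σ (0, t) = Real.cos (l * t) • p + Real.sin (l * t) • q := fun t => by
    simp only [hσdef, hΓ0, hC, neg_mul, h.neg_apply]
  have ht : ∀ t, fderiv ℝ σ (0, t) (0, 1) = l • (Real.cos (l * t) • q - Real.sin (l * t) • p) :=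
    fun t => by
      have h2 := fderiv_apply_right_eq_deriv (hσd (0, t))
      simp only [hσ0] at h2
      exact h2.unique (hasDerivAt_cos_add_sin p q l t)
  have hE := hasDerivAt_energy h hA hl hσ hσ1 hab.le fun t => by
    rw [ht]; exact norm_deriv_cos_add_sin hp hq hpq hl _
  have e2 : ∀ s t, R (l * t) (σ (s, t)) = Γ (s, t) := fun s t => (hΓσ (s, t)).symm
  simp only [e2] at hE
  refine hE.congr_deriv ?_
  have hApq : inner ℝ p (A q) = -inner ℝ q (A p) := by
    have h2 := h.inner_map_self (p + q)
    simp only [map_add, inner_add_left, inner_add_right, h.inner_map_self] at h2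
    rw [real_inner_comm p, real_inner_comm q] at h2
    linarith
  -- By skewness ⟨p, A q⟩ = −⟨q, A p⟩, so the cos² and sin² terms add up and the weight is constant
  -- along a great circle.
  have hden : ∀ t, inner ℝ (fderiv ℝ σ (0, t) (0, 1)) (A (σ (0, t))) = l * inner ℝ q (A p) := by
    intro t
    rw [ht, hσ0]
    simp only [map_add, map_smul, inner_add_right, inner_smul_left, inner_smul_right,
      inner_sub_left, RCLike.conj_to_real, hApq]
    have h2 : ∀ x, inner ℝ x (A x) = 0 := fun x => by rw [real_inner_comm, h.inner_map_self]
    rw [h2, h2]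
    linear_combination l * inner ℝ q (A p) * Real.sin_sq_add_cos_sq (l * t)
  set X : ℝ → V := fun t => fderiv ℝ σ (0, t) (1, 0) with hX
  have hXc : ContDiff ℝ ∞ X := (contDiff_fderiv_apply_const hσ (1, 0)).comp
    (contDiff_const.prodMk contDiff_id)
  have hXd : ∀ t, HasDerivAt X (deriv X t) t := fun t =>
    (hXc.differentiable (by simp) t).hasDerivAt
  have hσX : ∀ t, inner ℝ (σ (0, t)) (X t) = 0 := fun t => by
    have h2 := fderiv_apply_left_eq_deriv (hσd (0, t))
    have h3 := h2.inner ℝ h2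
    simp only [real_inner_self_eq_norm_sq, hσ1] at h3
    have := h3.unique (hasDerivAt_const _ _)
    rw [real_inner_comm (σ (0, t))] at this; linarith
  have hX0 : ∀ c, (∀ s, Γ (s, c) = C c) → X c = 0 := fun c hc => by
    have h2 := fderiv_apply_left_eq_deriv (hσd (0, c))
    have h3 : (fun s => σ (s, c)) = fun _ => R (-l * c) (C c) := by
      funext s; simp only [hσdef, hc]
    rw [h3] at h2
    exact h2.unique (hasDerivAt_const _ _)
  have hd2 : ∀ t, HasDerivAt (fun t => fderiv ℝ σ (0, t) (0, 1)) (-(l ^ 2) • σ (0, t)) t := by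
    intro t
    simp only [ht, hσ0]
    have h2 := (hasDerivAt_cos_add_sin q (-p) l t).const_smul l
    simp only [smul_neg, ← sub_eq_add_neg] at h2
    refine h2.congr_deriv ?_
    match_scalars <;> ring
  -- σ'' is a multiple of σ, hence orthogonal to X; the integrand ⟨σ', X'⟩ is the derivative of ⟨σ',
  -- X⟩, which vanishes at both ends.
  have hprod : ∀ t, HasDerivAt (fun t => inner ℝ (fderiv ℝ σ (0, t) (0, 1)) (X t))
      (inner ℝ (fderiv ℝ σ (0, t) (0, 1)) (deriv X t)) t := fun t => by
    refine ((hd2 t).inner ℝ (hXd t)).congr_deriv ?_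
    rw [inner_smul_left, hσX, mul_zero, add_zero]
  have hcont : Continuous fun t => inner ℝ (fderiv ℝ σ (0, t) (0, 1)) (deriv X t) :=
    ((contDiff_fderiv_apply_const hσ (0, 1)).continuous.comp
      (continuous_const.prodMk continuous_id)).inner
      (contDiff_infty_iff_deriv.1 hXc).2.continuous
  have hint := intervalIntegral.integral_eq_sub_of_hasDerivAt (a := a) (b := b)
    (fun t _ => hprod t) (hcont.intervalIntegrable a b)
  rw [hX0 a hΓa, hX0 b hΓb, inner_zero_right, inner_zero_right, sub_zero] at hint
  simp only [hden, intervalIntegral.integral_const_mul, intervalIntegral.integral_div]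
  rw [hint]; simp

end Geodesics

end Finsler

/-! ### Isometries acting on geodesics, and the Randers sphere -/

namespace Finsler

open Set Filter Topology MeasureTheory

section GeneralManifold

variable {E : Type*} [NormedAddCommGroup E] [NormedSpace ℝ E]
  {M : Type*} [TopologicalSpace M] [ChartedSpace E M]
  {F : ∀ x : M, TangentSpace 𝓘(ℝ, E) x → ℝ}

theorem speed_isometry_comp {Φ : M ≃ₘ^∞⟮𝓘(ℝ, E), 𝓘(ℝ, E)⟯ M}
    (hΦ : ∀ (x : M) (y : TangentSpace 𝓘(ℝ, E) x),
      F (Φ x) (mfderiv 𝓘(ℝ, E) 𝓘(ℝ, E) Φ x y) = F x y) {c c' : ℝ → M} {t : ℝ}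
    (hc : MDifferentiableAt 𝓘(ℝ, ℝ) 𝓘(ℝ, E) c t) (hc' : c' = fun t => Φ (c t)) :
    F (c' t) (velocity (E := E) c' t) = F (c t) (velocity (E := E) c t) := by
  subst hc'
  rw [← hΦ (c t)]
  have h := mfderiv_comp t (Φ.mdifferentiable (by simp) (c t)) hc
  exact congrArg (fun L : TangentSpace 𝓘(ℝ, ℝ) t →L[ℝ] TangentSpace 𝓘(ℝ, E) (Φ (c t)) =>
    F (Φ (c t)) (L (1 : ℝ))) h

/-- The equality of speeds is kept because the speed later identifies the block of a closed
geodesic. -/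
theorem IsGeodesicIn.isometry_comp {g : C(M, M)} (hg : g ∈ isometries F) {c : ℝ → M}
    (hc : IsGeodesicIn F univ c) : IsGeodesicIn F univ (fun t => g (c t)) ∧
      ∀ t, F (g (c t)) (velocity (E := E) (fun t => g (c t)) t) =
        F (c t) (velocity (E := E) c t) := by
  obtain ⟨Φ, hΦg, hΦ⟩ := hg
  obtain ⟨hc1, -, ⟨l, hl, hcl⟩, hc2⟩ := hc
  have hcd : ∀ t, MDifferentiableAt 𝓘(ℝ, ℝ) 𝓘(ℝ, E) c t := fun t =>
    (hc1 t).mdifferentiableAt (by simp)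
  have hgΦ : (g : M → M) = Φ := funext fun x => (hΦg x).symm
  rw [hgΦ]
  have hsp : ∀ t, F (Φ (c t)) (velocity (E := E) (fun t => Φ (c t)) t) =
      F (c t) (velocity (E := E) c t) := fun t => speed_isometry_comp hΦ (hcd t) rfl
  refine ⟨⟨Φ.contMDiff.comp hc1, fun t => mem_univ _, ⟨l, hl, fun t => by rw [hsp, hcl]⟩, ?_⟩, hsp⟩
  intro a b Γ hab hΓ _ hΓ0 hΓa hΓb
  -- A variation of the image curve is pulled back by the inverse isometry, with unchanged energies.
  have hΓ' : ContMDiff 𝓘(ℝ, ℝ × ℝ) 𝓘(ℝ, E) ∞ fun p => Φ.symm (Γ p) := Φ.symm.contMDiff.comp hΓ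
  have h := hc2 a b (fun p => Φ.symm (Γ p)) hab hΓ' (fun p => mem_univ _)
    (fun t => by rw [hΓ0, Φ.symm_apply_apply]) (fun s => by rw [hΓa, Φ.symm_apply_apply])
    (fun s => by rw [hΓb, Φ.symm_apply_apply])
  convert h using 1
  funext s
  refine intervalIntegral.integral_congr fun t _ => ?_
  have hd : MDifferentiableAt 𝓘(ℝ, ℝ) 𝓘(ℝ, E) (fun t => Φ.symm (Γ (s, t))) t := by
    have h1 : ContMDiff 𝓘(ℝ, ℝ) 𝓘(ℝ, ℝ × ℝ) ∞ fun t : ℝ => (s, t) :=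
      (contDiff_const.prodMk contDiff_id).contMDiff
    exact ((hΓ'.comp h1) t).mdifferentiableAt (by simp)
  have := speed_isometry_comp (c' := fun t => Γ (s, t)) hΦ hd
    (funext fun t => (Φ.apply_symm_apply _).symm)
  simp only [this]

theorem isometries_comp {g h : C(M, M)} (hg : g ∈ isometries F) (hh : h ∈ isometries F) :
    g.comp h ∈ isometries F := by
  obtain ⟨Φ, hΦg, hΦ⟩ := hg
  obtain ⟨Ψ, hΨh, hΨ⟩ := hh
  refine ⟨Ψ.trans Φ, fun x => by simp [hΦg, hΨh], fun x y => ?_⟩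
  have h := mfderiv_comp x (Φ.mdifferentiable (by simp) (Ψ x)) (Ψ.mdifferentiable (by simp) x)
  rw [← hΨ x y, ← hΦ (Ψ x)]
  exact congrArg (fun L : TangentSpace 𝓘(ℝ, E) x →L[ℝ] TangentSpace 𝓘(ℝ, E) (Φ (Ψ x)) =>
    F (Φ (Ψ x)) (L y)) h

theorem id_mem_isometries : ContinuousMap.id M ∈ isometries F :=
  ⟨Diffeomorph.refl _ _ _, fun _ => rfl, fun x y => by
    change F x (mfderiv 𝓘(ℝ, E) 𝓘(ℝ, E) id x y) = F x y
    rw [mfderiv_id]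
    rfl⟩

theorem connIsometries_subset : connIsometries F ⊆ isometries F := connectedComponentIn_subset _ _

theorem id_mem_connIsometries : ContinuousMap.id M ∈ connIsometries F :=
  mem_connectedComponentIn id_mem_isometries

/-- The left translate of the identity component by g is connected and contains g, so it stays
inside the component. -/
theorem connIsometries_comp {g h : C(M, M)} (hg : g ∈ connIsometries F)
    (hh : h ∈ connIsometries F) : g.comp h ∈ connIsometries F := by
  have hpre : IsPreconnected ((fun k => g.comp k) '' connIsometries F) :=
    isPreconnected_connectedComponentIn.image _ (ContinuousMap.continuous_postcomp g).continuousOn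
  have hsub : (fun k => g.comp k) '' connIsometries F ⊆ isometries F := by
    rintro _ ⟨k, hk, rfl⟩
    exact isometries_comp (connIsometries_subset hg) (connIsometries_subset hk)
  have hgm : g ∈ (fun k => g.comp k) '' connIsometries F :=
    ⟨_, id_mem_connIsometries, g.comp_id⟩
  have h1 := hpre.subset_connectedComponentIn hgm hsub
  rw [← connectedComponentIn_eq (show g ∈ connectedComponentIn (isometries F) _ from hg)] at h1
  exact h1 ⟨h, hh, rfl⟩

theorem IsClosedGeodesic.comp_isometry {g : C(M, M)} (hg : g ∈ isometries F)
    {γ : UnitAddCircle → M} (hγ : IsClosedGeodesic F γ) : IsClosedGeodesic F fun t => g (γ t) :=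
  (IsGeodesicIn.isometry_comp hg hγ).1

theorem curveOrbit_subset {γ : UnitAddCircle → M} {g : C(M, M)} (hg : g ∈ connIsometries F) :
    curveOrbit F (fun t => g (γ t)) ⊆ curveOrbit F γ := by
  rintro c ⟨h, hh, t', hc⟩
  exact ⟨h.comp g, connIsometries_comp hh hg, t', hc⟩

theorem curveOrbit_eq {γ : UnitAddCircle → M} {g g' : C(M, M)} (hg : g ∈ connIsometries F)
    (hg' : g' ∈ connIsometries F) (hgg' : ∀ x, g' (g x) = x) :
    curveOrbit F (fun t => g (γ t)) = curveOrbit F γ := by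
  refine (curveOrbit_subset hg).antisymm ?_
  have := curveOrbit_subset (F := F) (γ := fun t => g (γ t)) hg'
  simpa only [hgg'] using this

theorem mem_curveOrbit_self (γ : UnitAddCircle → M) : γ ∈ curveOrbit F γ :=
  ⟨_, id_mem_connIsometries, 0, fun t => by simp⟩

end GeneralManifold

variable {V : Type*} [NormedAddCommGroup V] [InnerProductSpace ℝ V] {n : ℕ}
  [Fact (Module.finrank ℝ V = n + 1)]

theorem randersMetric_roundMetric {A : V →L[ℝ] V}
    {W : ∀ x : Metric.sphere (0 : V) 1, TangentSpace (𝓡 n) x}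
    (hW : ∀ x, sphereIncl x (W x) = A x) (x : Metric.sphere (0 : V) 1)
    (y : TangentSpace (𝓡 n) x) :
    randersMetric roundMetric W x y = randersNorm A x (sphereIncl x y) := by
  simp only [randersMetric, roundMetric, hW, randersNorm]

section Geodesics

variable {A : V →L[ℝ] V} {R : ℝ → V →L[ℝ] V}
  {F : ∀ x : Metric.sphere (0 : V) 1, TangentSpace (𝓡 n) x → ℝ}

theorem speed_eq (hF : ∀ x y, F x y = randersNorm A x (sphereIncl x y))
    {c : ℝ → Metric.sphere (0 : V) 1} {t : ℝ} (hc : MDifferentiableAt 𝓘(ℝ, ℝ) (𝓡 n) c t) :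
    F (c t) (velocity (E := EuclideanSpace ℝ (Fin n)) c t) =
      randersNorm A (c t) (deriv (fun t => (c t : V)) t) := by
  rw [hF, sphereIncl_velocity hc]

theorem energy_eq (hF : ∀ x y, F x y = randersNorm A x (sphereIncl x y))
    {Γ : ℝ × ℝ → Metric.sphere (0 : V) 1} (hΓ : ContMDiff 𝓘(ℝ, ℝ × ℝ) (𝓡 n) ∞ Γ) (a b s : ℝ) :
    energy F (fun t => Γ (s, t)) a b = ∫ t in a..b,
      randersNorm A (Γ (s, t)) (fderiv ℝ (fun p => (Γ p : V)) (s, t) (0, 1)) ^ 2 := by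
  refine intervalIntegral.integral_congr fun t _ => ?_
  have h1 : ContMDiff 𝓘(ℝ, ℝ) 𝓘(ℝ, ℝ × ℝ) ∞ fun t : ℝ => (s, t) :=
    (contDiff_const.prodMk contDiff_id).contMDiff
  have h2 := speed_eq hF (c := fun t => Γ (s, t)) (((hΓ.comp h1) t).mdifferentiableAt (by simp))
  simp only [h2]
  rw [(fderiv_apply_right_eq_deriv
    ((contMDiff_sphere_iff.1 hΓ).differentiable (by simp) (s, t))).deriv]

/-- U = ⊤ classifies all geodesics of the sphere; taking a block for U yields total geodesy of its
unit sphere. -/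
theorem IsGeodesicIn.exists_greatCircle (hF : ∀ x y, F x y = randersNorm A x (sphereIncl x y))
    (h : IsIsometryFlow A R) (hA : ∀ x : V, ‖x‖ = 1 → ‖A x‖ < 1) {U : Submodule ℝ V}
    (hRU : ∀ t, ∀ x ∈ U, R t x ∈ U) {N : Set (Metric.sphere (0 : V) 1)}
    (hN : ∀ x : Metric.sphere (0 : V) 1, x ∈ N ↔ (x : V) ∈ U) {c : ℝ → Metric.sphere (0 : V) 1}
    (hc : IsGeodesicIn F N c) :
    ∃ l : ℝ, 0 < l ∧ (∀ t, F (c t) (velocity (E := EuclideanSpace ℝ (Fin n)) c t) = l) ∧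
    ∃ p ∈ U, ∃ q ∈ U, ‖p‖ = 1 ∧ ‖q‖ = 1 ∧ inner ℝ p q = 0 ∧
      ∀ t, (c t : V) = R (l * t) (Real.cos (l * t) • p + Real.sin (l * t) • q) := by
  have : FiniteDimensional ℝ V := .of_fact_finrank_eq_succ n
  obtain ⟨hc1, hcN, ⟨l, hl, hcl⟩, hc2⟩ := hc
  refine ⟨l, hl, hcl, ?_⟩
  refine exists_greatCircle_of_critical h hA hRU hl (contMDiff_sphere_iff.1 hc1)
    (fun t => norm_eq_of_mem_sphere _) (fun t => (hN _).1 (hcN t))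
    (fun t => by rw [← hcl t, speed_eq hF ((hc1 t).mdifferentiableAt (by simp))]) ?_
  intro a b Γ hab hΓ hΓU hΓ0 hΓa hΓb
  have hΓS : ∀ p, Γ p ∈ Metric.sphere (0 : V) 1 := fun p => by simpa using (hΓU p).1
  have hΓm : ContMDiff 𝓘(ℝ, ℝ × ℝ) (𝓡 n) ∞ fun p => (⟨Γ p, hΓS p⟩ : Metric.sphere (0 : V) 1) :=
    contMDiff_sphere_iff.2 hΓ
  have := hc2 a b (fun p => ⟨Γ p, hΓS p⟩) hab hΓm (fun p => (hN _).2 (hΓU p).2)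
    (fun t => Subtype.ext (hΓ0 t)) (fun t => Subtype.ext (hΓa t)) (fun t => Subtype.ext (hΓb t))
  simpa only [energy_eq hF hΓm] using this

theorem isGeodesicIn_of_greatCircle (hF : ∀ x y, F x y = randersNorm A x (sphereIncl x y))
    (h : IsIsometryFlow A R) (hA : ∀ x : V, ‖x‖ = 1 → ‖A x‖ < 1)
    {c : ℝ → Metric.sphere (0 : V) 1} {l : ℝ} (hl : 0 < l) {p q : V} (hp : ‖p‖ = 1)
    (hq : ‖q‖ = 1) (hpq : inner ℝ p q = 0)
    (hc : ∀ t, (c t : V) = R (l * t) (Real.cos (l * t) • p + Real.sin (l * t) • q)) :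
    IsGeodesicIn F univ c ∧
      ∀ t, F (c t) (velocity (E := EuclideanSpace ℝ (Fin n)) c t) = l := by
  have hce : (fun t => (c t : V)) =
    fun t => R (l * t) (Real.cos (l * t) • p + Real.sin (l * t) • q) := funext hc
  have hc1 : ContMDiff 𝓘(ℝ, ℝ) (𝓡 n) ∞ c := by
    rw [contMDiff_sphere_iff, hce]
    exact h.contDiff_moving (contDiff_const.mul contDiff_id) (contDiff_cos_add_sin p q l)
  have hsp : ∀ t, F (c t) (velocity (E := EuclideanSpace ℝ (Fin n)) c t) = l := fun t => by
    have h1 := speed_eq hF ((hc1 t).mdifferentiableAt (by simp))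
    rw [hce, hc t] at h1
    exact h1.trans (randersNorm_moving_greatCircle h hA hp hq hpq hl t)
  refine ⟨⟨hc1, fun t => mem_univ _, ⟨l, hl, hsp⟩, ?_⟩, hsp⟩
  intro a b Γ hab hΓ _ hΓ0 hΓa hΓb
  have h2 := critical_moving_greatCircle h hA hp hq hpq hl hc hab (contMDiff_sphere_iff.1 hΓ)
    (fun p => norm_eq_of_mem_sphere _) (fun t => by rw [hΓ0]) (fun s => by rw [hΓa])
    (fun s => by rw [hΓb])
  simpa only [energy_eq hF hΓ] using h2

end Geodesics

end Finsler

/-! ### Isometries of the Randers sphere are linear; linear sections are submanifolds -/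

namespace Finsler

open Set Filter Topology MeasureTheory

section PlaneGeometry

variable {V : Type*} [NormedAddCommGroup V] [InnerProductSpace ℝ V]

/-- Two points of a round sphere of positive dimension lie on a common great circle. -/
theorem exists_cos_add_sin {U : Submodule ℝ V} {x y w₀ : V} (hx : x ∈ U) (hy : y ∈ U)
    (hw₀ : w₀ ∈ U) (hx1 : ‖x‖ = 1) (hy1 : ‖y‖ = 1) (hw1 : ‖w₀‖ = 1) (hxw : inner ℝ x w₀ = 0) :
    ∃ w ∈ U, ‖w‖ = 1 ∧ inner ℝ x w = 0 ∧ ∃ θ : ℝ, y = Real.cos θ • x + Real.sin θ • w := by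
  set c := inner ℝ x y with hc
  have hcb : |c| ≤ 1 := by
    have := abs_real_inner_le_norm x y
    rwa [hx1, hy1, one_mul] at this
  set z := y - c • x with hz
  have hzz : ‖z‖ ^ 2 = 1 - c ^ 2 := by
    rw [← real_inner_self_eq_norm_sq, hz]
    simp only [inner_sub_left, inner_sub_right, inner_smul_left, inner_smul_right,
      real_inner_self_eq_norm_sq, hx1, hy1, RCLike.conj_to_real, real_inner_comm x y, ← hc]
    ring
  have hcos : Real.cos (Real.arccos c) = c :=
    Real.cos_arccos (neg_le_of_abs_le hcb) (le_of_abs_le hcb)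
  have hsin : Real.sin (Real.arccos c) = ‖z‖ := by
    rw [Real.sin_arccos, ← hzz, Real.sqrt_sq (norm_nonneg _)]
  have hxz : inner ℝ x z = 0 := by
    rw [hz, inner_sub_right, inner_smul_right, real_inner_self_eq_norm_sq, hx1, ← hc]; ring
  by_cases h0 : z = 0
  -- Here y = ±x has no component orthogonal to x to normalize, and w₀ takes its place.
  · refine ⟨w₀, hw₀, hw1, hxw, Real.arccos c, ?_⟩
    rw [hcos, hsin, h0, norm_zero, zero_smul, add_zero]
    exact sub_eq_zero.1 h0
  · have hn : ‖z‖ ≠ 0 := norm_ne_zero_iff.2 h0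
    refine ⟨‖z‖⁻¹ • z, U.smul_mem _ (U.sub_mem hy (U.smul_mem _ hx)), ?_, ?_, Real.arccos c, ?_⟩
    · rw [norm_smul, norm_inv, norm_norm, inv_mul_cancel₀ hn]
    · rw [inner_smul_right, hxz, mul_zero]
    · rw [hcos, hsin, smul_inv_smul₀ hn, hz]; abel

theorem exists_unit_orthogonal [FiniteDimensional ℝ V] (h : 1 < Module.finrank ℝ V) (x : V) :
    ∃ w : V, ‖w‖ = 1 ∧ inner ℝ x w = 0 := by
  have h1 : (ℝ ∙ x)ᗮ ≠ ⊥ := by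
    intro h0
    have h2 := Submodule.finrank_add_finrank_orthogonal (ℝ ∙ x)
    have h3 : Module.finrank ℝ (ℝ ∙ x) ≤ 1 :=
      (finrank_span_le_card (R := ℝ) ({x} : Set V)).trans (by simp)
    rw [h0, finrank_bot] at h2
    omega
  obtain ⟨w, hw, hw0⟩ := Submodule.exists_mem_ne_zero_of_ne_bot h1
  have hn : ‖w‖ ≠ 0 := norm_ne_zero_iff.2 hw0
  refine ⟨‖w‖⁻¹ • w, by rw [norm_smul, norm_inv, norm_norm, inv_mul_cancel₀ hn], ?_⟩
  rw [inner_smul_right, Submodule.mem_orthogonal_singleton_iff_inner_right.1 hw, mul_zero]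

/-- With A = 0 the round metric is itself a case of the geodesic classification. -/
theorem isIsometryFlow_zero : IsIsometryFlow (0 : V →L[ℝ] V) fun _ => 1 where
  zero := rfl
  add _ _ := by simp
  contDiff := contDiff_const
  hasDerivAt t := by simpa using hasDerivAt_const t (1 : V →L[ℝ] V)
  norm _ _ := rfl

theorem randersNorm_zero (x y : V) : randersNorm 0 x y = ‖y‖ := by
  simp [randersNorm]

theorem norm_eq_one_of_randersNorm_eq_one {A : V →L[ℝ] V} {x y : V} (hx : ‖A x‖ < 1)
    (h : randersNorm A x y = 1) : ‖y - A x‖ = 1 := by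
  have := norm_sub_randersNorm_smul_wind A hx y
  rw [h, one_smul, real_inner_self_eq_norm_sq] at this
  exact (pow_left_inj₀ (norm_nonneg _) zero_le_one two_ne_zero).1 this

/-- The self-map of the unit sphere induced by a linear isometry. -/
def sphereMap (L : V ≃ₗᵢ[ℝ] V) : C(Metric.sphere (0 : V) 1, Metric.sphere (0 : V) 1) where
  toFun x := ⟨L x, by rw [mem_sphere_zero_iff_norm, L.norm_map, norm_eq_of_mem_sphere x]⟩
  continuous_toFun := by
    exact (L.continuous.comp continuous_subtype_val).subtype_mk _

theorem coe_sphereMap (L : V ≃ₗᵢ[ℝ] V) (x : Metric.sphere (0 : V) 1) :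
    (sphereMap L x : V) = L x := rfl

end PlaneGeometry

variable {V : Type*} [NormedAddCommGroup V] [InnerProductSpace ℝ V] {n : ℕ}
  [Fact (Module.finrank ℝ V = n + 1)] {A : V →L[ℝ] V}
  {F : ∀ x : Metric.sphere (0 : V) 1, TangentSpace (𝓡 n) x → ℝ}

section Isometries

/-- A Randers isometry is an isometry of the round metric: its differential preserves norms. -/
theorem norm_mfderiv_of_randers_isometry (hF : ∀ x y, F x y = randersNorm A x (sphereIncl x y))
    (hA : ∀ x : V, ‖x‖ = 1 → ‖A x‖ < 1) (hAs : ∀ x, inner ℝ x (A x) = 0)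
    {Φ : Metric.sphere (0 : V) 1 ≃ₘ^∞⟮𝓡 n, 𝓡 n⟯ Metric.sphere (0 : V) 1}
    (hΦ : ∀ x y, F (Φ x) (mfderiv (𝓡 n) (𝓡 n) Φ x y) = F x y) (x : Metric.sphere (0 : V) 1)
    (y : TangentSpace (𝓡 n) x) :
    ‖sphereIncl (Φ x) (mfderiv (𝓡 n) (𝓡 n) Φ x y)‖ = ‖sphereIncl x y‖ := by
  obtain ⟨w, hw⟩ := (exists_sphereIncl_eq_iff (n := n) x (A x)).2 (hAs x)
  obtain ⟨w', hw'⟩ := (exists_sphereIncl_eq_iff (n := n) (Φ x) (A (Φ x))).2 (hAs _)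
  set T := mfderiv (𝓡 n) (𝓡 n) Φ x with hT
  -- e is the amount by which the differential fails to carry wind to wind.
  set e := sphereIncl (Φ x) (T w - w') with he
  have hew : e = sphereIncl (Φ x) (T w) - A (Φ x) := by
    rw [he, sub_eq_add_neg, ← neg_one_smul ℝ w', sphereIncl_add, sphereIncl_smul, hw', neg_one_smul,
      sub_eq_add_neg]
  -- Indicatrices are unit spheres centred at the winds, and T maps one into the other.
  have key : ∀ u, ‖sphereIncl x u‖ = 1 → ‖sphereIncl (Φ x) (T u) + e‖ = 1 := by
    intro u hu
    have h1 : F x (w + u) = 1 := by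
      rw [hF, sphereIncl_add, hw]
      simpa using randersNorm_wind_add A (l := 1) (hA _ (norm_eq_of_mem_sphere x)) hu
    have h2 := hΦ x (w + u)
    rw [h1, hF, ← hT] at h2
    have h3 := norm_eq_one_of_randersNorm_eq_one (hA _ (norm_eq_of_mem_sphere (Φ x))) h2
    have h4 : sphereIncl (Φ x) (T u) + e = sphereIncl (Φ x) (T (w + u)) - A (Φ x) := by
      rw [map_add, sphereIncl_add, hew]; abel
    rw [h4]
    exact h3
  -- Comparing u with −u separates the equation |T u + e| = 1 into its odd and even parts.
  have key2 : ∀ u, ‖sphereIncl x u‖ = 1 → inner ℝ (sphereIncl (Φ x) (T u)) e = 0 ∧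
      ‖sphereIncl (Φ x) (T u)‖ ^ 2 = 1 - ‖e‖ ^ 2 := by
    intro u hu
    have h1 := key u hu
    have h2 := key (-u) (by rw [← neg_one_smul ℝ u, sphereIncl_smul, norm_smul, hu]; simp)
    rw [map_neg, ← neg_one_smul ℝ (T u), sphereIncl_smul, neg_one_smul] at h2
    have h3 := norm_add_sq_real (sphereIncl (Φ x) (T u)) e
    have h4 := norm_add_sq_real (-sphereIncl (Φ x) (T u)) e
    rw [h1] at h3
    rw [h2, inner_neg_left, norm_neg] at h4
    constructor <;> linarith
  have hscale : ∀ u : TangentSpace (𝓡 n) x, sphereIncl x u ≠ 0 → ∃ r : ℝ, 0 < r ∧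
      ∃ v, ‖sphereIncl x v‖ = 1 ∧ u = r • v ∧ r = ‖sphereIncl x u‖ := by
    intro u hu
    have hn : ‖sphereIncl x u‖ ≠ 0 := norm_ne_zero_iff.2 hu
    refine ⟨‖sphereIncl x u‖, norm_pos_iff.2 hu, ‖sphereIncl x u‖⁻¹ • u, ?_, ?_, rfl⟩
    · rw [sphereIncl_smul, norm_smul, norm_inv, norm_norm, inv_mul_cancel₀ hn]
    · rw [smul_inv_smul₀ hn]
  -- T is onto, so e is the image of some vector; since e is orthogonal to all images, it is
  -- orthogonal to itself.
  have he0 : e = 0 := by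
    have hsurj : Function.Surjective T :=
      (Φ.toOpenPartialHomeomorph_mdifferentiable (by simp)).mfderiv_surjective (mem_univ x)
    obtain ⟨v, hv⟩ := hsurj (T w - w')
    have hve : e = sphereIncl (Φ x) (T v) := by rw [hv]
    by_cases h0 : sphereIncl x v = 0
    · have : v = 0 := sphereIncl_injective x (by
        rw [h0, ← zero_smul ℝ v, sphereIncl_smul, zero_smul])
      rw [hve, this, map_zero, ← zero_smul ℝ w', sphereIncl_smul, zero_smul]
    · obtain ⟨r, hr, u, hu, rfl, -⟩ := hscale v h0
      have h1 := (key2 u hu).1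
      have h2 : e = r • sphereIncl (Φ x) (T u) := by rw [hve, map_smul, sphereIncl_smul]
      have h3 : inner ℝ e e = 0 := by
        nth_rewrite 1 [h2]
        rw [inner_smul_left, h1, mul_zero]
      exact inner_self_eq_zero.1 h3
  by_cases h0 : sphereIncl x y = 0
  · have : y = 0 := sphereIncl_injective x (by
      rw [h0, ← zero_smul ℝ y, sphereIncl_smul, zero_smul])
    rw [h0, this, map_zero, ← zero_smul ℝ w', sphereIncl_smul, zero_smul]
  · obtain ⟨r, hr, u, hu, rfl, hru⟩ := hscale y h0
    have h1 := (key2 u hu).2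
    rw [he0, norm_zero] at h1
    have h2 : ‖sphereIncl (Φ x) (T u)‖ = 1 :=
      (pow_left_inj₀ (norm_nonneg _) zero_le_one two_ne_zero).1 (by rw [h1]; ring)
    rw [map_smul, sphereIncl_smul, sphereIncl_smul, norm_smul, norm_smul, hu, h2]

/-- A Randers isometry of the sphere preserves the inner product of the ambient space. -/
theorem inner_map_of_mem_isometries (hn : 1 ≤ n)
    (hF : ∀ x y, F x y = randersNorm A x (sphereIncl x y))
    (hA : ∀ x : V, ‖x‖ = 1 → ‖A x‖ < 1) (hAs : ∀ x, inner ℝ x (A x) = 0)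
    {g : C(Metric.sphere (0 : V) 1, Metric.sphere (0 : V) 1)} (hg : g ∈ isometries F)
    (x y : Metric.sphere (0 : V) 1) : inner ℝ (g x : V) (g y) = inner ℝ (x : V) y := by
  have hV : Module.finrank ℝ V = n + 1 := Fact.out
  have : FiniteDimensional ℝ V := .of_fact_finrank_eq_succ n
  have h0 : ∀ x : V, ‖x‖ = 1 → ‖(0 : V →L[ℝ] V) x‖ < 1 := by simp
  -- For the round metric F₀ the geodesics are great circles. Thus g carries the unit-speed great
  -- circle from x to y to another one, and both inner products equal the cosine of the same
  -- parameter θ.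
  set F₀ : ∀ x : Metric.sphere (0 : V) 1, TangentSpace (𝓡 n) x → ℝ :=
    fun x y => randersNorm (0 : V →L[ℝ] V) (x : V) (sphereIncl x y) with hF₀
  have hg₀ : g ∈ isometries F₀ := by
    obtain ⟨Φ, hΦg, hΦ⟩ := hg
    refine ⟨Φ, hΦg, fun x y => ?_⟩
    simp only [hF₀, randersNorm_zero]
    exact norm_mfderiv_of_randers_isometry hF hA hAs hΦ x y
  obtain ⟨w₀, hw1, hxw⟩ := exists_unit_orthogonal (by omega) (x : V)
  obtain ⟨w, -, hw, hxw, θ, hθ⟩ := exists_cos_add_sin (U := ⊤) (x := (x : V)) (y := (y : V))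
    trivial trivial trivial (norm_eq_of_mem_sphere x) (norm_eq_of_mem_sphere y) hw1 hxw
  have hx1 : ‖(x : V)‖ = 1 := norm_eq_of_mem_sphere x
  let c : ℝ → Metric.sphere (0 : V) 1 := fun t =>
    ⟨Real.cos t • (x : V) + Real.sin t • w, by simpa using norm_cos_add_sin hx1 hw hxw t⟩
  obtain ⟨hc, hcs⟩ := isGeodesicIn_of_greatCircle (F := F₀) (fun _ _ => rfl) isIsometryFlow_zero h0
    (c := c) zero_lt_one hx1 hw hxw (fun t => by simp [c])
  obtain ⟨hgc, hgs⟩ := hc.isometry_comp hg₀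
  obtain ⟨l, hl, hls, p, -, q, -, hp, hq, hpq, hcpq⟩ := hgc.exists_greatCircle (fun _ _ => rfl)
    isIsometryFlow_zero h0 (U := ⊤) (fun _ _ _ => trivial) (by simp)
  have hl1 : l = 1 := (hls 0).symm.trans ((hgs 0).trans (hcs 0))
  subst hl1
  have hx : c 0 = x := Subtype.ext (by simp [c])
  have hy : c θ = y := Subtype.ext hθ.symm
  have e0 := hcpq 0
  have e1 := hcpq θ
  rw [hx] at e0
  rw [hy] at e1
  rw [e0, e1, hθ]
  simp [inner_add_right, inner_smul_right, hp, hx1, hpq, hxw]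

/-- A Randers isometry of the sphere is the restriction of a linear isometry. -/
theorem exists_linearIsometryEquiv_of_mem_isometries (hn : 1 ≤ n)
    (hF : ∀ x y, F x y = randersNorm A x (sphereIncl x y))
    (hA : ∀ x : V, ‖x‖ = 1 → ‖A x‖ < 1) (hAs : ∀ x, inner ℝ x (A x) = 0)
    {g : C(Metric.sphere (0 : V) 1, Metric.sphere (0 : V) 1)} (hg : g ∈ isometries F) :
    ∃ L : V ≃ₗᵢ[ℝ] V, ∀ x, (g x : V) = L x := by
  have : FiniteDimensional ℝ V := .of_fact_finrank_eq_succ n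
  have hV : Module.finrank ℝ V = n + 1 := Fact.out
  let b := (stdOrthonormalBasis ℝ V)
  have hbS : ∀ i, b i ∈ Metric.sphere (0 : V) 1 := fun i => by simp
  have hin := inner_map_of_mem_isometries hn hF hA hAs hg
  let v : Fin (Module.finrank ℝ V) → V := fun i => g ⟨b i, hbS i⟩
  have hv : Orthonormal ℝ v := by
    rw [orthonormal_iff_ite]
    intro i j
    rw [hin]
    exact orthonormal_iff_ite.1 b.orthonormal i j
  have hne : Nonempty (Fin (Module.finrank ℝ V)) := by rw [hV]; infer_instance
  have hsp : ⊤ ≤ Submodule.span ℝ (Set.range v) := by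
    have h1 := (basisOfOrthonormalOfCardEqFinrank hv (by simp)).span_eq
    rw [coe_basisOfOrthonormalOfCardEqFinrank] at h1
    exact h1.ge
  let b' := OrthonormalBasis.mk hv hsp
  refine ⟨b.equiv b' (Equiv.refl _), fun x => ?_⟩
  refine b'.repr.injective (PiLp.ext fun i => ?_)
  rw [b'.repr_apply_apply, b'.repr_apply_apply]
  have e1 : b' i = b.equiv b' (Equiv.refl _) (b i) := by simp
  have e2 : b' i = v i := by simp [b']
  nth_rewrite 2 [e1]
  rw [LinearIsometryEquiv.inner_map_map, e2, hin]

end Isometries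

section LinearMaps

theorem contMDiff_sphereMap (L : V ≃ₗᵢ[ℝ] V) : ContMDiff (𝓡 n) (𝓡 n) ∞ (sphereMap L) :=
  ((L.contDiff.contMDiff.comp contMDiff_coe_sphere).codRestrict_sphere fun x => (sphereMap L x).2)

theorem sphereMap_mem_isometries (hF : ∀ x y, F x y = randersNorm A x (sphereIncl x y))
    {L : V ≃ₗᵢ[ℝ] V} (hL : ∀ x, A (L x) = L (A x)) : sphereMap L ∈ isometries F := by
  have hinv : ∀ L : V ≃ₗᵢ[ℝ] V, ∀ x, sphereMap L.symm (sphereMap L x) = x := fun L x =>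
    Subtype.ext (by simp [coe_sphereMap])
  refine ⟨⟨⟨sphereMap L, sphereMap L.symm, hinv L, hinv L.symm⟩, contMDiff_sphereMap L,
    contMDiff_sphereMap L.symm⟩, fun _ => rfl, fun x y => ?_⟩
  have hd : ∀ y, sphereIncl (sphereMap L x) (mfderiv (𝓡 n) (𝓡 n) (sphereMap L) x y) =
      L (sphereIncl x y) := by
    intro y
    have h1 := mfderiv_comp x
      ((contMDiff_coe_sphere (m := 1) (n := n) (sphereMap L x)).mdifferentiableAt one_ne_zero)
      ((contMDiff_sphereMap (n := n) L x).mdifferentiableAt (by simp))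
    have h2 := mfderiv_comp x (L.contDiff (n := 1).contMDiff.mdifferentiableAt one_ne_zero)
      ((contMDiff_coe_sphere (m := 1) (n := n) x).mdifferentiableAt one_ne_zero)
    refine (congrArg (fun T => T y) (h1.symm.trans h2)).trans ?_
    have h3 : mfderiv 𝓘(ℝ, V) 𝓘(ℝ, V) L (x : V) =
        (L.toContinuousLinearEquiv : V →L[ℝ] V) :=
      mfderiv_eq_fderiv.trans L.toContinuousLinearEquiv.hasFDerivAt.fderiv
    rw [h3]
    rfl
  change F (sphereMap L x) (mfderiv (𝓡 n) (𝓡 n) (sphereMap L) x y) = F x y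
  rw [hF, hF, hd, coe_sphereMap]
  simp only [randersNorm, hL, L.inner_map_map]

end LinearMaps

namespace IsIsometryFlow

variable {K : V →L[ℝ] V} {S : ℝ → V →L[ℝ] V}

/-- The linear isometries of an isometry flow. -/
def equiv (h : IsIsometryFlow K S) (t : ℝ) : V ≃ₗᵢ[ℝ] V where
  toFun := S t
  map_add' := map_add (S t)
  map_smul' := map_smul (S t)
  invFun := S (-t)
  left_inv := h.neg_apply t
  right_inv := h.apply_neg t
  norm_map' := h.norm t

/-- The flow on the unit sphere. -/
def sphereFlow (h : IsIsometryFlow K S) (t : ℝ) :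
    C(Metric.sphere (0 : V) 1, Metric.sphere (0 : V) 1) :=
  sphereMap (h.equiv t)

theorem coe_sphereFlow (h : IsIsometryFlow K S) (t : ℝ) (x : Metric.sphere (0 : V) 1) :
    (h.sphereFlow t x : V) = S t x := rfl

theorem continuous_sphereFlow (h : IsIsometryFlow K S) : Continuous h.sphereFlow := by
  refine ContinuousMap.continuous_of_continuous_uncurry _ ?_
  refine Continuous.subtype_mk (f := fun p : ℝ × Metric.sphere (0 : V) 1 => S p.1 p.2) ?_ _
  exact (h.contDiff.continuous.comp continuous_fst).clm_apply
    (continuous_subtype_val.comp continuous_snd)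

theorem sphereFlow_zero (h : IsIsometryFlow K S) : h.sphereFlow 0 = ContinuousMap.id _ := by
  ext x; simp [coe_sphereFlow, h.zero]

theorem sphereFlow_add (h : IsIsometryFlow K S) (s t : ℝ) :
    h.sphereFlow (s + t) = (h.sphereFlow s).comp (h.sphereFlow t) := by
  ext x; simp [coe_sphereFlow, h.add]

theorem sphereFlow_neg (h : IsIsometryFlow K S) (t : ℝ) (x : Metric.sphere (0 : V) 1) :
    h.sphereFlow (-t) (h.sphereFlow t x) = x :=
  Subtype.ext (h.neg_apply t x)

theorem sphereFlow_mem_connectedComponentIn (h : IsIsometryFlow K S)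
    {X : Set C(Metric.sphere (0 : V) 1, Metric.sphere (0 : V) 1)}
    (hX : ∀ t, h.sphereFlow t ∈ X) (t : ℝ) :
    h.sphereFlow t ∈ connectedComponentIn X (ContinuousMap.id _) :=
  (isPreconnected_range h.continuous_sphereFlow).subset_connectedComponentIn
    ⟨0, h.sphereFlow_zero⟩ (by rintro _ ⟨t, rfl⟩; exact hX t) ⟨t, rfl⟩

theorem sphereFlow_mem_connIsometries (h : IsIsometryFlow K S)
    (hF : ∀ x y, F x y = randersNorm A x (sphereIncl x y))
    (hKA : ∀ t x, A (S t x) = S t (A x)) (t : ℝ) : h.sphereFlow t ∈ connIsometries F :=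
  h.sphereFlow_mem_connectedComponentIn (fun t => sphereMap_mem_isometries hF (hKA t)) t

/-- The orbits of the flow on the sphere are integral curves of the field `x ↦ K x`. -/
theorem isMIntegralCurve_sphereFlow (h : IsIsometryFlow K S)
    {X : ∀ x : Metric.sphere (0 : V) 1, TangentSpace (𝓡 n) x} (hX : ∀ x, sphereIncl x (X x) = K x)
    (x : Metric.sphere (0 : V) 1) : IsMIntegralCurve (fun t => h.sphereFlow t x) X := by
  intro t
  have hd : HasDerivAt (fun t => (h.sphereFlow t x : V)) (K (S t x)) t := by
    have := (h.hasDerivAt t).clm_apply (hasDerivAt_const t (x : V))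
    simp only [map_zero, add_zero] at this
    exact this
  have hc : ContMDiff 𝓘(ℝ, ℝ) (𝓡 n) ∞ fun t => h.sphereFlow t x :=
    contMDiff_sphere_iff.2 (h.contDiff.clm_apply contDiff_const)
  have hm := (hc t).mdifferentiableAt (by simp)
  have e : velocity (E := EuclideanSpace ℝ (Fin n)) (fun t => h.sphereFlow t x) t =
      X (h.sphereFlow t x) := by
    refine sphereIncl_injective (n := n) (h.sphereFlow t x) ?_
    exact (sphereIncl_velocity hm).trans (hd.deriv.trans (hX (h.sphereFlow t x)).symm)
  have e2 : mfderiv 𝓘(ℝ, ℝ) (𝓡 n) (fun t => h.sphereFlow t x) t =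
      (1 : ℝ →L[ℝ] ℝ).smulRight (X (h.sphereFlow t x)) :=
    ContinuousLinearMap.ext_ring (e.trans (one_smul ℝ _).symm)
  exact e2 ▸ hm.hasMFDerivAt

end IsIsometryFlow

/-- The sections of the sphere by linear subspaces are embedded submanifolds. -/
theorem isEmbeddedSubmanifold_section (U : Submodule ℝ V) {N : Set (Metric.sphere (0 : V) 1)}
    (hN : ∀ x : Metric.sphere (0 : V) 1, x ∈ N ↔ (x : V) ∈ U) :
    IsEmbeddedSubmanifold (EuclideanSpace ℝ (Fin n)) N := by
  have : FiniteDimensional ℝ V := .of_fact_finrank_eq_succ n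
  -- The truncated subtraction is harmless: for U = 0 there is no point x to check.
  refine ⟨Module.finrank ℝ U - 1, fun x hx => ?_⟩
  have hxU := (hN x).1 hx
  -- The chart at x is stereographic projection from −x, which again lies in U. The image of y is a
  -- nonzero multiple of y − ⟨v, y⟩ v, and this lies in U exactly when y does.
  set v : Metric.sphere (0 : V) 1 := -x with hv
  have hvx : (v : V) = -x := rfl
  have hvU : (v : V) ∈ U := by rw [hvx]; exact U.neg_mem hxU
  have hv1 : ‖(v : V)‖ = 1 := norm_eq_of_mem_sphere v
  have hv0 : (v : V) ≠ 0 := ne_zero_of_mem_unit_sphere v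
  let e := (OrthonormalBasis.fromOrthogonalSpanSingleton (𝕜 := ℝ) n hv0).repr
  have hchart : chartAt (EuclideanSpace ℝ (Fin n)) x = stereographic' n v := rfl
  let K : Submodule ℝ (ℝ ∙ (v : V))ᗮ := U.comap (ℝ ∙ (v : V))ᗮ.subtype
  refine ⟨stereographic' n v, hchart ▸ IsManifold.chart_mem_maximalAtlas x,
    hchart ▸ mem_chart_source _ x, K.map e.toLinearEquiv.toLinearMap, ?_, ?_⟩
  · rw [LinearEquiv.finrank_map_eq]
    have h1 : Module.finrank ℝ K = Module.finrank ℝ ((ℝ ∙ (v : V))ᗮ ⊓ U : Submodule ℝ V) := by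
      rw [← Submodule.map_comap_subtype]
      exact (LinearEquiv.finrank_eq
        (Submodule.equivMapOfInjective _ (Submodule.subtype_injective _) K))
    have h2 := Submodule.finrank_add_inf_finrank_orthogonal
      (K₁ := (ℝ ∙ (v : V))) (K₂ := U) (by simpa using hvU)
    rw [finrank_span_singleton hv0] at h2
    omega
  · intro y hy
    have hyv : (y : V) ≠ v := fun h => by
      rw [stereographic'_source] at hy
      exact hy (Subtype.ext h)
    have h1 : (stereographic' n v y ∈ K.map e.toLinearEquiv.toLinearMap) ↔
        (stereoToFun (v : V) y : V) ∈ U := by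
      constructor
      · rintro ⟨z, hz, hze⟩
        have : z = stereoToFun (v : V) y := e.injective hze
        rw [← this]; exact hz
      · intro h
        exact ⟨stereoToFun (v : V) y, h, rfl⟩
    rw [h1, hN, stereoToFun_apply]
    have ha : inner ℝ (v : V) y < 1 :=
      (inner_lt_one_iff_real_of_norm_eq_one hv1 (norm_eq_of_mem_sphere y)).2 hyv.symm
    have hc : (2 / ((1 : ℝ) - innerSL ℝ (v : V) (y : V))) ≠ 0 := by
      rw [innerSL_apply_apply]
      exact div_ne_zero two_ne_zero (sub_pos.2 ha).ne'
    rw [Submodule.coe_smul, U.smul_mem_iff hc]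
    have hp : (((ℝ ∙ (v : V))ᗮ.orthogonalProjectionOnto (y : V) : (ℝ ∙ (v : V))ᗮ) : V) =
        y - inner ℝ (v : V) y • (v : V) := by
      have := (ℝ ∙ (v : V)).starProjection_add_starProjection_orthogonal (y : V)
      rw [Submodule.starProjection_unit_singleton ℝ hv1] at this
      exact eq_sub_of_add_eq' this
    rw [hp]
    exact (U.sub_mem_iff_left (U.smul_mem _ hvU)).symm

end Finsler

/-! ### Block families: commuting partial complex structures and their flows -/

namespace Finsler

open Set Filter Topology MeasureTheory

variable {V : Type*} [NormedAddCommGroup V] [InnerProductSpace ℝ V]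

/-- For skew A the solutions of u' = A u have constant norm. This gives the isometry property and,
applied to the difference of two solutions, the uniqueness behind the group law. -/
theorem IsIsometryFlow.of_hasDerivAt {A : V →L[ℝ] V} {R : ℝ → V →L[ℝ] V}
    (hA : ∀ x, inner ℝ x (A x) = 0) (h0 : R 0 = 1) (hR : ContDiff ℝ ∞ R)
    (hd : ∀ t, HasDerivAt R (A * R t) t) : IsIsometryFlow A R := by
  have key : ∀ u : ℝ → V, (∀ t, HasDerivAt u (A (u t)) t) → ∀ t, ‖u t‖ = ‖u 0‖ := by
    intro u hu t
    have h1 : ∀ t, HasDerivAt (fun t => inner ℝ (u t) (u t)) 0 t := fun t => by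
      refine ((hu t).inner ℝ (hu t)).congr_deriv ?_
      rw [real_inner_comm (u t), hA, add_zero]
    have h2 := is_const_of_deriv_eq_zero (fun t => (h1 t).differentiableAt)
      (fun t => (h1 t).deriv) t 0
    simp only [real_inner_self_eq_norm_sq] at h2
    exact (pow_left_inj₀ (norm_nonneg _) (norm_nonneg _) two_ne_zero).1 h2
  have hx : ∀ x t, HasDerivAt (fun t => R t x) (A (R t x)) t := fun x t => by
    have := (hd t).clm_apply (hasDerivAt_const t x)
    simp only [map_zero, add_zero] at this
    exact this
  refine ⟨h0, fun s t => ?_, hR, hd, fun t x => ?_⟩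
  · ext x
    have h1 : ∀ s, HasDerivAt (fun s => R (s + t) x - R s (R t x))
        (A (R (s + t) x - R s (R t x))) s := fun s => by
      rw [map_sub]
      exact ((hx x (s + t)).comp_add_const s t).sub (hx (R t x) s)
    have h2 := key _ h1 s
    simp only [zero_add, h0, one_apply_eq_self, sub_self, norm_zero] at h2
    exact sub_eq_zero.1 (norm_eq_zero.1 h2)
  · have := key _ (hx x) t
    simpa [h0] using this

/-- A family of partial complex structures with pairwise orthogonal supports: `J i` is skew, and
it is a complex structure on its range. -/
structure IsBlockFamily {ι : Type*} (J : ι → V →L[ℝ] V) : Prop where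
  skew : ∀ i x y, inner ℝ (J i x) y = -inner ℝ x (J i y)
  cube : ∀ i x, J i (J i (J i x)) = -J i x
  orth : ∀ i j, i ≠ j → ∀ x, J i (J j x) = 0

/-- The subspace on which `J i` is a complex structure. -/
def block {ι : Type*} (J : ι → V →L[ℝ] V) (i : ι) : Submodule ℝ V :=
  LinearMap.ker ((J i * J i + 1 : V →L[ℝ] V) : V →ₗ[ℝ] V)

/-- The common kernel of the `J i`. -/
def residual {ι : Type*} (J : ι → V →L[ℝ] V) : Submodule ℝ V :=
  ⨅ i, LinearMap.ker (J i : V →ₗ[ℝ] V)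

/-- The field `∑ λᵢ Jᵢ`. -/
noncomputable def blockField {ι : Type*} [Fintype ι] (J : ι → V →L[ℝ] V) (lam : ι → ℝ) :
    V →L[ℝ] V :=
  ∑ i, lam i • J i

/-- The flow of the field `∑ λᵢ Jᵢ`. -/
noncomputable def blockFlow {ι : Type*} [Fintype ι] (J : ι → V →L[ℝ] V) (lam : ι → ℝ) (t : ℝ) :
    V →L[ℝ] V :=
  1 + ∑ i, (Real.sin (lam i * t) • J i + (1 - Real.cos (lam i * t)) • (J i * J i))

/-- The rotation by the angle `θ` in the block `i`. -/
noncomputable def blockRot {ι : Type*} (J : ι → V →L[ℝ] V) (i : ι) (θ : ℝ) (x : V) : V :=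
  Real.cos θ • x + Real.sin θ • J i x

section Algebra

variable {ι : Type*} {J : ι → V →L[ℝ] V}

theorem mem_block {i : ι} {x : V} : x ∈ block J i ↔ J i (J i x) = -x := by
  simp [block, eq_neg_iff_add_eq_zero]

theorem mem_residual {x : V} : x ∈ residual J ↔ ∀ i, J i x = 0 := by
  simp [residual]

namespace IsBlockFamily

theorem inner_self (hJ : IsBlockFamily J) (i : ι) (x : V) : inner ℝ x (J i x) = 0 := by
  have := hJ.skew i x x
  rw [real_inner_comm] at this
  linarith

theorem apply_mem_block (hJ : IsBlockFamily J) (i : ι) (x : V) : J i x ∈ block J i :=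
  mem_block.2 (hJ.cube i x)

theorem apply_eq_zero (hJ : IsBlockFamily J) {i j : ι} (hij : j ≠ i) {x : V}
    (hx : x ∈ block J i) : J j x = 0 := by
  have h1 : x = -J i (J i x) := by rw [mem_block.1 hx, neg_neg]
  rw [h1, map_neg, hJ.orth j i hij, neg_zero]

theorem norm_apply_of_mem (hJ : IsBlockFamily J) {i : ι} {x : V} (hx : x ∈ block J i) :
    ‖J i x‖ = ‖x‖ := by
  have : ‖J i x‖ ^ 2 = ‖x‖ ^ 2 := by
    rw [← real_inner_self_eq_norm_sq, hJ.skew, mem_block.1 hx, inner_neg_right, neg_neg,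
      real_inner_self_eq_norm_sq]
  exact (pow_left_inj₀ (norm_nonneg _) (norm_nonneg _) two_ne_zero).1 this

theorem inner_map_map_of_mem (hJ : IsBlockFamily J) {i : ι} {x : V} (y : V)
    (hx : x ∈ block J i) : inner ℝ (J i x) (J i y) = inner ℝ x y := by
  have := hJ.skew i (J i x) y
  rw [mem_block.1 hx, inner_neg_left] at this
  linarith

theorem inner_apply_apply_of_ne (hJ : IsBlockFamily J) {i j : ι} (hij : i ≠ j) (x y : V) :
    inner ℝ (J i x) (J j y) = 0 := by
  rw [hJ.skew, hJ.orth i j hij, inner_zero_right, neg_zero]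

theorem disjoint_block (hJ : IsBlockFamily J) {i j : ι} (hij : i ≠ j) {x : V}
    (hi : x ∈ block J i) (hj : x ∈ block J j) : x = 0 := by
  have h := mem_block.1 hi
  rw [hJ.apply_eq_zero hij hj, map_zero] at h
  exact neg_eq_zero.1 h.symm

theorem eq_zero_of_block_of_residual {i : ι} {x : V} (hi : x ∈ block J i)
    (hr : x ∈ residual J) : x = 0 := by
  have h := mem_block.1 hi
  rw [mem_residual.1 hr, map_zero] at h
  exact neg_eq_zero.1 h.symm

theorem blockRot_mem {i : ι} {x : V} (hx : x ∈ block J i) (θ : ℝ) : blockRot J i θ x ∈ block J i := by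
  refine (block J i).add_mem ((block J i).smul_mem _ hx) ((block J i).smul_mem _ ?_)
  rw [mem_block, mem_block.1 hx, map_neg]

theorem blockRot_add {i : ι} {x : V} (hx : x ∈ block J i) (θ φ : ℝ) :
    blockRot J i (θ + φ) x = blockRot J i θ (blockRot J i φ x) := by
  simp only [blockRot, map_add, map_smul, mem_block.1 hx, Real.cos_add, Real.sin_add]
  module

theorem norm_blockRot (hJ : IsBlockFamily J) {i : ι} {x : V} (hx : x ∈ block J i) (θ : ℝ) :
    ‖blockRot J i θ x‖ = ‖x‖ := by
  have : ‖blockRot J i θ x‖ ^ 2 = ‖x‖ ^ 2 := by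
    rw [← real_inner_self_eq_norm_sq, blockRot]
    simp only [inner_add_left, inner_add_right, inner_smul_left, inner_smul_right,
      RCLike.conj_to_real, hJ.inner_self, hJ.skew i x x, hJ.inner_map_map_of_mem x hx,
      real_inner_self_eq_norm_sq]
    linear_combination ‖x‖ ^ 2 * Real.sin_sq_add_cos_sq θ
  exact (pow_left_inj₀ (norm_nonneg _) (norm_nonneg _) two_ne_zero).1 this

/-- A block rotation fixing a nonzero vector is trivial. -/
theorem cos_eq_one_of_blockRot_eq (hJ : IsBlockFamily J) {i : ι} {x : V} (hx0 : x ≠ 0) {θ : ℝ}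
    (h : blockRot J i θ x = x) : Real.cos θ = 1 := by
  have h1 := congrArg (inner ℝ x) h
  simp only [blockRot, inner_add_right, inner_smul_right, hJ.inner_self, mul_zero, add_zero] at h1
  exact mul_right_cancel₀ (inner_self_ne_zero.2 hx0) (by rw [h1, one_mul])

end IsBlockFamily

variable [Fintype ι]

namespace IsBlockFamily

theorem skew_blockField (hJ : IsBlockFamily J) (lam : ι → ℝ) (x : V) :
    inner ℝ x (blockField J lam x) = 0 := by
  simp [blockField, inner_sum, inner_smul_right, hJ.inner_self]

/-- Since Jᵢ³ = −Jᵢ and distinct Jᵢ annihilate each other, the exponential of t ∑ λᵢ Jᵢ collapses to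
the trigonometric expression `blockFlow`; differentiating it confirms this. -/
theorem isIsometryFlow (hJ : IsBlockFamily J) (lam : ι → ℝ) :
    IsIsometryFlow (blockField J lam) (blockFlow J lam) := by
  have hlin : ∀ (c t : ℝ), HasDerivAt (fun t : ℝ => c * t) c t := fun c t => by
    simpa using (hasDerivAt_id t).const_mul c
  refine .of_hasDerivAt (hJ.skew_blockField lam) (by simp [blockFlow]) ?_ fun t => ?_
  · unfold blockFlow
    refine contDiff_const.add (ContDiff.sum fun i _ => ?_)
    have h : ContDiff ℝ ∞ fun t : ℝ => lam i * t := contDiff_const.mul contDiff_id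
    exact (h.sin.smul contDiff_const).add ((contDiff_const.sub h.cos).smul contDiff_const)
  · have h1 : HasDerivAt (blockFlow J lam) (∑ i, ((Real.cos (lam i * t) * lam i) • J i +
        (Real.sin (lam i * t) * lam i) • (J i * J i))) t := by
      unfold blockFlow
      refine HasDerivAt.const_add 1 (HasDerivAt.fun_sum fun i _ => ?_)
      refine ((hlin (lam i) t).sin.smul_const (J i)).add ?_
      refine (((hlin (lam i) t).cos.const_sub 1).smul_const (J i * J i)).congr_deriv ?_
      rw [neg_mul, neg_neg]
    refine h1.congr_deriv ?_
    ext x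
    simp only [blockField, blockFlow, mul_apply_eq_comp, add_apply,
      sum_apply, smul_apply, one_apply_eq_self]
    refine Finset.sum_congr rfl fun i _ => ?_
    have h2 : J i (∑ j, (Real.sin (lam j * t) • J j x + (1 - Real.cos (lam j * t)) • J j (J j x))) =
        Real.sin (lam i * t) • J i (J i x) - (1 - Real.cos (lam i * t)) • J i x := by
      rw [map_sum, Finset.sum_eq_single i]
      · simp only [map_add, map_smul, hJ.cube]; module
      · intro j _ hj
        simp only [map_add, map_smul, hJ.orth i j hj.symm]; simp
      · simp
    rw [map_add, h2]
    module

theorem blockFlow_of_mem_block (hJ : IsBlockFamily J) (lam : ι → ℝ) {i : ι} {x : V}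
    (hx : x ∈ block J i) (t : ℝ) : blockFlow J lam t x = blockRot J i (lam i * t) x := by
  simp only [blockFlow, mul_apply_eq_comp, add_apply,
    sum_apply, smul_apply, one_apply_eq_self]
  rw [Finset.sum_eq_single i]
  · rw [mem_block.1 hx, blockRot]; module
  · intro j _ hj
    simp only [hJ.apply_eq_zero hj hx, map_zero, smul_zero, add_zero]
  · simp

theorem blockFlow_of_mem_residual (lam : ι → ℝ) {x : V} (hx : x ∈ residual J) (t : ℝ) :
    blockFlow J lam t x = x := by
  simp [blockFlow, mem_residual.1 hx]

/-- The component of a vector in the common kernel. -/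
theorem add_sum_mem_residual (hJ : IsBlockFamily J) (x : V) :
    x + ∑ i, J i (J i x) ∈ residual J := by
  refine mem_residual.2 fun i => ?_
  rw [map_add, map_sum, Finset.sum_eq_single i]
  · rw [hJ.cube]; simp
  · intro j _ hj; rw [hJ.orth i j hj.symm]
  · simp

theorem apply_comm_blockFlow (hJ : IsBlockFamily J) (lam : ι → ℝ) (i : ι) (t : ℝ) (x : V) :
    J i (blockFlow J lam t x) = blockFlow J lam t (J i x) := by
  simp only [blockFlow, mul_apply_eq_comp, add_apply,
    sum_apply, smul_apply, one_apply_eq_self,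
    map_add, map_sum, map_smul]
  congr 1
  refine Finset.sum_congr rfl fun j _ => ?_
  by_cases h : i = j
  · rw [h]
  · simp [hJ.orth i j h, hJ.orth j i (Ne.symm h)]

/-- |A x|² = ∑ λᵢ² |Jᵢ x|², while ∑ |Jᵢ x|² ≤ |x|² because the difference is the squared norm of the
component in the common kernel. -/
theorem norm_blockField_lt_one (hJ : IsBlockFamily J) {lam : ι → ℝ}
    (hlam : ∀ i, 0 ≤ lam i ∧ lam i < 1) (x : V) (hx : ‖x‖ = 1) : ‖blockField J lam x‖ < 1 := by
  have h1 : ‖blockField J lam x‖ ^ 2 = ∑ i, lam i ^ 2 * ‖J i x‖ ^ 2 := by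
    rw [← real_inner_self_eq_norm_sq]
    simp only [blockField, sum_apply, smul_apply,
      sum_inner, inner_sum, inner_smul_left, inner_smul_right, RCLike.conj_to_real]
    refine Finset.sum_congr rfl fun i _ => ?_
    rw [Finset.sum_eq_single i]
    · rw [real_inner_self_eq_norm_sq]; ring
    · intro j _ hj; rw [hJ.inner_apply_apply_of_ne hj]; ring
    · simp
  have h2 : ∑ i, ‖J i x‖ ^ 2 ≤ 1 := by
    have h3 : inner ℝ (x + ∑ i, J i (J i x)) (x + ∑ i, J i (J i x)) = 1 - ∑ i, ‖J i x‖ ^ 2 := by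
      nth_rewrite 2 [add_comm]
      rw [inner_add_right, inner_sum]
      have h4 : ∀ i, inner ℝ (x + ∑ i, J i (J i x)) (J i (J i x)) = 0 := fun i => by
        rw [real_inner_comm, hJ.skew, mem_residual.1 (hJ.add_sum_mem_residual x), inner_zero_right,
          neg_zero]
      simp only [h4, Finset.sum_const_zero, zero_add]
      rw [inner_add_left, sum_inner, real_inner_self_eq_norm_sq, hx]
      have h5 : ∀ i, inner ℝ (J i (J i x)) x = -‖J i x‖ ^ 2 := fun i => by
        rw [hJ.skew, real_inner_self_eq_norm_sq]
      simp only [h5, Finset.sum_neg_distrib]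
      ring
    have := real_inner_self_nonneg (x := x + ∑ i, J i (J i x))
    linarith
  have h6 : ‖blockField J lam x‖ ^ 2 < 1 := by
    rw [h1]
    by_cases h0 : ∀ i, J i x = 0
    · simp [h0]
    · push Not at h0
      obtain ⟨i, hi⟩ := h0
      refine lt_of_lt_of_le (Finset.sum_lt_sum (fun j _ => ?_) ⟨i, Finset.mem_univ i, ?_⟩) h2
      · have := hlam j
        exact mul_le_of_le_one_left (sq_nonneg _) (by nlinarith)
      · have := hlam i
        exact mul_lt_of_lt_one_left (pow_pos (norm_pos_iff.2 hi) 2) (by nlinarith)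
  nlinarith [norm_nonneg (blockField J lam x)]

end IsBlockFamily

end Algebra

end Finsler

/-! ### Frequencies of closed moving great circles -/

namespace Finsler

open Set Filter Topology MeasureTheory

variable {V : Type*} [NormedAddCommGroup V] [InnerProductSpace ℝ V] {ι : Type*}

/-- The arithmetic and dimension conditions on a block family `J` with speeds `lam` under which
the closed curves `exp(t A) (cos t p + sin t q)`, `A = ∑ λᵢ Jᵢ`, lie in single blocks. -/
structure IsGenericFamily (J : ι → V →L[ℝ] V) (lam : ι → ℝ) : Prop extends IsBlockFamily J where
  nonneg_lt_one : ∀ i, 0 ≤ lam i ∧ lam i < 1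
  nontrivial : ∀ i, ∃ x ∈ block J i, ‖x‖ = 1
  irrational_or_line : ∀ i, Irrational (lam i) ∨ ∀ x ∈ block J i, ∀ y ∈ block J i,
    inner ℝ x y = 0 → inner ℝ (J i x) y = 0 → x = 0 ∨ y = 0
  indep : ∀ i j, i ≠ j → ∀ ε ε' : ℝ, (ε = 1 ∨ ε = -1) → (ε' = 1 ∨ ε' = -1) → ∀ m m' : ℤ,
    m * (lam i + ε) = m' * (lam j + ε') → m = 0
  irrational_of_residual : ∀ x ∈ residual J, x ≠ 0 → ∀ i, Irrational (lam i)
  exists_orthogonal : ∀ x ∈ residual J, ∀ y ∈ residual J, ‖x‖ = 1 → ‖y‖ = 1 → inner ℝ x y = 0 →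
    ∃ z ∈ residual J, ‖z‖ = 1 ∧ inner ℝ x z = 0 ∧ inner ℝ y z = 0

theorem IsGenericFamily.lam_add_ne_zero {J : ι → V →L[ℝ] V} {lam : ι → ℝ}
    (hG : IsGenericFamily J lam) (i : ι) {ε : ℝ}
    (hε : ε = 1 ∨ ε = -1) : lam i + ε ≠ 0 := by
  have := hG.nonneg_lt_one i
  rcases hε with rfl | rfl <;> intro h <;> linarith

section Periodicity

variable {J : ι → V →L[ℝ] V}

theorem hasDerivAt_blockRot (i : ι) (μ : ℝ) (a : V) (t : ℝ) :
    HasDerivAt (fun t => blockRot J i (μ * t) a)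
      (μ • (Real.cos (μ * t) • J i a - Real.sin (μ * t) • a)) t := by
  have := hasDerivAt_cos_add_sin a (J i a) μ t
  exact this

theorem HasDerivAt.eq_of_periodic {f : ℝ → V} {f₀ f₁ : V} (hf : ∀ t, f (t + 1) = f t)
    (h0 : HasDerivAt f f₀ 0) (h1 : HasDerivAt f f₁ 1) : f₁ = f₀ := by
  have h2 : HasDerivAt (fun t => f (t + 1)) f₁ 0 := by
    have h1' : HasDerivAt f f₁ (0 + 1) := by rwa [zero_add]
    exact h1'.comp_add_const 0 1
  simp only [hf] at h2
  exact h2.unique h0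

/-- The frequencies occurring in a `1`-periodic superposition of two block rotations. -/
theorem IsBlockFamily.cos_eq_one_of_periodic (hJ : IsBlockFamily J) {i : ι} {a b : V}
    (ha : a ∈ block J i) (hb : b ∈ block J i) {μ ν : ℝ} (hμν : μ ≠ ν)
    (hper : ∀ t : ℝ, blockRot J i (μ * (t + 1)) a + blockRot J i (ν * (t + 1)) b =
      blockRot J i (μ * t) a + blockRot J i (ν * t) b) :
    (a ≠ 0 → Real.cos μ = 1) ∧ (b ≠ 0 → Real.cos ν = 1) := by
  have h0 := hper 0
  have hd := HasDerivAt.eq_of_periodic hper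
    ((hasDerivAt_blockRot i μ a 0).add (hasDerivAt_blockRot i ν b 0))
    ((hasDerivAt_blockRot i μ a 1).add (hasDerivAt_blockRot i ν b 1))
  simp only [zero_add, mul_one, mul_zero, Real.cos_zero, Real.sin_zero, one_smul, zero_smul,
    sub_zero] at h0 hd
  have hr0 : ∀ x, blockRot J i 0 x = x := fun x => by simp [blockRot]
  rw [hr0, hr0] at h0
  -- Periodicity of the values and of the derivatives at 0 gives a₁ + b₁ = 0 and μ J a₁ + ν J b₁ = 0
  -- for the increments over one period. As μ ≠ ν, both increments vanish.
  set a₁ := blockRot J i μ a - a with ha₁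
  set b₁ := blockRot J i ν b - b with hb₁
  have hb1 : b₁ = -a₁ := by
    rw [eq_neg_iff_add_eq_zero, hb₁, ha₁]
    rw [← sub_eq_zero] at h0
    rw [← h0]; abel
  have hJa : J i a₁ = Real.cos μ • J i a - Real.sin μ • a - J i a := by
    rw [ha₁, blockRot]
    simp only [map_sub, map_add, map_smul, mem_block.1 ha]; module
  have hJb : J i b₁ = Real.cos ν • J i b - Real.sin ν • b - J i b := by
    rw [hb₁, blockRot]
    simp only [map_sub, map_add, map_smul, mem_block.1 hb]; module
  have h1 : μ • J i a₁ + ν • J i b₁ = 0 := by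
    rw [hJa, hJb]
    rw [← sub_eq_zero] at hd
    rw [← hd]; module
  rw [hb1, map_neg] at h1
  have h2 : (μ - ν) • J i a₁ = 0 := by rw [← h1]; module
  have h3 : J i a₁ = 0 := (smul_eq_zero.1 h2).resolve_left (sub_ne_zero.2 hμν)
  have ha1m : a₁ ∈ block J i := (block J i).sub_mem (IsBlockFamily.blockRot_mem ha μ) ha
  have h4 : a₁ = 0 := by
    have := mem_block.1 ha1m
    rw [h3, map_zero] at this
    exact neg_eq_zero.1 this.symm
  exact ⟨fun h => hJ.cos_eq_one_of_blockRot_eq h (sub_eq_zero.1 h4),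
    fun h => hJ.cos_eq_one_of_blockRot_eq h (sub_eq_zero.1 (by rw [← hb₁, hb1, h4, neg_zero]))⟩

/-- Values and derivatives at 0 show that rotation by l fixes the pair (p, q). Rotation minus
identity has determinant 2 − 2 cos l, which must vanish on a nonzero pair. -/
theorem cos_eq_one_of_periodic {p q : V} {l : ℝ} (hl : l ≠ 0)
    (hper : ∀ t : ℝ, Real.cos (l * (t + 1)) • p + Real.sin (l * (t + 1)) • q =
      Real.cos (l * t) • p + Real.sin (l * t) • q) (hpq : p ≠ 0 ∨ q ≠ 0) : Real.cos l = 1 := by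
  have h0 := hper 0
  have hd := HasDerivAt.eq_of_periodic hper (hasDerivAt_cos_add_sin p q l 0)
    (hasDerivAt_cos_add_sin p q l 1)
  simp only [zero_add, mul_one, mul_zero, Real.cos_zero, Real.sin_zero, one_smul, zero_smul,
    sub_zero, add_zero] at h0 hd
  have hd' := smul_right_injective V hl hd
  have e1 : (Real.cos l - 1) • p + Real.sin l • q = 0 := by
    rw [← sub_eq_zero] at h0; rw [← h0]; module
  have e2 : (Real.cos l - 1) • q - Real.sin l • p = 0 := by
    rw [← sub_eq_zero] at hd'; rw [← hd']; module
  have key : ∀ x : V, (2 - 2 * Real.cos l) • x = (Real.cos l - 1) • (Real.cos l - 1) • x +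
      Real.sin l • Real.sin l • x := fun x => by
    match_scalars
    linear_combination (-1 : ℝ) * Real.sin_sq_add_cos_sq l
  have hz : ∀ x : V, x ≠ 0 → (2 - 2 * Real.cos l) • x = 0 → Real.cos l = 1 := fun x hx h => by
    have := (smul_eq_zero.1 h).resolve_right hx
    linarith
  rcases hpq with h | h
  · refine hz p h ?_
    rw [key]
    have : (Real.cos l - 1) • (Real.cos l - 1) • p + Real.sin l • Real.sin l • p =
      (Real.cos l - 1) • ((Real.cos l - 1) • p + Real.sin l • q) -
        Real.sin l • ((Real.cos l - 1) • q - Real.sin l • p) := by module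
    rw [this, e1, e2]; simp
  · refine hz q h ?_
    rw [key]
    have : (Real.cos l - 1) • (Real.cos l - 1) • q + Real.sin l • Real.sin l • q =
      (Real.cos l - 1) • ((Real.cos l - 1) • q - Real.sin l • p) +
        Real.sin l • ((Real.cos l - 1) • p + Real.sin l • q) := by module
    rw [this, e1, e2]; simp

end Periodicity

variable [Fintype ι] {J : ι → V →L[ℝ] V} {lam : ι → ℝ}

/-- The component in a block of a moving great circle is a superposition of two rotations. -/
theorem IsBlockFamily.apply_moving_greatCircle (hJ : IsBlockFamily J) (i : ι) (p q : V) (l t : ℝ) :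
    J i (blockFlow J lam (l * t) (Real.cos (l * t) • p + Real.sin (l * t) • q)) =
      blockRot J i ((lam i + 1) * l * t) ((1 / 2 : ℝ) • (J i p - J i (J i q))) +
      blockRot J i ((lam i - 1) * l * t) ((1 / 2 : ℝ) • (J i p + J i (J i q))) := by
  rw [hJ.apply_comm_blockFlow, hJ.blockFlow_of_mem_block lam (hJ.apply_mem_block i _)]
  rw [show (lam i + 1) * l * t = lam i * (l * t) + l * t by ring,
    show (lam i - 1) * l * t = lam i * (l * t) - l * t by ring]
  simp only [blockRot, map_add, map_smul, map_sub, hJ.cube, Real.cos_add, Real.sin_add,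
    Real.cos_sub, Real.sin_sub]
  module

/-- Closed moving great circles lie in one block or in the common kernel. -/
theorem IsGenericFamily.closed_moving_greatCircle (hG : IsGenericFamily J lam) {p q : V}
    (hp : ‖p‖ = 1) (hq : ‖q‖ = 1) (hpq : inner ℝ p q = 0) {l : ℝ} (hl : 0 < l)
    (hper : ∀ t : ℝ,
      blockFlow J lam (l * (t + 1)) (Real.cos (l * (t + 1)) • p + Real.sin (l * (t + 1)) • q) =
      blockFlow J lam (l * t) (Real.cos (l * t) • p + Real.sin (l * t) • q)) :
    (∃ i, ∃ ε : ℝ, (ε = 1 ∨ ε = -1) ∧ p ∈ block J i ∧ q = ε • J i p ∧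
      Real.cos ((lam i + ε) * l) = 1) ∨ (p ∈ residual J ∧ q ∈ residual J ∧ Real.cos l = 1) := by
  have hJ := hG.toIsBlockFamily
  -- a i and b i are the amplitudes, inside the block i, of the frequencies (λᵢ + 1) l and (λᵢ − 1)
  -- l.
  set a : ι → V := fun i => (1 / 2 : ℝ) • (J i p - J i (J i q)) with ha
  set b : ι → V := fun i => (1 / 2 : ℝ) • (J i p + J i (J i q)) with hb
  have ham : ∀ i, a i ∈ block J i := fun i => (block J i).smul_mem _
    ((block J i).sub_mem (hJ.apply_mem_block i _) (hJ.apply_mem_block i _))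
  have hbm : ∀ i, b i ∈ block J i := fun i => (block J i).smul_mem _
    ((block J i).add_mem (hJ.apply_mem_block i _) (hJ.apply_mem_block i _))
  have hcos : ∀ i, (a i ≠ 0 → Real.cos ((lam i + 1) * l) = 1) ∧
      (b i ≠ 0 → Real.cos ((lam i - 1) * l) = 1) := fun i => by
    refine hJ.cos_eq_one_of_periodic (ham i) (hbm i) (by intro h; nlinarith) fun t => ?_
    rw [← hJ.apply_moving_greatCircle, ← hJ.apply_moving_greatCircle, hper]
  have hab : ∀ i, J i p = a i + b i := fun i => by simp only [ha, hb]; module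
  have hba : ∀ i, J i (J i q) = b i - a i := fun i => by simp only [ha, hb]; module
  have hfreq : ∀ i, a i ≠ 0 ∨ b i ≠ 0 → ∃ ε : ℝ, (ε = 1 ∨ ε = -1) ∧ ∃ m : ℤ,
      (m : ℝ) * (2 * Real.pi) = (lam i + ε) * l := fun i h => by
    rcases h with h | h
    · exact ⟨1, .inl rfl, (Real.cos_eq_one_iff _).1 ((hcos i).1 h)⟩
    · refine ⟨-1, .inr rfl, (Real.cos_eq_one_iff _).1 ?_⟩
      rw [← sub_eq_add_neg]; exact (hcos i).2 h
  have hzero : ∀ i, a i = 0 → b i = 0 → J i p = 0 ∧ J i q = 0 := fun i h1 h2 => by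
    refine ⟨by rw [hab, h1, h2, add_zero], ?_⟩
    have h3 := hba i
    rw [h1, h2, sub_zero] at h3
    have h4 := hJ.cube i q
    rw [h3, map_zero] at h4
    exact neg_eq_zero.1 h4.symm
  have hpi := Real.pi_pos
  set p₀ := p + ∑ i, J i (J i p) with hp₀
  set q₀ := q + ∑ i, J i (J i q) with hq₀
  -- A nonzero component in the common kernel gives l = 2πm. A frequency of the block i occurring as
  -- well would make λᵢ = m'/m − ε rational, so all block components vanish.
  by_cases hres : p₀ ≠ 0 ∨ q₀ ≠ 0
  · right
    have hl1 : Real.cos l = 1 := by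
      refine cos_eq_one_of_periodic hl.ne' (fun t => ?_) hres
      have hproj : ∀ t : ℝ, Real.cos (l * t) • p₀ + Real.sin (l * t) • q₀ =
          blockFlow J lam (l * t) (Real.cos (l * t) • p + Real.sin (l * t) • q) +
            ∑ i, J i (J i (blockFlow J lam (l * t)
              (Real.cos (l * t) • p + Real.sin (l * t) • q))) := fun t => by
        simp only [hJ.apply_comm_blockFlow]
        rw [← map_sum, ← map_add,
          IsBlockFamily.blockFlow_of_mem_residual lam (hJ.add_sum_mem_residual _), hp₀, hq₀]
        simp only [map_add, map_smul, Finset.sum_add_distrib, ← Finset.smul_sum]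
        module
      rw [hproj, hproj, hper]
    obtain ⟨m, hm⟩ := (Real.cos_eq_one_iff _).1 hl1
    have hm0 : (m : ℝ) ≠ 0 := by rintro h; rw [h, zero_mul] at hm; exact hl.ne hm
    have hirr : ∀ i, Irrational (lam i) := by
      rcases hres with h | h
      · exact hG.irrational_of_residual _ (hJ.add_sum_mem_residual p) h
      · exact hG.irrational_of_residual _ (hJ.add_sum_mem_residual q) h
    have hnone : ∀ i, ¬ (a i ≠ 0 ∨ b i ≠ 0) := fun i h => by
      obtain ⟨ε, hε, m', hm'⟩ := hfreq i h
      rw [← hm] at hm'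
      have h1 : (m' : ℝ) = (lam i + ε) * m := by
        refine mul_right_cancel₀ (b := 2 * Real.pi) (by positivity) ?_
        rw [hm']; ring
      have h2 : lam i = (m' : ℝ) / m - ε := by rw [h1]; field_simp; ring
      refine hirr i ⟨(m' : ℚ) / m - (if ε = 1 then 1 else -1), ?_⟩
      rw [h2]
      rcases hε with rfl | rfl
      · simp
      · norm_num
    have h0 : ∀ i, J i p = 0 ∧ J i q = 0 := fun i => by
      have := hnone i
      push Not at this
      exact hzero i this.1 this.2
    exact ⟨mem_residual.2 fun i => (h0 i).1, mem_residual.2 fun i => (h0 i).2, hl1⟩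
  · left
    push Not at hres
    have hex : ∃ i, a i ≠ 0 ∨ b i ≠ 0 := by
      by_contra! h
      have h1 : p₀ = p := by
        rw [hp₀]; simp [fun i => (hzero i (h i).1 (h i).2).1]
      rw [h1] at hres
      simp [hres.1] at hp
    obtain ⟨i, hi⟩ := hex
    -- Frequencies from two different blocks, both in 2πℤ, would be commensurable, against `indep`.
    have hother : ∀ j, j ≠ i → J j p = 0 ∧ J j q = 0 := fun j hj => by
      suffices h : ¬ (a j ≠ 0 ∨ b j ≠ 0) by
        push Not at h
        exact hzero j h.1 h.2
      intro h
      obtain ⟨ε, hε, m, hm⟩ := hfreq i hi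
      obtain ⟨ε', hε', m', hm'⟩ := hfreq j h
      have h1 : (m' : ℝ) * (lam i + ε) = m * (lam j + ε') := by
        refine mul_right_cancel₀ (b := 2 * Real.pi * l) (by positivity) ?_
        linear_combination (m' : ℝ) * (2 * Real.pi) * (-hm) + (m : ℝ) * (2 * Real.pi) * hm'
      have h2 := hG.indep i j hj.symm ε ε' hε hε' m' m h1
      rw [h2, Int.cast_zero, zero_mul] at hm'
      exact mul_ne_zero (hG.lam_add_ne_zero j hε') hl.ne' hm'.symm
    have hsum : ∀ x, (∀ j, j ≠ i → J j x = 0) → ∑ j, J j (J j x) = J i (J i x) := fun x hx =>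
      Finset.sum_eq_single i (fun j _ hj => by rw [hx j hj, map_zero]) (by simp)
    have hpm : p ∈ block J i := by
      rw [mem_block, eq_neg_iff_add_eq_zero, add_comm, ← hsum p fun j hj => (hother j hj).1]
      exact hres.1
    have hqm : q ∈ block J i := by
      rw [mem_block, eq_neg_iff_add_eq_zero, add_comm, ← hsum q fun j hj => (hother j hj).2]
      exact hres.2
    have hJJq := mem_block.1 hqm
    have hJJp := mem_block.1 hpm
    have haz : a i = 0 → q = -J i p := fun h => by
      have h1 := hba i
      rw [hJJq, hab i, h, sub_zero] at *
      rw [zero_add, ← h1, neg_neg]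
    have hbz : b i = 0 → q = J i p := fun h => by
      have h1 := hba i
      rw [hJJq, hab i, h, zero_sub] at *
      rw [add_zero]; exact neg_inj.1 h1
    by_cases ha0 : a i = 0
    · have hb0 : b i ≠ 0 := by
        rcases hi with h | h
        · exact absurd ha0 h
        · exact h
      refine ⟨i, -1, .inr rfl, hpm, by rw [haz ha0, neg_one_smul], ?_⟩
      rw [← sub_eq_add_neg]
      exact (hcos i).2 hb0
    · by_cases hb0 : b i = 0
      · exact ⟨i, 1, .inl rfl, hpm, by rw [hbz hb0, one_smul], (hcos i).1 ha0⟩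
      · exfalso
        -- Both frequencies of one block occur. Then (λᵢ + 1)/(λᵢ − 1) is rational, hence so is λᵢ;
        -- and if the block is a single complex line, q = ±Jᵢ p, so that one amplitude was zero
        -- after all.
        rcases hG.irrational_or_line i with hirr | hline
        · obtain ⟨m, hm⟩ := (Real.cos_eq_one_iff _).1 ((hcos i).1 ha0)
          obtain ⟨m', hm'⟩ := (Real.cos_eq_one_iff _).1 ((hcos i).2 hb0)
          have h1 : (m : ℝ) * (lam i - 1) = m' * (lam i + 1) := by
            refine mul_right_cancel₀ (b := 2 * Real.pi * l) (by positivity) ?_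
            linear_combination (lam i - 1) * l * hm - (lam i + 1) * l * hm'
          have hmm : (m : ℝ) - m' ≠ 0 := by
            intro h
            have h2 : (m : ℝ) = m' := sub_eq_zero.1 h
            rw [← h2] at h1
            have h3 : (m : ℝ) = 0 := by linarith
            rw [h3, zero_mul] at hm
            have := hG.lam_add_ne_zero i (ε := 1) (.inl rfl)
            exact mul_ne_zero this hl.ne' hm.symm
          refine hirr ⟨((m : ℚ) + m') / (m - m'), ?_⟩
          push_cast
          rw [div_eq_iff hmm]
          linarith
        · set s := inner ℝ (J i p) q with hs
          have hJp1 : ‖J i p‖ = 1 := by rw [hJ.norm_apply_of_mem hpm, hp]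
          have hy := hline p hpm (q - s • J i p)
            ((block J i).sub_mem hqm ((block J i).smul_mem _ (hJ.apply_mem_block i p)))
            (by rw [inner_sub_right, hpq, inner_smul_right, hJ.inner_self]; simp)
            (by rw [inner_sub_right, inner_smul_right, real_inner_self_eq_norm_sq, hJp1, ← hs]
                ring)
          have hqs : q = s • J i p := by
            rcases hy with h | h
            · rw [h, norm_zero] at hp; exact absurd hp (by norm_num)
            · exact sub_eq_zero.1 h
          have hs1 : |s| = 1 := by
            have := congrArg norm hqs
            rw [norm_smul, hJp1, hq, mul_one] at this
            exact this.symm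
          rcases eq_or_eq_neg_of_abs_eq hs1 with h | h
          · apply hb0
            simp only [hb]
            rw [hJJq, hqs, h]; simp
          · apply ha0
            simp only [ha]
            rw [hJJq, hqs, h]; simp

/-- The moving great circles in a block are block rotations. -/
theorem IsBlockFamily.moving_greatCircle_of_block (hJ : IsBlockFamily J) {i : ι} {p : V}
    (hp : p ∈ block J i) {ε : ℝ} (hε : ε = 1 ∨ ε = -1) (θ : ℝ) :
    blockFlow J lam θ (Real.cos θ • p + Real.sin θ • (ε • J i p)) =
      blockRot J i ((lam i + ε) * θ) p := by
  have h1 : Real.cos θ • p + Real.sin θ • (ε • J i p) = blockRot J i (ε * θ) p := by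
    rcases hε with rfl | rfl <;> simp [blockRot]
  rw [h1, hJ.blockFlow_of_mem_block lam (IsBlockFamily.blockRot_mem hp _),
    ← IsBlockFamily.blockRot_add hp]
  ring_nf

end Finsler

/-! ### Commuting plane rotations and the list of closed geodesics -/

namespace Finsler

open Set Filter Topology MeasureTheory

section PlaneRotations

variable {V : Type*} [NormedAddCommGroup V] [InnerProductSpace ℝ V]

/-- The infinitesimal rotation in the plane spanned by the orthonormal pair `u, v`. -/
noncomputable def planeField (u v : V) : V →L[ℝ] V :=
  (innerSL ℝ u).smulRight v - (innerSL ℝ v).smulRight u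

theorem planeField_apply (u v x : V) :
    planeField u v x = inner ℝ u x • v - inner ℝ v x • u := by
  simp [planeField]

/-- The rotations in the plane spanned by the orthonormal pair `u, v`. -/
noncomputable def planeFlow (u v : V) (t : ℝ) : V →L[ℝ] V :=
  blockFlow (fun _ : Unit => planeField u v) (fun _ => 1) t

theorem planeFlow_apply (u v x : V) (t : ℝ) : planeFlow u v t x =
    x + Real.sin t • planeField u v x +
      (1 - Real.cos t) • planeField u v (planeField u v x) := by
  simp [planeFlow, blockFlow, add_assoc]

theorem isIsometryFlow_planeFlow {u v : V} (hu : ‖u‖ = 1) (hv : ‖v‖ = 1)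
    (huv : inner ℝ u v = 0) : IsIsometryFlow (planeField u v) (planeFlow u v) := by
  have hJ : IsBlockFamily fun _ : Unit => planeField u v := by
    refine ⟨fun _ x y => ?_, fun _ x => ?_, fun i j h => (h (Subsingleton.elim _ _)).elim⟩
    · simp only [planeField_apply, inner_sub_left, inner_sub_right, inner_smul_left,
        inner_smul_right, RCLike.conj_to_real, real_inner_comm x u, real_inner_comm x v]
      ring
    · simp only [planeField_apply, inner_sub_right, inner_smul_right,
        real_inner_self_eq_norm_sq, hu, hv, huv, real_inner_comm u v]
      module
  have h := hJ.isIsometryFlow fun _ => 1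
  rwa [show blockField (fun _ : Unit => planeField u v) (fun _ => 1) = planeField u v by
    simp [blockField]] at h

theorem planeFlow_apply_of_inner_eq_zero {u v x : V} (hu : inner ℝ u x = 0)
    (hv : inner ℝ v x = 0) (t : ℝ) : planeFlow u v t x = x := by
  simp [planeFlow_apply, planeField_apply, hu, hv]

theorem planeFlow_comm {u v : V} {T : V →L[ℝ] V}
    (h : ∀ x, T (planeField u v x) = planeField u v (T x)) (t : ℝ) (x : V) :
    T (planeFlow u v t x) = planeFlow u v t (T x) := by
  simp only [planeFlow_apply, map_add, map_smul, h]

theorem exists_cos_sin_eq {c s : ℝ} (h : c ^ 2 + s ^ 2 = 1) :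
    ∃ θ : ℝ, Real.cos θ = c ∧ Real.sin θ = s := by
  have hc : |c| ≤ 1 := abs_le_one_iff_mul_self_le_one.2 (by nlinarith [sq_nonneg s])
  have hcos := Real.cos_arccos (neg_le_of_abs_le hc) (le_of_abs_le hc)
  have hsin : Real.sin (Real.arccos c) = |s| := by
    rw [Real.sin_arccos, show 1 - c ^ 2 = s ^ 2 by linarith, Real.sqrt_sq_eq_abs]
  rcases le_total 0 s with h0 | h0
  · exact ⟨Real.arccos c, hcos, by rw [hsin, abs_of_nonneg h0]⟩
  · exact ⟨-Real.arccos c, by rw [Real.cos_neg, hcos],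
      by rw [Real.sin_neg, hsin, abs_of_nonpos h0, neg_neg]⟩

variable {ι : Type*} {J : ι → V →L[ℝ] V}

/-- The unit vectors of a block are related by plane rotations commuting with the family. -/
theorem IsBlockFamily.exists_flow_block (hJ : IsBlockFamily J) {i : ι} {a a' : V}
    (ha : a ∈ block J i) (ha' : a' ∈ block J i) (h1 : ‖a‖ = 1) (h1' : ‖a'‖ = 1) :
    ∃ K S, IsIsometryFlow K S ∧ (∀ j t x, J j (S t x) = S t (J j x)) ∧ ∃ θ, S θ a = a' := by
  by_cases haa : a = a'
  · exact ⟨0, fun _ => 1, isIsometryFlow_zero, fun _ _ _ => rfl, 0, haa⟩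
  have hδ0 : ‖a - a'‖ ≠ 0 := norm_ne_zero_iff.2 (sub_ne_zero.2 haa)
  -- The rotation takes place in the complex line of a − a'. This plane is stable under the family,
  -- which makes the rotation commute with every Jⱼ.
  set r := ‖a - a'‖ with hr
  set u := r⁻¹ • (a - a') with hu
  have hum : u ∈ block J i := (block J i).smul_mem _ ((block J i).sub_mem ha ha')
  have hu1 : ‖u‖ = 1 := by
    rw [hu, norm_smul, norm_inv, hr, norm_norm, inv_mul_cancel₀ hδ0]
  have hJu1 : ‖J i u‖ = 1 := by rw [hJ.norm_apply_of_mem hum, hu1]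
  have huJ : inner ℝ u (J i u) = 0 := hJ.inner_self i u
  have hcomm : ∀ j x, J j (planeField u (J i u) x) = planeField u (J i u) (J j x) := by
    intro j x
    by_cases hj : j = i
    · subst hj
      simp only [planeField_apply, map_sub, map_smul, mem_block.1 hum,
        hJ.inner_map_map_of_mem x hum, hJ.skew j u x]
      module
    · have e1 := hJ.apply_eq_zero hj hum
      have e2 := hJ.apply_eq_zero hj (hJ.apply_mem_block i u)
      have e3 : ∀ y, inner ℝ y (J j x) = -inner ℝ (J j y) x := fun y => by
        rw [hJ.skew, neg_neg]
      simp [planeField_apply, e1, e2, e3]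
  refine ⟨_, _, isIsometryFlow_planeFlow hu1 hJu1 huJ, fun j t x => planeFlow_comm (hcomm j) t x, ?_⟩
  set α := inner ℝ u a with hα
  set β := inner ℝ (J i u) a with hβ
  have hα2 : r = 2 * α := by
    have e1 : r ^ 2 = 2 - 2 * inner ℝ a a' := by
      rw [hr, norm_sub_sq_real, h1, h1']; ring
    have e2 : α = r⁻¹ * (1 - inner ℝ a a') := by
      rw [hα, hu, inner_smul_left, inner_sub_left, real_inner_self_eq_norm_sq, h1,
        real_inner_comm a a']
      simp
    rw [e2]
    field_simp
    linarith
  have hα0 : α ≠ 0 := by intro h; rw [h] at hα2; exact hδ0 (by linarith)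
  have hρ : α ^ 2 + β ^ 2 ≠ 0 := by positivity
  -- a' is the reflection of a in the hyperplane orthogonal to u. In the basis u, Jᵢ u the rotation
  -- has to take (α, β) to (−α, β), which determines the angle.
  obtain ⟨θ, hc, hs⟩ := exists_cos_sin_eq (c := (β ^ 2 - α ^ 2) / (α ^ 2 + β ^ 2))
    (s := 2 * α * β / (α ^ 2 + β ^ 2)) (by field_simp; ring)
  refine ⟨θ, ?_⟩
  have e : a' = a - (2 * α) • u := by rw [hu, ← hα2, smul_inv_smul₀ hδ0]; abel
  rw [e]
  simp only [planeFlow_apply, planeField_apply, inner_sub_right, inner_smul_right,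
    real_inner_self_eq_norm_sq, hu1, hJu1, huJ, real_inner_comm u (J i u), ← hα, ← hβ, hc, hs]
  match_scalars <;> field_simp <;> ring

/-- The unit vectors of a subspace of the common kernel, of dimension at least two, are related by
plane rotations commuting with the family and fixing the orthogonal vectors. -/
theorem IsBlockFamily.exists_flow_residual (hJ : IsBlockFamily J) {U : Submodule ℝ V}
    (hU : ∀ x ∈ U, x ∈ residual J) {x y w₀ : V} (hx : x ∈ U) (hy : y ∈ U) (hw₀ : w₀ ∈ U)
    (hx1 : ‖x‖ = 1) (hy1 : ‖y‖ = 1) (hw1 : ‖w₀‖ = 1) (hxw : inner ℝ x w₀ = 0) :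
    ∃ K S, IsIsometryFlow K S ∧ (∀ j t z, J j (S t z) = S t (J j z)) ∧ (∃ θ, S θ x = y) ∧
      ∀ z, (∀ v ∈ U, inner ℝ v z = 0) → ∀ t, S t z = z := by
  obtain ⟨w, hw, hw1, hxw, θ, hθ⟩ := exists_cos_add_sin hx hy hw₀ hx1 hy1 hw1 hxw
  refine ⟨_, _, isIsometryFlow_planeFlow hx1 hw1 hxw, fun j t z => planeFlow_comm (fun z => ?_) t z,
    ⟨θ, ?_⟩, fun z hz t => planeFlow_apply_of_inner_eq_zero (hz _ hx) (hz _ hw) t⟩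
  · have e3 : ∀ y, inner ℝ y (J j z) = -inner ℝ (J j y) z := fun y => by rw [hJ.skew, neg_neg]
    simp [planeField_apply, e3, mem_residual.1 (hU x hx) j, mem_residual.1 (hU w hw) j]
  · rw [hθ]
    simp only [planeFlow_apply, planeField_apply, inner_sub_right, inner_smul_right,
      real_inner_self_eq_norm_sq, hx1, hw1, hxw, real_inner_comm x w]
    module

end PlaneRotations

variable {V : Type*} [NormedAddCommGroup V] [InnerProductSpace ℝ V] {n : ℕ}
  [Fact (Module.finrank ℝ V = n + 1)] {ι : Type*} [Fintype ι] {J : ι → V →L[ℝ] V} {lam : ι → ℝ}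
  {F : ∀ x : Metric.sphere (0 : V) 1, TangentSpace (𝓡 n) x → ℝ}

section ClosedGeodesics

/-- `γ` is a circle in the block `i`, traversed `r` times. -/
def IsBlockCircle (J : ι → V →L[ℝ] V) (i : ι) (r : ℝ)
    (γ : UnitAddCircle → Metric.sphere (0 : V) 1) : Prop :=
  ∃ p ∈ block J i, ‖p‖ = 1 ∧ ∀ t : ℝ, (γ t : V) = blockRot J i (2 * Real.pi * r * t) p

/-- `γ` is a great circle in the common kernel, traversed `r` times. -/
def IsResidualCircle (J : ι → V →L[ℝ] V) (r : ℝ)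
    (γ : UnitAddCircle → Metric.sphere (0 : V) 1) : Prop :=
  ∃ p ∈ residual J, ∃ q ∈ residual J, ‖p‖ = 1 ∧ ‖q‖ = 1 ∧ inner ℝ p q = 0 ∧ ∀ t : ℝ,
    (γ t : V) = Real.cos (2 * Real.pi * r * t) • p + Real.sin (2 * Real.pi * r * t) • q

/-- The relation between m and the speed l is retained: it is what allows the block to be recovered
from l. -/
theorem IsClosedGeodesic.isBlockCircle_or (hG : IsGenericFamily J lam)
    (hF : ∀ x y, F x y = randersNorm (blockField J lam) x (sphereIncl x y))
    {γ : UnitAddCircle → Metric.sphere (0 : V) 1} (hγ : IsClosedGeodesic F γ) :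
    ∃ l : ℝ, 0 < l ∧ (∀ t : ℝ, F (γ t) (velocity (E := EuclideanSpace ℝ (Fin n))
        (fun t : ℝ => γ t) t) = l) ∧ ∃ m : ℤ,
      (∃ i, ∃ ε : ℝ, (ε = 1 ∨ ε = -1) ∧ (m : ℝ) * (2 * Real.pi) = (lam i + ε) * l ∧
        IsBlockCircle J i m γ) ∨ ((m : ℝ) * (2 * Real.pi) = l ∧ IsResidualCircle J m γ) := by
  have hJ := hG.toIsBlockFamily
  obtain ⟨l, hl, hs, p, -, q, -, hp, hq, hpq, hc⟩ := IsGeodesicIn.exists_greatCircle hF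
    (hJ.isIsometryFlow lam) (hJ.norm_blockField_lt_one hG.nonneg_lt_one) (U := ⊤)
    (fun _ _ _ => trivial) (by simp) hγ
  refine ⟨l, hl, hs, ?_⟩
  have hper := hG.closed_moving_greatCircle hp hq hpq hl fun t => by
    rw [← hc, ← hc, AddCircle.coe_add_period]
  rcases hper with ⟨i, ε, hε, hpm, rfl, hcos⟩ | ⟨hpm, hqm, hcos⟩
  · obtain ⟨m, hm⟩ := (Real.cos_eq_one_iff _).1 hcos
    refine ⟨m, .inl ⟨i, ε, hε, hm, p, hpm, hp, fun t => ?_⟩⟩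
    rw [hc, hJ.moving_greatCircle_of_block hpm hε, ← mul_assoc, ← hm]
    ring_nf
  · obtain ⟨m, hm⟩ := (Real.cos_eq_one_iff _).1 hcos
    refine ⟨m, .inr ⟨hm, p, hpm, q, hqm, hp, hq, hpq, fun t => ?_⟩⟩
    rw [hc, IsBlockFamily.blockFlow_of_mem_residual lam ((residual J).add_mem
      ((residual J).smul_mem _ hpm) ((residual J).smul_mem _ hqm)), ← hm]
    ring_nf

/-- A circle of winding number m already closes up at time 1/|m|, so |m| = 1. As |λᵢ| < 1, the sign
of λᵢ + ε, hence of m, is that of ε; in the common kernel m is positive. -/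
theorem IsPrimeClosedGeodesic.isBlockCircle_or (hG : IsGenericFamily J lam)
    (hF : ∀ x y, F x y = randersNorm (blockField J lam) x (sphereIncl x y))
    {γ : UnitAddCircle → Metric.sphere (0 : V) 1} (hγ : IsPrimeClosedGeodesic F γ) :
    ∃ l : ℝ, 0 < l ∧ (∀ t : ℝ, F (γ t) (velocity (E := EuclideanSpace ℝ (Fin n))
        (fun t : ℝ => γ t) t) = l) ∧
      ((∃ i, ∃ ε : ℝ, (ε = 1 ∨ ε = -1) ∧ ε * (2 * Real.pi) = (lam i + ε) * l ∧
        IsBlockCircle J i ε γ) ∨ (2 * Real.pi = l ∧ IsResidualCircle J 1 γ)) := by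
  obtain ⟨l, hl, hs, m, hm⟩ := hγ.1.isBlockCircle_or hG hF
  refine ⟨l, hl, hs, ?_⟩
  have hpi := Real.pi_pos
  have hmin : ∀ t : ℝ, 0 < t → γ t = γ 0 → 1 ≤ t := fun t ht h => hγ.2.2 ⟨ht, h⟩
  have h00 : γ 0 = γ ((0 : ℝ) : UnitAddCircle) := by simp
  have habs : (m : ℝ) ≠ 0 → γ ((|(m : ℝ)|⁻¹ : ℝ) : UnitAddCircle) = γ 0 → |m| ≤ 1 := by
    intro h0 h
    have h1 := hmin _ (inv_pos.2 (abs_pos.2 h0)) h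
    have h2 : |(m : ℝ)| ≤ 1 := (one_le_inv₀ (abs_pos.2 h0)).1 h1
    exact_mod_cast h2
  have hunit : (m : ℝ) ≠ 0 → (m : ℝ) * |(m : ℝ)|⁻¹ = 1 ∨ (m : ℝ) * |(m : ℝ)|⁻¹ = -1 := by
    intro h0
    rcases lt_or_gt_of_ne h0 with h | h
    · right; rw [abs_of_neg h]; field_simp
    · left; rw [abs_of_pos h]; field_simp
  have htrig : (m : ℝ) ≠ 0 → Real.cos (2 * Real.pi * m * |(m : ℝ)|⁻¹) = 1 ∧
      Real.sin (2 * Real.pi * m * |(m : ℝ)|⁻¹) = 0 := by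
    intro h0
    rw [mul_assoc]
    rcases hunit h0 with h | h <;> rw [h] <;> simp
  rcases hm with ⟨i, ε, hε, hm, hcirc⟩ | ⟨hm, hcirc⟩
  · left
    have hm0 : (m : ℝ) ≠ 0 := by
      intro h
      rw [h, zero_mul] at hm
      exact mul_ne_zero (hG.lam_add_ne_zero i hε) hl.ne' hm.symm
    have hm1 : |m| ≤ 1 := by
      refine habs hm0 ?_
      obtain ⟨p, -, -, hp⟩ := hcirc
      refine Subtype.ext ?_
      rw [h00, hp, hp, blockRot, blockRot, (htrig hm0).1, (htrig hm0).2]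
      simp
    have hmε : (m : ℝ) = ε := by
      have hb := hG.nonneg_lt_one i
      obtain ⟨hm2, hm3⟩ := abs_le.1 hm1
      have hm0' : m ≠ 0 := by exact_mod_cast hm0
      have hmm : m = 1 ∨ m = -1 := by omega
      rcases hε with rfl | rfl
      · rcases hmm with h | h
        · rw [h]; simp
        · rw [h] at hm; push_cast at hm
          nlinarith [mul_pos (show 0 < lam i + 1 by linarith) hl]
      · rcases hmm with h | h
        · rw [h] at hm; push_cast at hm
          nlinarith [mul_pos (show 0 < 1 - lam i by linarith) hl]
        · rw [h]; simp
    exact ⟨i, ε, hε, hmε ▸ hm, hmε ▸ hcirc⟩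
  · right
    have hmpos : (0 : ℝ) < m := by
      by_contra! h
      nlinarith
    have hm1 : |m| ≤ 1 := by
      refine habs hmpos.ne' ?_
      obtain ⟨p, -, q, -, -, -, -, hp⟩ := hcirc
      refine Subtype.ext ?_
      rw [h00, hp, hp, (htrig hmpos.ne').1, (htrig hmpos.ne').2]
      simp
    have h1 : m = 1 := by
      have : (0 : ℤ) < m := by exact_mod_cast hmpos
      rw [abs_of_pos this] at hm1
      omega
    rw [h1, Int.cast_one] at hcirc hm
    exact ⟨by simpa using hm, hcirc⟩

/-- Every unit vector of a block lies on a prime closed geodesic in the block. -/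
theorem exists_prime_block (hG : IsGenericFamily J lam)
    (hF : ∀ x y, F x y = randersNorm (blockField J lam) x (sphereIncl x y)) {i : ι} {p : V}
    (hp : p ∈ block J i) (hp1 : ‖p‖ = 1) :
    ∃ γ, IsPrimeClosedGeodesic F γ ∧
      ∀ t : ℝ, (γ t : V) = blockRot J i (2 * Real.pi * 1 * t) p := by
  have hJ := hG.toIsBlockFamily
  have hpi := Real.pi_pos
  let f : ℝ → Metric.sphere (0 : V) 1 := fun t => ⟨blockRot J i (2 * Real.pi * 1 * t) p, by
    rw [mem_sphere_zero_iff_norm, hJ.norm_blockRot hp, hp1]⟩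
  have hf : Function.Periodic f 1 := fun t => Subtype.ext (by
    have : 2 * Real.pi * 1 * (t + 1) = 2 * Real.pi * 1 * t + 2 * Real.pi := by ring
    simp only [f, blockRot, this, Real.cos_add_two_pi, Real.sin_add_two_pi])
  have hlam : 0 < lam i + 1 := by linarith [(hG.nonneg_lt_one i).1]
  -- The direction ε = 1 is used, with l chosen so that (λᵢ + 1) l = 2π.
  set l := 2 * Real.pi / (lam i + 1) with hl
  have hlpos : 0 < l := by positivity
  refine ⟨hf.lift, ⟨?_, ⟨one_pos, ?_⟩, fun t ht => ?_⟩, fun t => by rw [hf.lift_coe]⟩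
  · refine (isGeodesicIn_of_greatCircle hF (hJ.isIsometryFlow lam)
      (hJ.norm_blockField_lt_one hG.nonneg_lt_one) hlpos hp1 (q := (1 : ℝ) • J i p)
      (by rw [one_smul, hJ.norm_apply_of_mem hp, hp1])
      (by rw [one_smul, hJ.inner_self]) fun t => ?_).1
    rw [hf.lift_coe, hJ.moving_greatCircle_of_block hp (.inl rfl)]
    simp only [f]
    congr 1
    rw [hl]; field_simp
  · rw [← QuotientAddGroup.mk_zero, show (QuotientAddGroup.mk (0 : ℝ) : UnitAddCircle) =
      ((0 : ℝ) : UnitAddCircle) from rfl, hf.lift_coe, hf.lift_coe]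
    simpa using hf 0
  · obtain ⟨ht0, ht⟩ := ht
    rw [← QuotientAddGroup.mk_zero, show (QuotientAddGroup.mk (0 : ℝ) : UnitAddCircle) =
      ((0 : ℝ) : UnitAddCircle) from rfl, hf.lift_coe, hf.lift_coe] at ht
    have h1 : blockRot J i (2 * Real.pi * 1 * t) p = p := by
      have := congrArg Subtype.val ht
      simpa [f, blockRot] using this
    have h2 := hJ.cos_eq_one_of_blockRot_eq (by rintro rfl; simp at hp1) h1
    obtain ⟨m, hm⟩ := (Real.cos_eq_one_iff _).1 h2
    have h3 : (m : ℝ) = t := by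
      refine mul_right_cancel₀ (b := 2 * Real.pi) (by positivity) ?_
      rw [hm]; ring
    rw [← h3] at ht0 ⊢
    have h4 : 0 < m := by exact_mod_cast ht0
    exact_mod_cast h4

/-- Great circles in the common kernel are closed geodesics. -/
theorem exists_closed_residual (hG : IsGenericFamily J lam)
    (hF : ∀ x y, F x y = randersNorm (blockField J lam) x (sphereIncl x y)) {p q : V}
    (hp : p ∈ residual J) (hq : q ∈ residual J) (hp1 : ‖p‖ = 1) (hq1 : ‖q‖ = 1)
    (hpq : inner ℝ p q = 0) :
    ∃ γ, IsClosedGeodesic F γ ∧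
      ∀ t : ℝ, (γ t : V) = Real.cos (2 * Real.pi * t) • p + Real.sin (2 * Real.pi * t) • q := by
  have hJ := hG.toIsBlockFamily
  have hpi := Real.pi_pos
  let f : ℝ → Metric.sphere (0 : V) 1 := fun t =>
    ⟨Real.cos (2 * Real.pi * t) • p + Real.sin (2 * Real.pi * t) • q, by
      rw [mem_sphere_zero_iff_norm, norm_cos_add_sin hp1 hq1 hpq]⟩
  have hf : Function.Periodic f 1 := fun t => Subtype.ext (by
    have : 2 * Real.pi * (t + 1) = 2 * Real.pi * t + 2 * Real.pi := by ring
    simp only [f, this, Real.cos_add_two_pi, Real.sin_add_two_pi])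
  refine ⟨hf.lift, ?_, fun t => by rw [hf.lift_coe]⟩
  refine (isGeodesicIn_of_greatCircle hF (hJ.isIsometryFlow lam)
    (hJ.norm_blockField_lt_one hG.nonneg_lt_one) (l := 2 * Real.pi) (by positivity) hp1 hq1 hpq
    fun t => ?_).1
  rw [hf.lift_coe, IsBlockFamily.blockFlow_of_mem_residual lam ((residual J).add_mem
      ((residual J).smul_mem _ hp) ((residual J).smul_mem _ hq))]

end ClosedGeodesics

end Finsler

/-! ### Orbits of prime closed geodesics and their unions -/

namespace Finsler

open Set Filter Topology MeasureTheory

variable {V : Type*} [NormedAddCommGroup V] [InnerProductSpace ℝ V] {n : ℕ}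
  [Fact (Module.finrank ℝ V = n + 1)] {ι : Type*} {J : ι → V →L[ℝ] V} {lam : ι → ℝ}
  {F : ∀ x : Metric.sphere (0 : V) 1, TangentSpace (𝓡 n) x → ℝ}

section Orbits

theorem IsBlockCircle.mem_block {i : ι} {r : ℝ} {γ : UnitAddCircle → Metric.sphere (0 : V) 1}
    (h : IsBlockCircle J i r γ) (t : UnitAddCircle) : (γ t : V) ∈ block J i := by
  obtain ⟨p, hp, -, hγ⟩ := h
  obtain ⟨t, rfl⟩ := QuotientAddGroup.mk_surjective t
  exact (hγ t).symm ▸ IsBlockFamily.blockRot_mem hp _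

/-- The unit sphere of the block `i`. -/
def blockSphere (J : ι → V →L[ℝ] V) (i : ι) : Set (Metric.sphere (0 : V) 1) :=
  {x | (x : V) ∈ block J i}

theorem IsResidualCircle.mem_residual {r : ℝ} {γ : UnitAddCircle → Metric.sphere (0 : V) 1}
    (h : IsResidualCircle J r γ) (t : UnitAddCircle) : (γ t : V) ∈ residual J := by
  obtain ⟨p, hp, q, hq, -, -, -, hγ⟩ := h
  obtain ⟨t, rfl⟩ := QuotientAddGroup.mk_surjective t
  exact (hγ t).symm ▸ (residual J).add_mem ((residual J).smul_mem _ hp) ((residual J).smul_mem _ hq)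

variable [Fintype ι]

/-- The speed of a closed geodesic determines the block in which it runs. -/
theorem IsClosedGeodesic.mem_block_of_speed (hG : IsGenericFamily J lam)
    (hF : ∀ x y, F x y = randersNorm (blockField J lam) x (sphereIncl x y))
    {γ : UnitAddCircle → Metric.sphere (0 : V) 1} (hγ : IsClosedGeodesic F γ) {i : ι} {ε l : ℝ}
    (hε : ε = 1 ∨ ε = -1) (hl : ε * (2 * Real.pi) = (lam i + ε) * l)
    (hs : ∀ t : ℝ, F (γ t) (velocity (E := EuclideanSpace ℝ (Fin n)) (fun t : ℝ => γ t) t) = l)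
    (t : UnitAddCircle) : (γ t : V) ∈ block J i := by
  obtain ⟨l', hl0, hs', m, hm⟩ := hγ.isBlockCircle_or hG hF
  obtain rfl : l = l' := (hs 0).symm.trans (hs' 0)
  have hpi := Real.pi_pos
  obtain ⟨e, he, hee⟩ : ∃ e : ℤ, (e : ℝ) = ε ∧ e ≠ 0 := by
    rcases hε with rfl | rfl
    · exact ⟨1, by simp, by simp⟩
    · exact ⟨-1, by simp, by simp⟩
  have he0 : ε ≠ 0 := by rw [← he]; exact_mod_cast hee
  rcases hm with ⟨j, ε', hε', hm, hc⟩ | ⟨hm, p, hp, q, -, hp1, -⟩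
  · by_cases hij : j = i
    · exact hij ▸ hc.mem_block t
    · exfalso
      -- Eliminating l from the two frequency relations gives e (λⱼ + ε') = m (λᵢ + ε) with e = ε =
      -- ±1.
      refine hee (hG.indep j i hij ε' ε hε' hε e m ?_)
      refine mul_right_cancel₀ hl0.ne' ?_
      rw [he]
      linear_combination ε * (-hm) + (m : ℝ) * hl
  · exfalso
    refine (hG.irrational_of_residual p hp (by rintro rfl; simp at hp1) i) ⟨(e - m * e) / m, ?_⟩
    have hm0 : (m : ℝ) ≠ 0 := by
      intro h
      rw [h, zero_mul] at hm
      exact hl0.ne hm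
    have h1 : ε = (lam i + ε) * m := by
      refine mul_right_cancel₀ (b := 2 * Real.pi) (by positivity) ?_
      rw [hl, ← hm]; ring
    push_cast
    rw [he]
    field_simp
    linear_combination h1

/-- At speed 2π a circle in the block j would make λⱼ + ε' an integer, against irrationality. -/
theorem IsClosedGeodesic.mem_residual_of_speed (hG : IsGenericFamily J lam)
    (hF : ∀ x y, F x y = randersNorm (blockField J lam) x (sphereIncl x y))
    {γ : UnitAddCircle → Metric.sphere (0 : V) 1} (hγ : IsClosedGeodesic F γ) {x : V}
    (hx : x ∈ residual J) (hx0 : x ≠ 0)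
    (hs : ∀ t : ℝ, F (γ t) (velocity (E := EuclideanSpace ℝ (Fin n)) (fun t : ℝ => γ t) t) =
      2 * Real.pi)
    (t : UnitAddCircle) : (γ t : V) ∈ residual J := by
  obtain ⟨l', hl0, hs', m, hm⟩ := hγ.isBlockCircle_or hG hF
  obtain rfl : 2 * Real.pi = l' := (hs 0).symm.trans (hs' 0)
  rcases hm with ⟨j, ε', hε', hm, hc⟩ | ⟨-, hc⟩
  · exfalso
    have h1 := mul_right_cancel₀ hl0.ne' hm
    refine hG.irrational_of_residual x hx hx0 j ?_
    rcases hε' with rfl | rfl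
    · exact ⟨m - 1, by push_cast; linarith⟩
    · exact ⟨m + 1, by push_cast; linarith⟩
  · exact hc.mem_residual t

theorem IsIsometryFlow.sphereFlow_mem_of_comm {K : V →L[ℝ] V} {S : ℝ → V →L[ℝ] V}
    (h : IsIsometryFlow K S)
    (hF : ∀ x y, F x y = randersNorm (blockField J lam) x (sphereIncl x y))
    (hc : ∀ j t x, J j (S t x) = S t (J j x)) (t : ℝ) : h.sphereFlow t ∈ connIsometries F :=
  h.sphereFlow_mem_connIsometries hF (fun t x => by simp [blockField, hc]) t

theorem IsIsometryFlow.curveOrbit_eq {K : V →L[ℝ] V} {S : ℝ → V →L[ℝ] V}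
    (h : IsIsometryFlow K S)
    (hF : ∀ x y, F x y = randersNorm (blockField J lam) x (sphereIncl x y))
    (hc : ∀ j t x, J j (S t x) = S t (J j x)) {θ : ℝ}
    {γ γ' : UnitAddCircle → Metric.sphere (0 : V) 1} (hγ : ∀ t : ℝ, (γ' t : V) = S θ (γ t)) :
    curveOrbit F γ' = curveOrbit F γ := by
  have e : γ' = fun t => h.sphereFlow θ (γ t) := funext fun t => Subtype.ext (by
    obtain ⟨t, rfl⟩ := QuotientAddGroup.mk_surjective t
    exact hγ t)
  rw [e]
  exact Finsler.curveOrbit_eq (h.sphereFlow_mem_of_comm hF hc θ)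
    (h.sphereFlow_mem_of_comm hF hc (-θ)) (h.sphereFlow_neg θ)

theorem IsBlockCircle.curveOrbit_eq (hJ : IsBlockFamily J)
    (hF : ∀ x y, F x y = randersNorm (blockField J lam) x (sphereIncl x y)) {i : ι} {r : ℝ}
    {γ γ' : UnitAddCircle → Metric.sphere (0 : V) 1} (h : IsBlockCircle J i r γ)
    (h' : IsBlockCircle J i r γ') : curveOrbit F γ' = curveOrbit F γ := by
  obtain ⟨p, hp, hp1, hγ⟩ := h
  obtain ⟨p', hp', hp1', hγ'⟩ := h'
  obtain ⟨K, S, hS, hc, θ, hθ⟩ := hJ.exists_flow_block hp hp' hp1 hp1'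
  refine hS.curveOrbit_eq hF hc (θ := θ) fun t => ?_
  rw [hγ, hγ', ← hθ]
  simp only [blockRot, map_add, map_smul, hc]

/-- One rotation takes p to p'; a second one, inside the orthogonal complement of p' in the common
kernel, takes the image of q to q' and fixes p'. The third orthogonal vector w makes that complement
at least two-dimensional. -/
theorem IsResidualCircle.curveOrbit_eq (hG : IsGenericFamily J lam)
    (hF : ∀ x y, F x y = randersNorm (blockField J lam) x (sphereIncl x y)) {r : ℝ}
    {γ γ' : UnitAddCircle → Metric.sphere (0 : V) 1} (h : IsResidualCircle J r γ)
    (h' : IsResidualCircle J r γ') : curveOrbit F γ' = curveOrbit F γ := by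
  have hJ := hG.toIsBlockFamily
  obtain ⟨p, hp, q, hq, hp1, hq1, hpq, hγ⟩ := h
  obtain ⟨p', hp', q', hq', hp1', hq1', hpq', hγ'⟩ := h'
  obtain ⟨K, S, hS, hc, ⟨θ, hθ⟩, -⟩ := hJ.exists_flow_residual (U := residual J) (fun _ h => h)
    hp hp' hq hp1 hp1' hq1 hpq
  obtain ⟨w, hw, hw1, hpw, hqw⟩ := hG.exists_orthogonal p' hp' q' hq' hp1' hq1' hpq'
  have hSq : S θ q ∈ residual J := Finsler.mem_residual.2 fun j => by
    rw [hc, Finsler.mem_residual.1 hq j, map_zero]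
  have hmem : ∀ {x : V}, x ∈ residual J → inner ℝ p' x = 0 → x ∈ residual J ⊓ (ℝ ∙ p')ᗮ :=
    fun hx h => ⟨hx, Submodule.mem_orthogonal_singleton_iff_inner_right.2 h⟩
  have hpSq : inner ℝ p' (S θ q) = 0 := by
    rw [← hθ, hS.inner_map_map, hpq]
  obtain ⟨K', S', hS', hc', ⟨θ', hθ'⟩, hfix⟩ := hJ.exists_flow_residual
    (U := residual J ⊓ (ℝ ∙ p')ᗮ) (fun _ h => h.1) (hmem hq' hpq') (hmem hSq hpSq)
    (hmem hw hpw) hq1' (by rw [hS.norm, hq1]) hw1 hqw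
  have hp'fix : S' θ' p' = p' := hfix p' (fun v hv =>
    Submodule.mem_orthogonal_singleton_iff_inner_left.1 hv.2) θ'
  rw [← hS.curveOrbit_eq hF hc (γ' := fun t => hS.sphereFlow θ (γ t)) (fun t => rfl)]
  refine (hS'.curveOrbit_eq hF hc' (θ := θ') fun t => ?_).symm
  rw [hγ', hS.coe_sphereFlow, hγ]
  simp only [map_add, map_smul, hθ, hθ', hp'fix]

/-- There are only finitely many orbits of prime closed geodesics. -/
theorem IsGenericFamily.assumptionF (hG : IsGenericFamily J lam)
    (hF : ∀ x y, F x y = randersNorm (blockField J lam) x (sphereIncl x y)) : AssumptionF F := by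
  have hsub : ∀ P : (UnitAddCircle → Metric.sphere (0 : V) 1) → Prop,
      (∀ γ γ', P γ → P γ' → curveOrbit F γ = curveOrbit F γ') →
      {𝓑 | ∃ γ, P γ ∧ 𝓑 = curveOrbit F γ}.Finite := fun P h =>
    Set.Subsingleton.finite fun _ ⟨γ, hγ, e⟩ _ ⟨γ', hγ', e'⟩ => by rw [e, e', h γ γ' hγ hγ']
  have hb : ∀ ε : ℝ, ∀ i : ι, {𝓑 | ∃ γ, IsBlockCircle J i ε γ ∧ 𝓑 = curveOrbit F γ}.Finite :=
    fun ε i => hsub _ fun _ _ h h' => h'.curveOrbit_eq hG.toIsBlockFamily hF h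
  refine (((finite_iUnion (hb 1)).union (finite_iUnion (hb (-1)))).union
    (hsub (IsResidualCircle J 1) fun _ _ h h' => h'.curveOrbit_eq hG hF h)).subset ?_
  rintro 𝓑 ⟨γ, hγ, rfl⟩
  obtain ⟨l, -, -, ⟨i, ε, rfl | rfl, -, h⟩ | ⟨-, h⟩⟩ := hγ.isBlockCircle_or hG hF
  · exact .inl (.inl (mem_iUnion.2 ⟨i, γ, h, rfl⟩))
  · exact .inl (.inr (mem_iUnion.2 ⟨i, γ, h, rfl⟩))
  · exact .inr ⟨γ, h, rfl⟩

/-- G is not assumed to respect the blocks; the union stays in one block because isometries preserve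
the speed. It fills the block sphere by transitivity of the commuting rotations. In the common
kernel containment suffices, since H_o acts trivially there. -/
theorem IsPrimeClosedGeodesic.unionOfCurves_eq_or (hG : IsGenericFamily J lam)
    (hF : ∀ x y, F x y = randersNorm (blockField J lam) x (sphereIncl x y))
    {γ : UnitAddCircle → Metric.sphere (0 : V) 1} (hγ : IsPrimeClosedGeodesic F γ) :
    (∃ i, unionOfCurves (curveOrbit F γ) = blockSphere J i) ∨
      (∀ x ∈ unionOfCurves (curveOrbit F γ), (x : V) ∈ residual J) ∧
        ∃ p ∈ residual J, ∃ q ∈ residual J, ‖p‖ = 1 ∧ ‖q‖ = 1 ∧ inner ℝ p q = 0 := by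
  obtain ⟨l, hl, hs, h⟩ := hγ.isBlockCircle_or hG hF
  have hmem : ∀ {x}, x ∈ unionOfCurves (curveOrbit F γ) →
      ∃ g ∈ isometries F, ∃ t, x = g (γ t) := by
    intro x hx
    simp only [unionOfCurves, mem_iUnion] at hx
    obtain ⟨c, ⟨g, hg, t', hc⟩, t, rfl⟩ := hx
    exact ⟨g, connIsometries_subset hg, _, hc t⟩
  rcases h with ⟨i, ε, hε, hle, h⟩ | ⟨hle, h⟩
  · refine .inl ⟨i, Subset.antisymm (fun x hx => ?_) fun x hx => ?_⟩
    · obtain ⟨g, hg, t, rfl⟩ := hmem hx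
      exact (hγ.1.comp_isometry hg).mem_block_of_speed hG hF hε hle
        (fun t => ((IsGeodesicIn.isometry_comp hg hγ.1).2 t).trans (hs t)) t
    · obtain ⟨K, S, hS, hc, θ, hθ⟩ := hG.toIsBlockFamily.exists_flow_block
        (h.mem_block 0) hx (norm_eq_of_mem_sphere _) (norm_eq_of_mem_sphere x)
      simp only [unionOfCurves, mem_iUnion]
      exact ⟨_, ⟨_, hS.sphereFlow_mem_of_comm hF hc θ, 0, fun t => rfl⟩, 0, Subtype.ext (by
        simpa [hS.coe_sphereFlow] using hθ)⟩
  · obtain ⟨p, hp, q, hq, hp1, hq1, hpq, -⟩ := id h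
    refine .inr ⟨fun x hx => ?_, p, hp, q, hq, hp1, hq1, hpq⟩
    obtain ⟨g, hg, t, rfl⟩ := hmem hx
    exact (hγ.1.comp_isometry hg).mem_residual_of_speed hG hF (h.mem_residual 0)
      (ne_zero_of_mem_unit_sphere _)
      (fun t => ((IsGeodesicIn.isometry_comp hg hγ.1).2 t).trans ((hs t).trans hle.symm)) t

theorem exists_prime_unionOfCurves_eq (hG : IsGenericFamily J lam)
    (hF : ∀ x y, F x y = randersNorm (blockField J lam) x (sphereIncl x y)) (i : ι) :
    ∃ γ, IsPrimeClosedGeodesic F γ ∧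
      unionOfCurves (curveOrbit F γ) = blockSphere J i := by
  obtain ⟨p, hp, hp1⟩ := hG.nontrivial i
  obtain ⟨γ, hγ, hγt⟩ := exists_prime_block hG hF hp hp1
  have hi : (γ 0 : V) ∈ block J i :=
    IsBlockCircle.mem_block ⟨p, hp, hp1, hγt⟩ 0
  have h0 : γ 0 ∈ unionOfCurves (curveOrbit F γ) := by
    simp only [unionOfCurves, mem_iUnion]
    exact ⟨γ, mem_curveOrbit_self γ, 0, rfl⟩
  refine ⟨γ, hγ, ?_⟩
  rcases hγ.unionOfCurves_eq_or hG hF with ⟨j, hj⟩ | ⟨h, -⟩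
  · by_cases hij : i = j
    · rw [hj, hij]
    · rw [hj] at h0
      exact (ne_zero_of_mem_unit_sphere _ (hG.disjoint_block hij hi h0)).elim
  · exact (ne_zero_of_mem_unit_sphere _
      (IsBlockFamily.eq_zero_of_block_of_residual hi (h _ h0))).elim

/-- A block is flow-invariant, so the geodesics of its sphere are moving great circles with p, q in
the block, and these are geodesics of the whole sphere. -/
theorem IsBlockFamily.isTotallyGeodesic_block (hJ : IsBlockFamily J)
    (hlam : ∀ i, 0 ≤ lam i ∧ lam i < 1)
    (hF : ∀ x y, F x y = randersNorm (blockField J lam) x (sphereIncl x y)) (i : ι) :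
    IsTotallyGeodesic F (blockSphere J i) := by
  refine ⟨isEmbeddedSubmanifold_section (block J i) fun x => Iff.rfl, fun c hc => ?_⟩
  obtain ⟨l, hl, -, p, -, q, -, hp, hq, hpq, hcc⟩ := hc.exists_greatCircle hF
    (hJ.isIsometryFlow lam) (hJ.norm_blockField_lt_one hlam) (U := block J i)
    (fun t x hx => by
      rw [hJ.blockFlow_of_mem_block lam hx]; exact IsBlockFamily.blockRot_mem hx _) fun x => Iff.rfl
  exact (isGeodesicIn_of_greatCircle hF (hJ.isIsometryFlow lam) (hJ.norm_blockField_lt_one hlam) hl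
    hp hq hpq hcc).1

end Orbits

end Finsler

/-! ### The group preserving all closed geodesics -/

namespace Finsler

open Set Filter Topology MeasureTheory

variable {V : Type*} [NormedAddCommGroup V] [InnerProductSpace ℝ V] {n : ℕ}
  [Fact (Module.finrank ℝ V = n + 1)] {ι : Type*} [Fintype ι] {J : ι → V →L[ℝ] V} {lam : ι → ℝ}
  {F : ∀ x : Metric.sphere (0 : V) 1, TangentSpace (𝓡 n) x → ℝ}

section PreservingGroup

theorem exists_blockRot_of_mem_preservingGroup (hG : IsGenericFamily J lam)
    (hF : ∀ x y, F x y = randersNorm (blockField J lam) x (sphereIncl x y))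
    {g : C(Metric.sphere (0 : V) 1, Metric.sphere (0 : V) 1)} (hg : g ∈ preservingGroup F) {i : ι}
    (x : Metric.sphere (0 : V) 1) (hx : (x : V) ∈ block J i) :
    ∃ θ, (g x : V) = blockRot J i θ x := by
  obtain ⟨γ, hγ, hγt⟩ := exists_prime_block hG hF hx (norm_eq_of_mem_sphere x)
  obtain ⟨t₀, ht₀⟩ := hg.2 γ hγ.1
  obtain ⟨s, rfl⟩ := QuotientAddGroup.mk_surjective t₀
  have h0 : γ ((0 : ℝ) : UnitAddCircle) = x := Subtype.ext (by rw [hγt]; simp [blockRot])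
  have e : g x = γ (s : ℝ) := by
    have h1 := ht₀ ((0 : ℝ) : UnitAddCircle)
    rwa [h0, ← AddCircle.coe_add, zero_add] at h1
  exact ⟨_, (congrArg Subtype.val e).trans (hγt s)⟩

/-- The point x lies on the closed geodesic through x in direction q. The freedom in q is the point:
comparing two directions pins g x down to ±x. -/
theorem exists_cos_sin_of_mem_preservingGroup (hG : IsGenericFamily J lam)
    (hF : ∀ x y, F x y = randersNorm (blockField J lam) x (sphereIncl x y))
    {g : C(Metric.sphere (0 : V) 1, Metric.sphere (0 : V) 1)} (hg : g ∈ preservingGroup F)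
    (x : Metric.sphere (0 : V) 1) (hx : (x : V) ∈ residual J) {q : V} (hq : q ∈ residual J)
    (hq1 : ‖q‖ = 1) (hxq : inner ℝ (x : V) q = 0) :
    ∃ θ : ℝ, (g x : V) = Real.cos θ • (x : V) + Real.sin θ • q := by
  obtain ⟨γ, hγ, hγt⟩ := exists_closed_residual hG hF hx hq (norm_eq_of_mem_sphere x) hq1 hxq
  obtain ⟨t₀, ht₀⟩ := hg.2 γ hγ
  obtain ⟨s, rfl⟩ := QuotientAddGroup.mk_surjective t₀
  have h0 : γ ((0 : ℝ) : UnitAddCircle) = x := Subtype.ext (by rw [hγt]; simp)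
  have e : g x = γ (s : ℝ) := by
    have h1 := ht₀ ((0 : ℝ) : UnitAddCircle)
    rwa [h0, ← AddCircle.coe_add, zero_add] at h1
  exact ⟨_, (congrArg Subtype.val e).trans (hγt s)⟩

/-- The block rotations preserve each closed geodesic. -/
theorem sphereFlow_mem_preservingGroup (hG : IsGenericFamily J lam)
    (hF : ∀ x y, F x y = randersNorm (blockField J lam) x (sphereIncl x y)) (μ : ι → ℝ) (t : ℝ) :
    (hG.isIsometryFlow μ).sphereFlow t ∈ preservingGroup F := by
  have hJ := hG.toIsBlockFamily
  refine ⟨(hJ.isIsometryFlow μ).sphereFlow_mem_of_comm hF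
    (fun j t x => hJ.apply_comm_blockFlow μ j t x) t, fun γ hγ => ?_⟩
  obtain ⟨l, hl, -, m, ⟨i, ε, hε, hm, h⟩ | ⟨-, h⟩⟩ := hγ.isBlockCircle_or hG hF
  · have hm0 : (m : ℝ) ≠ 0 := by
      intro h
      rw [h, zero_mul] at hm
      exact mul_ne_zero (hG.lam_add_ne_zero i hε) hl.ne' hm.symm
    -- The circle turns by 2πm per unit of time, so rotation by the angle μᵢ t is this shift of
    -- parameter.
    refine ⟨((μ i * t / (2 * Real.pi * m) : ℝ) : UnitAddCircle), fun s => Subtype.ext ?_⟩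
    have hs := h.mem_block s
    obtain ⟨p, hp, -, hγt⟩ := h
    obtain ⟨s, rfl⟩ := QuotientAddGroup.mk_surjective s
    rw [IsIsometryFlow.coe_sphereFlow, hJ.blockFlow_of_mem_block μ hs]
    refine (congrArg _ (hγt s)).trans (Eq.trans ?_ (hγt _).symm)
    rw [← IsBlockFamily.blockRot_add hp]
    congr 1
    have := Real.pi_pos
    field_simp
    ring
  · refine ⟨0, fun s => Subtype.ext ?_⟩
    rw [IsIsometryFlow.coe_sphereFlow,
      IsBlockFamily.blockFlow_of_mem_residual μ (h.mem_residual s), add_zero]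

theorem exists_connPreservingGroup_ne (hG : IsGenericFamily J lam)
    (hF : ∀ x y, F x y = randersNorm (blockField J lam) x (sphereIncl x y)) (i : ι) :
    ∃ g ∈ connPreservingGroup F, ∃ x ∈ blockSphere J i, g x ≠ x := by
  obtain ⟨p, hp, hp1⟩ := hG.nontrivial i
  -- The half turn of all blocks at once is −1 on each of them.
  refine ⟨_, (hG.isIsometryFlow fun _ => 1).sphereFlow_mem_connectedComponentIn
    (sphereFlow_mem_preservingGroup hG hF _) Real.pi, ⟨p, by simpa using hp1⟩, hp, fun h => ?_⟩
  have h1 := congrArg Subtype.val h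
  rw [IsIsometryFlow.coe_sphereFlow, hG.blockFlow_of_mem_block _ hp] at h1
  have h2 : p = 0 := by
    have h3 : -p = p := by simpa [blockRot] using h1
    have h4 : (2 : ℝ) • p = p - -p := by module
    rw [h3, sub_self] at h4
    exact (smul_eq_zero.1 h4).resolve_left two_ne_zero
  simp [h2] at hp1

/-- The identity component of the preserving group fixes the common kernel. -/
theorem connPreservingGroup_apply_residual (hG : IsGenericFamily J lam)
    (hF : ∀ x y, F x y = randersNorm (blockField J lam) x (sphereIncl x y))
    {g : C(Metric.sphere (0 : V) 1, Metric.sphere (0 : V) 1)} (hg : g ∈ connPreservingGroup F)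
    (x : Metric.sphere (0 : V) 1) (hx : (x : V) ∈ residual J) {q : V} (hq : q ∈ residual J)
    (hq1 : ‖q‖ = 1) (hxq : inner ℝ (x : V) q = 0) : g x = x := by
  have hx1 : ‖(x : V)‖ = 1 := norm_eq_of_mem_sphere x
  obtain ⟨r, hr, hr1, hxr, hqr⟩ := hG.exists_orthogonal x hx q hq hx1 hq1 hxq
  -- h x lies on the great circles through x in the orthogonal directions q and r, which meet only
  -- in ±x.
  have key : ∀ h ∈ preservingGroup F, ∃ c : ℝ, c ^ 2 = 1 ∧ (h x : V) = c • (x : V) := by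
    intro h hh
    obtain ⟨θ, hθ⟩ := exists_cos_sin_of_mem_preservingGroup hG hF hh x hx hq hq1 hxq
    obtain ⟨θ', hθ'⟩ := exists_cos_sin_of_mem_preservingGroup hG hF hh x hx hr hr1 hxr
    have h1 := congrArg (inner ℝ q) (hθ.symm.trans hθ')
    simp only [inner_add_right, inner_smul_right, real_inner_comm (x : V) q, hxq, hqr,
      real_inner_self_eq_norm_sq, hq1] at h1
    have h2 : Real.sin θ = 0 := by linarith
    refine ⟨Real.cos θ, by nlinarith [Real.sin_sq_add_cos_sq θ], by rw [hθ, h2]; simp⟩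
  have hval : ∀ (c : ℝ) (h : C(Metric.sphere (0 : V) 1, Metric.sphere (0 : V) 1)),
      (h x : V) = c • (x : V) → inner ℝ (x : V) (h x) = c := fun c h e => by
    rw [e, inner_smul_right, real_inner_self_eq_norm_sq, hx1]; ring
  obtain ⟨c, hc, hgc⟩ := key g (connectedComponentIn_subset _ _ hg)
  rcases sq_eq_one_iff.1 hc with rfl | rfl
  · exact Subtype.ext (by rw [hgc, one_smul])
  · exfalso
    have hid : ContinuousMap.id _ ∈ connPreservingGroup F :=
      mem_connectedComponentIn (connectedComponentIn_nonempty_iff.1 ⟨g, hg⟩)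
    -- ⟨x, h x⟩ is continuous in h and takes only the values ±1 on H; on the connected component of
    -- the identity it stays 1.
    have hcont : Continuous fun h : C(Metric.sphere (0 : V) 1, Metric.sphere (0 : V) 1) =>
        inner ℝ (x : V) (h x) :=
      continuous_const.inner
        (continuous_subtype_val.comp (continuous_eval_const x))
    obtain ⟨h, hh, h0⟩ := isPreconnected_connectedComponentIn.intermediate_value hg hid
      hcont.continuousOn (show (0 : ℝ) ∈ Icc _ _ from
        ⟨by rw [hval _ _ hgc]; norm_num, by simp⟩)
    obtain ⟨c, hc, hhc⟩ := key h (connectedComponentIn_subset _ _ hh)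
    have := hval _ _ hhc
    simp only [h0] at this
    rw [← this] at hc
    norm_num at hc

/-- The totally geodesic unions of prime closed geodesics with nontrivial action are the unit
spheres of the blocks. -/
theorem unionOfCurves_eq_range (hG : IsGenericFamily J lam)
    (hF : ∀ x y, F x y = randersNorm (blockField J lam) x (sphereIncl x y)) :
    {B : Set (Metric.sphere (0 : V) 1) | ∃ 𝓑 ∈ primeOrbits F, B = unionOfCurves 𝓑 ∧
      IsTotallyGeodesic F B ∧ ∃ g ∈ connPreservingGroup F, ∃ x ∈ B, g x ≠ x} =
    range (blockSphere J) := by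
  ext B
  constructor
  · rintro ⟨_, ⟨γ, hγ, rfl⟩, rfl, -, g, hg, x, hx, hgx⟩
    rcases hγ.unionOfCurves_eq_or hG hF with ⟨i, hi⟩ | ⟨hr, p, hp, q, hq, hp1, hq1, hpq⟩
    · exact ⟨i, hi.symm⟩
    · obtain ⟨w, hw, hw1, hpw, θ, hθ⟩ := exists_cos_add_sin hp (hr x hx) hq hp1
        (norm_eq_of_mem_sphere x) hq1 hpq
      -- The companion vector orthogonal to x is the point a quarter turn further along the great
      -- circle through p and x.
      refine (hgx (connPreservingGroup_apply_residual hG hF hg x (hr x hx)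
        (q := Real.cos (θ + Real.pi / 2) • p + Real.sin (θ + Real.pi / 2) • w)
        ((residual J).add_mem ((residual J).smul_mem _ hp) ((residual J).smul_mem _ hw))
        ?_ ?_)).elim
      · simpa using norm_cos_add_sin hp1 hw1 hpw (θ + Real.pi / 2) 
      · rw [hθ]
        simp only [inner_add_left, inner_add_right, inner_smul_left, inner_smul_right,
          real_inner_self_eq_norm_sq, hp1, hw1, hpw, real_inner_comm p w, RCLike.conj_to_real,
          Real.cos_add_pi_div_two, Real.sin_add_pi_div_two]
        ring
  · rintro ⟨i, rfl⟩
    obtain ⟨γ, hγ, h⟩ := exists_prime_unionOfCurves_eq hG hF i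
    exact ⟨_, ⟨γ, hγ, rfl⟩, h.symm, hG.isTotallyGeodesic_block hG.nonneg_lt_one hF i,
      exists_connPreservingGroup_ne hG hF i⟩

end PreservingGroup

end Finsler

/-! ### The Lie algebra of the preserving group -/

namespace Finsler

open Set Filter Topology MeasureTheory

variable {V : Type*} [NormedAddCommGroup V] [InnerProductSpace ℝ V] {n : ℕ}
  [Fact (Module.finrank ℝ V = n + 1)] {ι : Type*} [Fintype ι] {J : ι → V →L[ℝ] V} {lam : ι → ℝ}
  {F : ∀ x : Metric.sphere (0 : V) 1, TangentSpace (𝓡 n) x → ℝ}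

section LieAlgebra

theorem IsMIntegralCurve.hasDerivAt_coe {c : ℝ → Metric.sphere (0 : V) 1}
    {X : ∀ x : Metric.sphere (0 : V) 1, TangentSpace (𝓡 n) x} (hc : IsMIntegralCurve c X) (t : ℝ) :
    HasDerivAt (fun t => (c t : V)) (sphereIncl (c t) (X (c t))) t := by
  have h1 := hc t
  have h2 : DifferentiableAt ℝ (fun t => (c t : V)) t :=
    (((contMDiff_coe_sphere (m := 1) (n := n) (E := V) (c t)).mdifferentiableAt
      one_ne_zero).comp t h1.mdifferentiableAt).differentiableAt
  have h3 : velocity (E := EuclideanSpace ℝ (Fin n)) c t = X (c t) :=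
    (congrArg (fun T => T (1 : ℝ)) h1.mfderiv).trans (one_smul ℝ _)
  have h4 := sphereIncl_velocity h1.mdifferentiableAt
  rw [h3] at h4
  exact h4 ▸ h2.hasDerivAt

/-- If `D x` is a multiple of `J x` for every `x` in a block, then `D` is a multiple of `J` on the
block. -/
theorem IsBlockFamily.exists_forall_eq_smul {ι : Type*} {J : ι → V →L[ℝ] V} {i : ι}
    (D : V →ₗ[ℝ] V) (h : ∀ x ∈ block J i, ∃ b : ℝ, D x = b • J i x) :
    ∃ b : ℝ, ∀ x ∈ block J i, D x = b • J i x := by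
  by_cases h0 : ∀ x ∈ block J i, x = 0
  · exact ⟨0, fun x hx => by simp [h0 x hx]⟩
  push Not at h0
  obtain ⟨x, hx, hx0⟩ := h0
  obtain ⟨b, hb⟩ := h x hx
  refine ⟨b, fun y hy => ?_⟩
  obtain ⟨b', hb'⟩ := h y hy
  obtain ⟨c, hc⟩ := h (x + y) ((block J i).add_mem hx hy)
  rw [map_add, hb, hb', map_add] at hc
  -- The three factors for x, y and x + y are tied by this relation: either they agree, or y is a
  -- multiple of x and linearity settles it.
  have h1 : (c - b) • x + (c - b') • y = 0 := by
    have h2 := congrArg (J i) hc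
    simp only [map_add, map_smul, mem_block.1 hx, mem_block.1 hy] at h2
    rw [← sub_eq_zero] at h2
    rw [← h2]; module
  by_cases hcb : c = b'
  · rw [hcb, sub_self, zero_smul, add_zero] at h1
    have := (smul_eq_zero.1 h1).resolve_right hx0
    rw [hb', sub_eq_zero.1 this]
  · have h2 : y = (-(c - b) / (c - b')) • x := by
      have h3 : (c - b') • y = -((c - b) • x) := eq_neg_of_add_eq_zero_right h1
      rw [div_eq_inv_mul, mul_smul, neg_smul, ← h3, inv_smul_smul₀ (sub_ne_zero.2 hcb)]
    rw [h2, map_smul, hb, map_smul, smul_comm]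

/-- A skew linear map preserving all lines through the orbits of the preserving group is a
combination of the `J i`. -/
theorem IsGenericFamily.exists_eq_blockField (hG : IsGenericFamily J lam) (D : V →ₗ[ℝ] V)
    (hskew : ∀ x y, inner ℝ (D x) y = -inner ℝ x (D y))
    (hb : ∀ i, ∀ x ∈ block J i, D x ∈ Submodule.span ℝ {x, J i x})
    (hr : ∀ x ∈ residual J, ∀ q ∈ residual J, ‖x‖ = 1 → ‖q‖ = 1 → inner ℝ x q = 0 →
      D x ∈ Submodule.span ℝ {x, q}) :
    ∃ μ : ι → ℝ, ∀ x, D x = blockField J μ x := by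
  have hself : ∀ x, inner ℝ x (D x) = 0 := fun x => by
    have := hskew x x
    rw [real_inner_comm] at this
    linarith
  have hb' : ∀ i, ∃ b : ℝ, ∀ x ∈ block J i, D x = b • J i x := fun i => by
    refine IsBlockFamily.exists_forall_eq_smul D fun x hx => ?_
    obtain ⟨a, b, hab⟩ := Submodule.mem_span_pair.1 (hb i x hx)
    by_cases hx0 : x = 0
    · exact ⟨0, by simp [hx0]⟩
    have h1 := hself x
    rw [← hab, inner_add_right, inner_smul_right, inner_smul_right, hG.inner_self, mul_zero,
      add_zero] at h1
    have ha : a = 0 := (mul_eq_zero.1 h1).resolve_right (inner_self_ne_zero.2 hx0)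
    exact ⟨b, by rw [← hab, ha, zero_smul, zero_add]⟩
  choose μ hμ using hb'
  -- By skewness of both maps, ⟨Jᵢ D x, y⟩ = ⟨x, D Jᵢ y⟩ = μᵢ ⟨x, Jᵢ² y⟩, and this vanishes for x in
  -- the common kernel.
  have hres : ∀ x ∈ residual J, D x ∈ residual J := fun x hx => by
    refine mem_residual.2 fun i => (inner_self_eq_zero (𝕜 := ℝ)).1 ?_
    set y := J i (D x)
    rw [show inner ℝ y y = inner ℝ (J i (D x)) y from rfl, hG.skew, hskew,
      hμ i _ (hG.apply_mem_block i y), inner_smul_right, ← neg_neg (inner ℝ x _), ← hG.skew,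
      mem_residual.1 hx]
    simp
  -- If D x ≠ 0, choose r orthogonal to x and D x. Then D x lies in the span of x and r while being
  -- orthogonal to both.
  have hr1 : ∀ x ∈ residual J, ‖x‖ = 1 → D x = 0 := fun x hx hx1 => by
    by_contra h0
    have hn : ‖D x‖ ≠ 0 := norm_ne_zero_iff.2 h0
    obtain ⟨r, hrm, hr1, hxr, hqr⟩ := hG.exists_orthogonal x hx (‖D x‖⁻¹ • D x)
      ((residual J).smul_mem _ (hres x hx)) hx1
      (by rw [norm_smul, norm_inv, norm_norm, inv_mul_cancel₀ hn])
      (by rw [inner_smul_right, hself, mul_zero])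
    obtain ⟨a, b, hab⟩ := Submodule.mem_span_pair.1 (hr x hx r hrm hx1 hr1 hxr)
    rw [inner_smul_left] at hqr
    have h1 : inner ℝ (D x) r = 0 := (mul_eq_zero.1 hqr).resolve_left (by simpa using h0)
    have h2 : inner ℝ (D x) (D x) = 0 := by
      nth_rewrite 2 [← hab]
      rw [inner_add_right, inner_smul_right, inner_smul_right, h1, real_inner_comm, hself]
      simp
    exact h0 (inner_self_eq_zero.1 h2)
  have hr0 : ∀ x ∈ residual J, D x = 0 := fun x hx => by
    by_cases hx0 : x = 0
    · rw [hx0, map_zero]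
    have hn : ‖x‖ ≠ 0 := norm_ne_zero_iff.2 hx0
    have h1 := hr1 (‖x‖⁻¹ • x) ((residual J).smul_mem _ hx)
      (by rw [norm_smul, norm_inv, norm_norm, inv_mul_cancel₀ hn])
    rw [map_smul] at h1
    exact (smul_eq_zero.1 h1).resolve_left (inv_ne_zero hn)
  refine ⟨μ, fun x => ?_⟩
  -- Every x is its component in the common kernel minus ∑ Jᵢ² x, and D is known on each summand.
  have h1 := hr0 _ (hG.add_sum_mem_residual x)
  rw [map_add, map_sum] at h1
  rw [eq_neg_of_add_eq_zero_left h1]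
  simp only [blockField, sum_apply, smul_apply]
  rw [← Finset.sum_neg_distrib]
  refine Finset.sum_congr rfl fun i _ => ?_
  rw [hμ i _ (hG.apply_mem_block i _), hG.cube, smul_neg, neg_neg]

/-- The maps φ t are restrictions of linear isometries, so X is the restriction of a linear field D,
their derivative at 0. Membership in a fixed subspace passes to the derivative, which gives D x ∈
span{x, Jᵢ x} on blocks and D x ∈ span{x, q} on the common kernel. -/
theorem generator_preservingGroup (hn : 1 ≤ n) (hG : IsGenericFamily J lam)
    (hF : ∀ x y, F x y = randersNorm (blockField J lam) x (sphereIncl x y))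
    {φ : ℝ → C(Metric.sphere (0 : V) 1, Metric.sphere (0 : V) 1)}
    (hφ : ∀ t, φ t ∈ preservingGroup F) (hφ0 : φ 0 = ContinuousMap.id _)
    {X : ∀ x : Metric.sphere (0 : V) 1, TangentSpace (𝓡 n) x}
    (hX : ∀ x, IsMIntegralCurve (fun t => φ t x) X) :
    ∃ μ : ι → ℝ, ∀ x : Metric.sphere (0 : V) 1, sphereIncl x (X x) = blockField J μ x := by
  have : FiniteDimensional ℝ V := .of_fact_finrank_eq_succ n
  choose L hL using fun t => exists_linearIsometryEquiv_of_mem_isometries hn hF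
    (hG.norm_blockField_lt_one hG.nonneg_lt_one) (hG.skew_blockField lam)
    (connIsometries_subset (hφ t).1)
  -- The integral curves give information on unit vectors only; scaling extends it to V.
  have hunit : ∀ v : V, ∃ x : Metric.sphere (0 : V) 1, v ≠ 0 → v = ‖v‖ • (x : V) := by
    intro v
    by_cases hv : v = 0
    · have : Nontrivial V := Module.nontrivial_of_finrank_pos (R := ℝ)
        (by rw [Fact.out (p := Module.finrank ℝ V = n + 1)]; omega)
      obtain ⟨x, hx⟩ := NormedSpace.sphere_nonempty (E := V) (x := 0) |>.2 zero_le_one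
      exact ⟨⟨x, hx⟩, fun h => (h hv).elim⟩
    · have hn : ‖v‖ ≠ 0 := norm_ne_zero_iff.2 hv
      exact ⟨⟨‖v‖⁻¹ • v, by
        rw [mem_sphere_zero_iff_norm, norm_smul, norm_inv, norm_norm, inv_mul_cancel₀ hn]⟩,
        fun _ => (smul_inv_smul₀ hn v).symm⟩
  have hS : ∀ x : Metric.sphere (0 : V) 1,
      HasDerivAt (fun t => L t x) (sphereIncl x (X x)) 0 := fun x => by
    have h1 := IsMIntegralCurve.hasDerivAt_coe (hX x) 0
    simp only [hL] at h1
    have h2 : φ 0 x = x := by rw [hφ0]; rfl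
    rwa [h2] at h1
  have hd : ∀ v, DifferentiableAt ℝ (fun t => L t v) 0 := fun v => by
    by_cases hv : v = 0
    · simp [hv]
    · obtain ⟨x, hx⟩ := hunit v
      rw [hx hv]
      simp only [map_smul]
      exact ((hS x).const_smul ‖v‖).differentiableAt
  have hL0 : ∀ v, L 0 v = v := fun v => by
    by_cases hv : v = 0
    · simp [hv]
    · obtain ⟨x, hx⟩ := hunit v
      rw [hx hv, map_smul, ← hL 0 x, hφ0]
      rfl
  let D : V →ₗ[ℝ] V :=
    { toFun := fun v => deriv (fun t => L t v) 0
      map_add' := fun v w => by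
        simp only [map_add]
        exact ((hd v).hasDerivAt.add (hd w).hasDerivAt).deriv
      map_smul' := fun c v => by
        simp only [map_smul]
        exact ((hd v).hasDerivAt.const_smul c).deriv }
  have hD : ∀ v, HasDerivAt (fun t => L t v) (D v) 0 := fun v => (hd v).hasDerivAt
  have hmem : ∀ {v : V} {U : Submodule ℝ V}, (∀ t, L t v ∈ U) → D v ∈ U := fun h =>
    deriv_mem_submodule h 0
  suffices h : ∃ μ : ι → ℝ, ∀ x, D x = blockField J μ x by
    obtain ⟨μ, hμ⟩ := h
    refine ⟨μ, fun x => ?_⟩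
    rw [← hμ]
    exact (hS x).unique (hD x)
  refine hG.exists_eq_blockField D (fun v w => ?_) (fun i v hv => ?_)
    fun v hv q hq hv1 hq1 hvq => ?_
  · have h1 := (hD v).inner ℝ (hD w)
    simp only [(L _).inner_map_map, hL0] at h1
    have := h1.unique (hasDerivAt_const _ _)
    linarith
  · by_cases hv0 : v = 0
    · simp [hv0]
    obtain ⟨x, hx⟩ := hunit v
    have hxv : (x : V) = ‖v‖⁻¹ • v := by
      nth_rewrite 2 [hx hv0]; rw [inv_smul_smul₀ (norm_ne_zero_iff.2 hv0)]
    refine hmem fun t => ?_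
    obtain ⟨θ, hθ⟩ := exists_blockRot_of_mem_preservingGroup hG hF (hφ t) (i := i) x
      (hxv ▸ (block J i).smul_mem _ hv)
    have h1 : L t v = blockRot J i θ v := by
      rw [hx hv0, map_smul, ← hL, hθ]
      simp only [blockRot, map_smul]
      module
    rw [h1]
    exact Submodule.mem_span_pair.2 ⟨_, _, rfl⟩
  · refine hmem fun t => ?_
    obtain ⟨θ, hθ⟩ := exists_cos_sin_of_mem_preservingGroup hG hF (hφ t)
      ⟨v, by simpa using hv1⟩ hv hq hq1 hvq
    rw [← hL t ⟨v, by simpa using hv1⟩, hθ]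
    exact Submodule.mem_span_pair.2 ⟨_, _, rfl⟩

/-- The tangent fields of the sphere given by the combinations of the `J i`. -/
theorem exists_tangentField (hJ : IsBlockFamily J) :
    ∃ Ψ : (ι → ℝ) →ₗ[ℝ] (∀ x : Metric.sphere (0 : V) 1, TangentSpace (𝓡 n) x),
      ∀ μ x, sphereIncl x (Ψ μ x) = blockField J μ x := by
  choose Y hY using fun (μ : ι → ℝ) (x : Metric.sphere (0 : V) 1) =>
    (exists_sphereIncl_eq_iff (n := n) x (blockField J μ x)).2 (hJ.skew_blockField μ x)
  refine ⟨⟨⟨Y, fun μ ν => funext fun x => sphereIncl_injective x ?_⟩,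
    fun c μ => funext fun x => sphereIncl_injective x ?_⟩, hY⟩
  · rw [hY, Pi.add_apply, sphereIncl_add, hY, hY]
    simp [blockField, add_smul, Finset.sum_add_distrib]
  · change sphereIncl x (Y (c • μ) x) = sphereIncl x (c • Y μ x)
    rw [hY, sphereIncl_smul, hY]
    simp [blockField, mul_smul, Finset.smul_sum]

/-- Sending μ to the field ∑ μᵢ Jᵢ identifies ℝ^ι with the Lie algebra; injectivity is seen by
evaluating at a unit vector of each block. -/
theorem lieAlgebra_preservingGroup (hn : 1 ≤ n) (hG : IsGenericFamily J lam)
    (hF : ∀ x y, F x y = randersNorm (blockField J lam) x (sphereIncl x y)) :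
    FiniteDimensional ℝ (lieAlgebra (EuclideanSpace ℝ (Fin n)) (preservingGroup F)) ∧
      Module.finrank ℝ (lieAlgebra (EuclideanSpace ℝ (Fin n)) (preservingGroup F)) =
        Fintype.card ι := by
  obtain ⟨Ψ, hΨ⟩ := exists_tangentField (n := n) hG.toIsBlockFamily
  have h1 : lieAlgebra (EuclideanSpace ℝ (Fin n)) (preservingGroup F) = LinearMap.range Ψ := by
    refine le_antisymm (Submodule.span_le.2 ?_) ?_
    · rintro X ⟨φ, -, hφ, hφ0, -, hX⟩
      obtain ⟨μ, hμ⟩ := generator_preservingGroup hn hG hF hφ hφ0 hX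
      exact ⟨μ, funext fun x => sphereIncl_injective x ((hΨ μ x).trans (hμ x).symm)⟩
    · rintro _ ⟨μ, rfl⟩
      have hS := hG.isIsometryFlow μ
      exact Submodule.subset_span ⟨hS.sphereFlow, hS.continuous_sphereFlow,
        sphereFlow_mem_preservingGroup hG hF μ, hS.sphereFlow_zero, hS.sphereFlow_add,
        hS.isMIntegralCurve_sphereFlow (hΨ μ)⟩
  have h2 : Function.Injective Ψ := by
    rw [← LinearMap.ker_eq_bot, LinearMap.ker_eq_bot']
    intro μ hμ
    funext i
    obtain ⟨p, hp, hp1⟩ := hG.nontrivial i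
    have h3 := hΨ μ ⟨p, by simpa using hp1⟩
    have h4 := hΨ 0 ⟨p, by simpa using hp1⟩
    rw [hμ, ← map_zero Ψ, h4] at h3
    have h5 : blockField J μ p = μ i • J i p := by
      simp only [blockField, sum_apply, smul_apply]
      rw [Finset.sum_eq_single i _ (by simp)]
      exact fun j _ hj => by rw [hG.apply_eq_zero hj hp, smul_zero]
    have h6 : μ i • J i p = 0 := by
      rw [← h5, ← h3]; simp [blockField]
    refine (smul_eq_zero.1 h6).resolve_right fun h => ?_
    have := hG.norm_apply_of_mem hp
    rw [h, hp1, norm_zero] at this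
    exact zero_ne_one this
  rw [h1]
  exact ⟨inferInstance, by rw [LinearMap.finrank_range_of_inj h2, Module.finrank_fintype_fun_eq_card]⟩

end LieAlgebra

/-- Both sides equal the number of blocks. Distinct blocks have distinct spheres because they meet
only in 0. -/
theorem IsGenericFamily.main (hn : 1 ≤ n) (hG : IsGenericFamily J lam)
    (hF : ∀ x y, F x y = randersNorm (blockField J lam) x (sphereIncl x y)) :
    AssumptionF F ∧
    FiniteDimensional ℝ (lieAlgebra (EuclideanSpace ℝ (Fin n)) (preservingGroup F)) ∧
    {B : Set (Metric.sphere (0 : V) 1) | ∃ 𝓑 ∈ primeOrbits F, B = unionOfCurves 𝓑 ∧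
      IsTotallyGeodesic F B ∧ ∃ g ∈ connPreservingGroup F, ∃ x ∈ B, g x ≠ x}.encard =
      Module.finrank ℝ (lieAlgebra (EuclideanSpace ℝ (Fin n)) (preservingGroup F)) := by
  obtain ⟨h1, h2⟩ := lieAlgebra_preservingGroup hn hG hF
  refine ⟨hG.assumptionF hF, h1, ?_⟩
  have hinj : Function.Injective (blockSphere J) := fun i j hij => by
    by_contra h
    obtain ⟨p, hp, hp1⟩ := hG.nontrivial i
    have h3 : (⟨p, by simpa using hp1⟩ : Metric.sphere (0 : V) 1) ∈ blockSphere J j := hij ▸ hp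
    have h4 := hG.disjoint_block h hp h3
    simp [h4] at hp1
  rw [unionOfCurves_eq_range hG hF, h2, ← image_univ, hinj.encard_image, encard_univ,
    ENat.card_eq_coe_fintype_card]

end Finsler

/-! ### Arithmetic of the speeds and the complex structures of the Katok space -/

namespace Finsler

open Set Filter Topology MeasureTheory

section Extension

variable {V : Type*} [NormedAddCommGroup V] [InnerProductSpace ℝ V] {ι : Type*}
  {J : ι → V →L[ℝ] V} {u v : V}

theorem planeField_planeField (hu : ‖u‖ = 1) (hv : ‖v‖ = 1) (huv : inner ℝ u v = 0) (x : V) :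
    planeField u v (planeField u v x) = -(inner ℝ u x • u + inner ℝ v x • v) := by
  simp only [planeField_apply, inner_sub_right, inner_smul_right,
    real_inner_self_eq_norm_sq, hu, hv, huv, real_inner_comm u v]
  module

/-- A block family together with the rotation in a plane of its common kernel. -/
noncomputable def optionFamily (J : ι → V →L[ℝ] V) (u v : V) (o : Option ι) : V →L[ℝ] V :=
  o.elim (planeField u v) J

theorem IsBlockFamily.optionFamily (hJ : IsBlockFamily J) (hu : ‖u‖ = 1) (hv : ‖v‖ = 1)
    (huv : inner ℝ u v = 0) (hur : u ∈ residual J) (hvr : v ∈ residual J) :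
    IsBlockFamily (optionFamily J u v) := by
  have e : ∀ i {y z : V}, y ∈ residual J → inner ℝ y (J i z) = 0 := fun i y z h => by
    rw [← neg_neg (inner ℝ y _), ← hJ.skew, mem_residual.1 h]; simp
  refine ⟨fun o x y => ?_, fun o x => ?_, fun o o' h x => ?_⟩
  · rcases o with _ | i
    · simp only [Finsler.optionFamily, Option.elim, planeField_apply, inner_sub_left,
        inner_sub_right, inner_smul_left, inner_smul_right, RCLike.conj_to_real,
        real_inner_comm x u, real_inner_comm x v]
      ring
    · exact hJ.skew i x y
  · rcases o with _ | i
    · simp only [Finsler.optionFamily, Option.elim, planeField_planeField hu hv huv]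
      simp only [planeField_apply, inner_add_right, inner_neg_right, inner_smul_right,
        real_inner_self_eq_norm_sq, hu, hv, huv, real_inner_comm u v]
      module
    · exact hJ.cube i x
  · rcases o with _ | i <;> rcases o' with _ | j
    · exact (h rfl).elim
    · simp [Finsler.optionFamily, planeField_apply, e j hur, e j hvr]
    · simp [Finsler.optionFamily, planeField_apply, mem_residual.1 hur, mem_residual.1 hvr]
    · exact hJ.orth i j (fun h' => h (congrArg some h')) x

end Extension

section Arithmetic

theorem eq_zero_of_linearIndependent {x y : ℝ} (h : LinearIndependent ℚ ![(1 : ℝ), x, y])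
    {a b c : ℤ} (habc : (a : ℝ) + b * x + c * y = 0) : b = 0 ∧ c = 0 := by
  have h1 := Fintype.linearIndependent_iff.1 h ![(a : ℚ), b, c] (by
    simpa [Fin.sum_univ_three, Rat.smul_def] using habc)
  exact ⟨by simpa using h1 1, by simpa using h1 2⟩

/-- The speeds `λᵢ ± 1` of distinct blocks have irrational quotients. -/
theorem eq_zero_of_mul_add_eq {ι : Type*} {lam : ι → ℝ} (hlam : ∀ i, 0 ≤ lam i ∧ lam i < 1)
    (hrat : ∀ i j, ¬ Irrational (lam i) → ¬ Irrational (lam j) → i = j)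
    (hirr : ∀ i j, i ≠ j → Irrational (lam i) → Irrational (lam j) → ∀ a b c : ℤ,
      (a : ℝ) + b * lam i + c * lam j = 0 → b = 0)
    (i j : ι) (hij : i ≠ j) (ε ε' : ℝ) (hε : ε = 1 ∨ ε = -1) (hε' : ε' = 1 ∨ ε' = -1) (m m' : ℤ)
    (h : m * (lam i + ε) = m' * (lam j + ε')) : m = 0 := by
  have hint : ∀ {ε : ℝ}, (ε = 1 ∨ ε = -1) → ∃ e : ℤ, ε = e := by
    rintro _ (rfl | rfl)
    exacts [⟨1, by simp⟩, ⟨-1, by simp⟩]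
  have hne : lam i + ε ≠ 0 := by
    have := hlam i
    rcases hε with rfl | rfl <;> intro h <;> linarith
  obtain ⟨e, rfl⟩ := hint hε
  obtain ⟨e', rfl⟩ := hint hε'
  have hq : ∀ (x : ℝ) (e a : ℤ) (q : ℚ), (a : ℝ) * (x + e) = q → Irrational x → a = 0 := by
    intro x e a q h hx
    by_contra h0
    have h0' : (a : ℝ) ≠ 0 := by exact_mod_cast h0
    refine hx ⟨q / a - e, ?_⟩
    push_cast
    rw [← h]
    field_simp
    ring
  -- Two irrational speeds contradict independence over ℚ unless m = 0; with just one irrational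
  -- speed its integer coefficient must vanish; two rational speeds belong to the same block.
  by_cases hi : Irrational (lam i) <;> by_cases hj : Irrational (lam j)
  · refine hirr i j hij hi hj (m * e - m' * e') m (-m') ?_
    push_cast
    linear_combination h
  · obtain ⟨q, hq'⟩ := not_not.1 hj
    exact hq _ e m (m' * (q + e')) (by push_cast; rw [h, hq']) hi
  · obtain ⟨q, hq'⟩ := not_not.1 hi
    have h1 := hq _ e' m' (m * (q + e)) (by push_cast; rw [← h, hq']) hj
    rw [h1, Int.cast_zero, zero_mul] at h
    exact_mod_cast (mul_eq_zero.1 h).resolve_right hne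
  · exact (hij (hrat i j hi hj)).elim

end Arithmetic

section Katok

variable {n₀ k : ℕ} {d : Fin k → ℕ}

theorem katokSpace_ext {x y : KatokSpace n₀ d} (h : x.fst = y.fst) (h' : ∀ j, x.snd j = y.snd j) :
    x = y :=
  (WithLp.ofLp_injective 2) (Prod.ext h (PiLp.ext h'))

/-- The complex structure of the `i`-th complex summand. -/
noncomputable def complexStructure (n₀ : ℕ) {k : ℕ} (d : Fin k → ℕ) (i : Fin k) :
    KatokSpace n₀ d →L[ℝ] KatokSpace n₀ d :=
  LinearMap.toContinuousLinearMap
    { toFun := fun x => WithLp.toLp 2 (0, WithLp.toLp 2 fun j =>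
        if j = i then Complex.I • x.snd j else 0)
      map_add' := fun x y => katokSpace_ext (by simp) fun j => by
        by_cases h : j = i <;> simp [h]
      map_smul' := fun c x => katokSpace_ext (by simp) fun j => by
        by_cases h : j = i
        · simpa [h] using smul_comm Complex.I c (x.snd j)
        · simp [h] }

@[simp] theorem complexStructure_fst (i : Fin k) (x : KatokSpace n₀ d) :
    (complexStructure n₀ d i x).fst = 0 := rfl

@[simp] theorem complexStructure_snd (i j : Fin k) (x : KatokSpace n₀ d) :
    (complexStructure n₀ d i x).snd j = if j = i then Complex.I • x.snd j else 0 := rfl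

theorem inner_katokSpace (x y : KatokSpace n₀ d) :
    inner ℝ x y = inner ℝ x.fst y.fst + ∑ j, inner ℝ (x.snd j) (y.snd j) := by
  rw [WithLp.prod_inner_apply]
  exact congrArg₂ _ rfl (PiLp.inner_apply _ _)

theorem inner_I_smul {m : ℕ} (a b : EuclideanSpace ℂ (Fin m)) :
    inner ℝ (Complex.I • a) b = -inner ℝ a (Complex.I • b) := by
  simp only [PiLp.inner_apply, ← Finset.sum_neg_distrib]
  refine Finset.sum_congr rfl fun j _ => ?_
  simp [Complex.inner]
  ring

theorem I_smul_I_smul {m : ℕ} (a : EuclideanSpace ℂ (Fin m)) :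
    Complex.I • Complex.I • a = -a := by
  rw [smul_smul, Complex.I_mul_I, neg_one_smul]

theorem isBlockFamily_complexStructure : IsBlockFamily (complexStructure n₀ d) := by
  refine ⟨fun i x y => ?_, fun i x => ?_, fun i j hij x => ?_⟩
  · rw [inner_katokSpace, inner_katokSpace, neg_add, ← Finset.sum_neg_distrib]
    congr 1
    · simp
    · refine Finset.sum_congr rfl fun j _ => ?_
      by_cases h : j = i <;> simp [h, inner_I_smul]
  · refine katokSpace_ext (by simp) fun j => ?_
    by_cases h : j = i <;> simp [h, I_smul_I_smul]
  · refine katokSpace_ext (by simp) fun l => ?_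
    by_cases h : l = i <;> by_cases h' : l = j
    · exact (hij (h.symm.trans h')).elim
    all_goals simp [h, h', hij, hij.symm]

theorem mem_block_complexStructure {i : Fin k} {x : KatokSpace n₀ d} :
    x ∈ block (complexStructure n₀ d) i ↔ x.fst = 0 ∧ ∀ j, j ≠ i → x.snd j = 0 := by
  rw [mem_block]
  constructor
  · intro h
    refine ⟨?_, fun j hj => ?_⟩
    · have := congrArg WithLp.fst h
      simpa using this.symm
    · have := congrArg (fun y : KatokSpace n₀ d => y.snd j) h
      simpa [hj] using this.symm
  · rintro ⟨h0, h1⟩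
    refine katokSpace_ext (by simp [h0]) fun j => ?_
    by_cases h : j = i
    · simp [h, I_smul_I_smul]
    · simp [h, h1 j h]

theorem mem_residual_complexStructure {x : KatokSpace n₀ d} :
    x ∈ residual (complexStructure n₀ d) ↔ ∀ j, x.snd j = 0 := by
  rw [mem_residual]
  constructor
  · intro h j
    have := congrArg (fun y : KatokSpace n₀ d => y.snd j) (h j)
    simpa using this
  · intro h i
    refine katokSpace_ext (by simp) fun j => ?_
    simp [h j]

theorem inner_of_mem_residual {x y : KatokSpace n₀ d}
    (hx : x ∈ residual (complexStructure n₀ d)) : inner ℝ x y = inner ℝ x.fst y.fst := by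
  rw [inner_katokSpace, Finset.sum_eq_zero fun j _ => ?_, add_zero]
  rw [mem_residual_complexStructure.1 hx, inner_zero_left]

theorem inner_of_mem_block {i : Fin k} {x y : KatokSpace n₀ d}
    (hx : x ∈ block (complexStructure n₀ d) i) :
    inner ℝ x y = inner ℝ (x.snd i) (y.snd i) := by
  obtain ⟨h0, h1⟩ := mem_block_complexStructure.1 hx
  rw [inner_katokSpace, h0, inner_zero_left, zero_add,
    Finset.sum_eq_single i (fun j _ hj => by rw [h1 j hj, inner_zero_left]) (by simp)]

theorem rotationField_eq_blockField (lam : Fin k → ℝ) (x : KatokSpace n₀ d) :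
    rotationField lam x = blockField (complexStructure n₀ d) lam x := by
  have hf : (blockField (complexStructure n₀ d) lam x).fst =
      ∑ i, lam i • (complexStructure n₀ d i x).fst := by
    simp only [blockField, sum_apply, smul_apply]
    exact map_sum (AddMonoidHom.mk' (fun y : KatokSpace n₀ d => y.fst) fun _ _ => rfl) _ _
  have hs : ∀ j, (blockField (complexStructure n₀ d) lam x).snd j =
      ∑ i, lam i • (complexStructure n₀ d i x).snd j := fun j => by
    simp only [blockField, sum_apply, smul_apply]
    exact map_sum (AddMonoidHom.mk' (fun y : KatokSpace n₀ d => y.snd j) fun _ _ => rfl) _ _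
  refine katokSpace_ext ?_ fun j => ?_
  · rw [hf]; simp [rotationField]
  · rw [hs, Finset.sum_eq_single j (fun i _ hi => by simp [hi.symm]) (by simp)]
    ext l
    simp [rotationField]
    ring

theorem exists_unit_mem_block {i : Fin k} (hd : 0 < d i) :
    ∃ x ∈ block (complexStructure n₀ d) i, ‖x‖ = 1 := by
  let y : KatokSpace n₀ d := WithLp.toLp 2 (0, WithLp.toLp 2 fun j =>
    if j = i then WithLp.toLp 2 fun l => if (l : ℕ) = 0 then 1 else 0 else 0)
  have hy : y ∈ block (complexStructure n₀ d) i :=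
    mem_block_complexStructure.2 ⟨rfl, fun j hj => if_neg hj⟩
  have hy0 : y ≠ 0 := fun h => by
    have := congrArg (fun y : KatokSpace n₀ d => y.snd i ⟨0, hd⟩) h
    simp [y] at this
  have hn : ‖y‖ ≠ 0 := norm_ne_zero_iff.2 hy0
  exact ⟨‖y‖⁻¹ • y, (block _ i).smul_mem _ hy,
    by rw [norm_smul, norm_inv, norm_norm, inv_mul_cancel₀ hn]⟩

/-- For d i = 1 the vectors are complex numbers a and b, and the two conditions say that the real
and imaginary parts of the product of b with the conjugate of a vanish. -/
theorem eq_zero_or_eq_zero_of_mem_block {i : Fin k} (hd : d i = 1) {x y : KatokSpace n₀ d}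
    (hx : x ∈ block (complexStructure n₀ d) i) (hy : y ∈ block (complexStructure n₀ d) i)
    (hxy : inner ℝ x y = 0) (hxy' : inner ℝ (complexStructure n₀ d i x) y = 0) :
    x = 0 ∨ y = 0 := by
  have : Unique (Fin (d i)) := by rw [hd]; infer_instance
  have h0 : ∀ {z : KatokSpace n₀ d}, z ∈ block (complexStructure n₀ d) i →
      z.snd i default = 0 → z = 0 := by
    intro z hz h
    obtain ⟨h0, h1⟩ := mem_block_complexStructure.1 hz
    refine katokSpace_ext h0 fun j => ?_
    by_cases hj : j = i
    · subst hj
      refine PiLp.ext fun l => ?_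
      rw [Unique.eq_default l, h]
      rfl
    · exact h1 j hj
  rw [inner_of_mem_block hx, PiLp.inner_apply, Fintype.sum_unique, Complex.inner] at hxy
  rw [inner_of_mem_block (isBlockFamily_complexStructure.apply_mem_block i x), PiLp.inner_apply,
    Fintype.sum_unique, Complex.inner] at hxy'
  set a := x.snd i default with ha
  set b := y.snd i default with hb
  have h1 : (starRingEnd ℂ) a * b = 0 := by
    refine Complex.ext ?_ ?_
    · simp at hxy ⊢
      linarith
    · simp [← ha] at hxy' ⊢
      linarith
  rcases mul_eq_zero.1 h1 with h | h
  · exact .inl (h0 hx ((map_eq_zero _).1 h))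
  · exact .inr (h0 hy h)

/-- An orthonormal pair forces n₀ ≥ 2, so excluding n₀ = 2 leaves a third dimension; for n₀ ≤ 1
there is no such pair. -/
theorem exists_orthogonal_of_mem_residual (hn₀ : n₀ ≠ 2) {x y : KatokSpace n₀ d}
    (hx : x ∈ residual (complexStructure n₀ d)) (hy : y ∈ residual (complexStructure n₀ d))
    (hx1 : ‖x‖ = 1) (hy1 : ‖y‖ = 1) (hxy : inner ℝ x y = 0) :
    ∃ z ∈ residual (complexStructure n₀ d), ‖z‖ = 1 ∧ inner ℝ x z = 0 ∧ inner ℝ y z = 0 := by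
  have e1 : ∀ {z : KatokSpace n₀ d}, z ∈ residual (complexStructure n₀ d) → ‖z‖ = ‖z.fst‖ := by
    intro z hz
    have := inner_of_mem_residual (y := z) hz
    rw [real_inner_self_eq_norm_sq, real_inner_self_eq_norm_sq] at this
    exact (pow_left_inj₀ (norm_nonneg _) (norm_nonneg _) two_ne_zero).1 this
  rw [inner_of_mem_residual hx] at hxy
  have ho : Orthonormal ℝ ![x.fst, y.fst] := by
    rw [orthonormal_vecCons_iff]
    refine ⟨(e1 hx).symm.trans hx1, fun i => by simpa using hxy, ?_⟩
    rw [orthonormal_vecCons_iff]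
    exact ⟨(e1 hy).symm.trans hy1, fun i => i.elim0, Orthonormal.of_isEmpty _⟩
  have h2 : 2 ≤ n₀ := by
    simpa using ho.linearIndependent.fintype_card_le_finrank
  set S := Submodule.span ℝ (range ![x.fst, y.fst]) with hS
  have hf : Module.finrank ℝ S = 2 := by
    simpa using finrank_span_eq_card ho.linearIndependent
  have h3 : Sᗮ ≠ ⊥ := by
    intro h0
    have h4 := Submodule.finrank_add_finrank_orthogonal S
    rw [h0, finrank_bot, hf, finrank_euclideanSpace_fin] at h4
    omega
  obtain ⟨w, hw, hw0⟩ := Submodule.exists_mem_ne_zero_of_ne_bot h3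
  have hn : ‖w‖ ≠ 0 := norm_ne_zero_iff.2 hw0
  have hz : (WithLp.toLp 2 (‖w‖⁻¹ • w, 0) : KatokSpace n₀ d) ∈ residual (complexStructure n₀ d) :=
    mem_residual_complexStructure.2 fun j => rfl
  refine ⟨_, hz, ?_, ?_, ?_⟩
  · rw [e1 hz]
    change ‖‖w‖⁻¹ • w‖ = 1
    rw [norm_smul, norm_inv, norm_norm, inv_mul_cancel₀ hn]
  · rw [inner_of_mem_residual hx]
    change inner ℝ x.fst (‖w‖⁻¹ • w) = 0
    rw [inner_smul_right, (Submodule.mem_orthogonal S w).1 hw x.fst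
      (Submodule.subset_span ⟨0, rfl⟩), mul_zero]
  · rw [inner_of_mem_residual hy]
    change inner ℝ y.fst (‖w‖⁻¹ • w) = 0
    rw [inner_smul_right, (Submodule.mem_orthogonal S w).1 hw y.fst
      (Submodule.subset_span ⟨1, rfl⟩), mul_zero]

end Katok

end Finsler

/-! ### Verification of the generic conditions -/

namespace Finsler

open Set Filter Topology MeasureTheory

section Extension

variable {V : Type*} [NormedAddCommGroup V] [InnerProductSpace ℝ V] {ι : Type*} [Fintype ι]
  {J : ι → V →L[ℝ] V} {u v : V}

/-- The additional block has speed 0, so the wind, and with it F, is unchanged. -/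
theorem blockField_optionFamily (J : ι → V →L[ℝ] V) (u v : V) (lam : ι → ℝ) :
    blockField (optionFamily J u v) (fun o => o.elim 0 lam) = blockField J lam := by
  simp [blockField, Fintype.sum_option, optionFamily]

end Extension

variable {n₀ k : ℕ} {d : Fin k → ℕ} {lam : Fin k → ℝ}

theorem isGenericFamily_complexStructure (hd : ∀ i, 0 < d i) (hlam : ∀ i, 0 < lam i ∧ lam i < 1)
    (hn₀ : n₀ ≠ 2)
    (hrat : ∀ i j, ¬ Irrational (lam i) → ¬ Irrational (lam j) → i = j)
    (hirr : ∀ i j, i ≠ j → Irrational (lam i) → Irrational (lam j) → ∀ a b c : ℤ,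
      (a : ℝ) + b * lam i + c * lam j = 0 → b = 0)
    (hline : ∀ i, ¬ Irrational (lam i) → d i = 1) (hres : n₀ ≠ 0 → ∀ i, Irrational (lam i)) :
    IsGenericFamily (complexStructure n₀ d) lam where
  toIsBlockFamily := isBlockFamily_complexStructure
  nonneg_lt_one i := ⟨(hlam i).1.le, (hlam i).2⟩
  nontrivial i := exists_unit_mem_block (hd i)
  irrational_or_line i := or_iff_not_imp_left.2 fun h _ hx _ hy =>
    eq_zero_or_eq_zero_of_mem_block (hline i h) hx hy
  indep := eq_zero_of_mul_add_eq (fun i => ⟨(hlam i).1.le, (hlam i).2⟩) hrat hirr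
  irrational_of_residual x hx hx0 := hres <| by
    rintro rfl
    exact hx0 (katokSpace_ext (Subsingleton.elim _ _) (mem_residual_complexStructure.1 hx))
  exists_orthogonal _ hx _ hy := exists_orthogonal_of_mem_residual hn₀ hx hy

/-- For n₀ = 2 the real summand becomes a block with the rotation of the plane as complex structure.
Its speed 0 is the only rational one and the block is a single complex line. The common kernel is
now 0, so the conditions on it hold trivially. -/
theorem isGenericFamily_optionFamily {d : Fin k → ℕ} (hd : ∀ i, 0 < d i)
    (hlam : ∀ i, 0 < lam i ∧ lam i < 1)
    (hirr' : ∀ i, Irrational (lam i))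
    (hirr : ∀ i j, i ≠ j → Irrational (lam i) → Irrational (lam j) → ∀ a b c : ℤ,
      (a : ℝ) + b * lam i + c * lam j = 0 → b = 0) :
    ∃ u v, IsGenericFamily (optionFamily (complexStructure 2 d) u v) fun o => o.elim 0 lam := by
  let e : Fin 2 → KatokSpace 2 d := fun a => WithLp.toLp 2 (EuclideanSpace.single a 1, 0)
  have her : ∀ a, e a ∈ residual (complexStructure 2 d) := fun a =>
    mem_residual_complexStructure.2 fun j => rfl
  have hin : ∀ a (x : KatokSpace 2 d), inner ℝ (e a) x = x.fst a := fun a x => by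
    rw [inner_of_mem_residual (her a)]
    change inner ℝ (EuclideanSpace.single a (1 : ℝ)) x.fst = _
    simp [EuclideanSpace.inner_single_left]
  have hself : ∀ a, ‖e a‖ = 1 := fun a => by
    have h : inner ℝ (e a) (e a) = 1 := by rw [hin]; simp [e]
    rw [real_inner_self_eq_norm_sq] at h
    exact (pow_left_inj₀ (norm_nonneg _) zero_le_one two_ne_zero).1 (by rw [h, one_pow])
  have h01 : inner ℝ (e 0) (e 1) = 0 := by rw [hin]; simp [e]
  have hJ := isBlockFamily_complexStructure.optionFamily (hself 0) (hself 1) h01 (her 0) (her 1)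
  have hres : ∀ x ∈ residual (optionFamily (complexStructure 2 d) (e 0) (e 1)), x = 0 := by
    intro x hx
    rw [mem_residual] at hx
    have h1 : planeField (e 0) (e 1) x = 0 := hx none
    have h2 := planeField_planeField (hself 0) (hself 1) h01 x
    rw [h1, map_zero, hin, hin] at h2
    have h3 : ∀ a, x.fst a = 0 := by
      have h4 := congrArg (inner ℝ (e 0)) h2
      have h5 := congrArg (inner ℝ (e 1)) h2
      simp only [inner_zero_right, inner_neg_right, inner_add_right, inner_smul_right,
        real_inner_self_eq_norm_sq, hself, h01, real_inner_comm (e 0) (e 1)] at h4 h5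
      rw [Fin.forall_fin_two]
      exact ⟨by linarith, by linarith⟩
    refine katokSpace_ext (PiLp.ext h3) ?_
    exact mem_residual_complexStructure.1 (mem_residual.2 fun i => hx (some i))
  have hlam' : ∀ o : Option (Fin k), 0 ≤ o.elim 0 lam ∧ o.elim 0 lam < 1
    | none => ⟨le_rfl, zero_lt_one⟩
    | some i => ⟨(hlam i).1.le, (hlam i).2⟩
  have hrat0 : ∀ o : Option (Fin k), ¬ Irrational (o.elim 0 lam) → o = none
    | none, _ => rfl
    | some i, h => (h (hirr' i)).elim
  refine ⟨e 0, e 1, hJ, hlam', ?_, ?_, ?_, fun x hx hx0 => (hx0 (hres x hx)).elim,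
    fun x hx _ _ hx1 => by simp [hres x hx] at hx1⟩
  · rintro (_ | i)
    · refine ⟨e 0, mem_block.2 ?_, hself 0⟩
      refine (planeField_planeField (hself 0) (hself 1) h01 _).trans ?_
      rw [real_inner_self_eq_norm_sq, hself, real_inner_comm, h01]
      simp
    · exact exists_unit_mem_block (hd i)
  · rintro (_ | i)
    · right
      intro x hx y hy hxy hxy'
      have hb : ∀ {z}, z ∈ block (optionFamily (complexStructure 2 d) (e 0) (e 1)) none →
          z = z.fst 0 • e 0 + z.fst 1 • e 1 := fun {z} hz => by
        have h1 : planeField (e 0) (e 1) (planeField (e 0) (e 1) z) = -z := mem_block.1 hz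
        rw [planeField_planeField (hself 0) (hself 1) h01, hin, hin] at h1
        exact (neg_injective h1).symm
      have h1 : inner ℝ (planeField (e 0) (e 1) x) y = 0 := hxy'
      rw [planeField_apply, inner_sub_left, inner_smul_left, inner_smul_left, hin, hin, hin,
        hin] at h1
      rw [hb hx, inner_add_left, inner_smul_left, inner_smul_left, hin, hin] at hxy
      simp only [RCLike.conj_to_real] at h1 hxy
      -- Lagrange's identity: |x|² |y|² is the sum of the squares of the inner product and the
      -- determinant, both zero here.
      have h2 : (x.fst 0 ^ 2 + x.fst 1 ^ 2) * (y.fst 0 ^ 2 + y.fst 1 ^ 2) = 0 := by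
        linear_combination (x.fst 0 * y.fst 0 + x.fst 1 * y.fst 1) * hxy +
          (x.fst 0 * y.fst 1 - x.fst 1 * y.fst 0) * h1
      have h3 : ∀ {a b : ℝ}, a ^ 2 + b ^ 2 = 0 → a = 0 ∧ b = 0 := fun h =>
        ⟨by nlinarith, by nlinarith⟩
      rcases mul_eq_zero.1 h2 with h | h
      · left; rw [hb hx, (h3 h).1, (h3 h).2]; simp
      · right; rw [hb hy, (h3 h).1, (h3 h).2]; simp
    · exact .inl (hirr' i)
  · refine eq_zero_of_mul_add_eq hlam' (fun o o' h h' => (hrat0 o h).trans (hrat0 o' h').symm) ?_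
    rintro (_ | i) (_ | j) hij hi hj a b c h
    · exact (hij rfl).elim
    · exact (hi ⟨0, by simp⟩).elim
    · exact (hj ⟨0, by simp⟩).elim
    · exact hirr i j (fun h => hij (congrArg some h)) hi hj a b c h

end Finsler

/-! ### The theorem -/

open Finsler in
theorem mainTheorem2 (n : ℕ) (hn : 1 < n) (n₀ k : ℕ) (d : Fin k → ℕ) (hd : ∀ i, 0 < d i)
    [Fact (Module.finrank ℝ (Finsler.KatokSpace n₀ d) = n + 1)]
    (lam : Fin k → ℝ) (hlam : ∀ i, 0 < lam i ∧ lam i < 1) (hmono : StrictMono lam)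
    (hgen : Finsler.ConditionA4 lam ∨ Finsler.ConditionA5 n₀ d lam)
    (W : ∀ x : Metric.sphere (0 : Finsler.KatokSpace n₀ d) 1, TangentSpace (𝓡 n) x)
    (hW : ∀ x, Finsler.sphereIncl x (W x) = Finsler.rotationField lam x.1)
    (F : ∀ x : Metric.sphere (0 : Finsler.KatokSpace n₀ d) 1, TangentSpace (𝓡 n) x → ℝ)
    (hF : F = Finsler.randersMetric Finsler.roundMetric W) :
    Finsler.AssumptionF F ∧
    FiniteDimensional ℝ
      (Finsler.lieAlgebra (EuclideanSpace ℝ (Fin n)) (Finsler.preservingGroup F)) ∧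
    {B : Set (Metric.sphere (0 : Finsler.KatokSpace n₀ d) 1) |
        ∃ 𝓑 ∈ Finsler.primeOrbits F, B = Finsler.unionOfCurves 𝓑 ∧
          Finsler.IsTotallyGeodesic F B ∧
          ∃ g ∈ Finsler.connPreservingGroup F, ∃ x ∈ B, g x ≠ x}.encard =
      Module.finrank ℝ
        (Finsler.lieAlgebra (EuclideanSpace ℝ (Fin n)) (Finsler.preservingGroup F)) := by
  have hrat : ∀ i j, ¬ Irrational (lam i) → ¬ Irrational (lam j) → i = j := by
    rcases hgen with h | h
    · exact fun i _ hi => (hi (h.1 i)).elim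
    · exact fun i j hi hj => h.2.1.unique hi hj
  have hirr : ∀ i j, i ≠ j → Irrational (lam i) → Irrational (lam j) → ∀ a b c : ℤ,
      (a : ℝ) + b * lam i + c * lam j = 0 → b = 0 := by
    have hLI : ∀ i j, i < j → Irrational (lam i) → Irrational (lam j) →
        LinearIndependent ℚ ![(1 : ℝ), lam i, lam j] := by
      rcases hgen with h | h
      · exact fun i j hij _ _ => h.2 i j hij
      · exact h.2.2.2
    intro i j hij hi hj a b c h
    rcases lt_or_gt_of_ne hij with h' | h'
    · exact (eq_zero_of_linearIndependent (hLI i j h' hi hj) h).1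
    · exact (eq_zero_of_linearIndependent (hLI j i h' hj hi) (a := a) (b := c) (c := b)
        (by linarith)).2
  have hFA : ∀ x y, F x y = randersNorm (blockField (complexStructure n₀ d) lam) x
      (sphereIncl x y) := fun x y => by
    rw [hF]
    exact randersMetric_roundMetric (fun x => by rw [hW, rotationField_eq_blockField]) x y
  -- For n₀ = 2 condition (A5) is impossible, as it requires n₀ = 0; so all speeds are irrational
  -- and the plane can be added as a block.
  by_cases hn₀ : n₀ = 2
  · subst hn₀
    have hA4 : ConditionA4 lam := hgen.resolve_right fun h => two_ne_zero h.1
    obtain ⟨u, v, hG⟩ := isGenericFamily_optionFamily hd hlam hA4.1 hirr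
    exact hG.main hn.le (by rw [blockField_optionFamily]; exact hFA)
  · refine (isGenericFamily_complexStructure hd hlam hn₀ hrat hirr ?_ ?_).main hn.le hFA
    · rcases hgen with h | h
      · exact fun i hi => (hi (h.1 i)).elim
      · exact h.2.2.1
    · exact fun h0 => hgen.elim (fun h => h.1) fun h => (h0 h.1).elim
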